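/- \textbf{Proposition (Duhamel's principle in a time-dependent domain).} Let $\nu\ge 0$, $\ell_0>0$, and let $\ell\colon[0,+\infty)\to[\ell_0,+\infty)$ be Lipschitz with $\ell(0)=\ell_0$ and $0\le\dot\ell(t)\le 1$ for a.e. $t\ge0$. Put $\varphi(t)=t-\ell(t)$, $\psi(t)=t+\ell(t)$ and $\omega=\varphi\circ\psi^{-1}\colon[\ell_0,+\infty)\to[-\ell_0,+\infty)$. Let $\Omega=\{(t,x)\mid t>0,\ 0<x<\ell(t)\}$ and $$\Omega'_1=\{(t,x)\in\Omega\mid t\le x,\ t+x\le\ell_0\},\quad \Omega'_2=\{(t,x)\in\Omega\mid t>x,\ t+x<\ell_0\},\quad \Omega'_3=\{(t,x)\in\Omega\mid t<x,\ t+x>\ell_0\},$$ $$\Omega'=\Omega'_1\cup\Omega'_2\cup\Omega'_3,\qquad \Omega'_T=\{(t,x)\in\Omega'\mid t<T\}.$$ Let $z\colon[0,+\infty)\to\mathbb R$ belong to $H^1(0,b)$ for every $b>0$, let $v_0\in H^1(0,\ell_0)$ and $v_1\in L^2(0,\ell_0)$ (where $z$ and $v_0$ are identified with their continuous representatives on $[0,+\infty)$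 and $[0,\ell_0]$), and assume $v_0(0)=z(0)$ and $v_0(\ell_0)=0$. Let $\widetilde H^1(\Omega')$ be the space of all $v\in H^1_{\rm loc}(\Omega')$ with $v\in H^1(\Omega'_T)$ for every $T>0$. (Here $\Omega'$ is open up to the single point $(\ell_0/2,\ell_0/2)$; weak derivatives and distributions are understood in its interior.) A function $v\in\widetilde H^1(\Omega')$ is called a solution in $\Omega'$ of $$v_{tt}-v_{xx}-\tfrac{\nu^2}{4}v=0,\quad v(t,0)=z(t),\quad v(t,\ell(t))=0,\quad v(0,x)=v_0(x),\quad v_t(0,x)=v_1(x)\qquad(\ast)$$ if the equation holds in the sense of distributions in $\Omega'$; the boundary conditions hold in the sense of traces on the parts of the lines $x=0$ and $x=\ell(t)$ that bound $\Omega'$, that is, for $0<t<\ell_0$ and for those $t>0$ with $t<\ell(t)$, respectively; and the initial conditions on $v$ and $v_t$ hold in the sense of $L^2(0,\ell_0)$ and of $H^{-1}(0,\ell_0)$, respectively. For $(t,x)\in\Omega'$ let $$A(t,x)=\begin{cases} \frac12 v_0(x-t)+\frac12 v_0(x+t)+\frac12\int_{x-t}^{x+t}v_1(s)\,ds,&(t,x)\in\Omega'_1,\\[2pt]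 z(t-x)-\frac12 v_0(t-x)+\frac12 v_0(t+x)+\frac12\int_{t-x}^{t+x}v_1(s)\,ds,&(t,x)\in\Omega'_2,\\[2pt] \frac12 v_0(x-t)-\frac12 v_0(-\omega(x+t))+\frac12\int_{x-t}^{-\omega(x+t)}v_1(s)\,ds,&(t,x)\in\Omega'_3, \end{cases}$$ and let $$R(t,x)=\{(\tau,\sigma)\in\Omega'\mid 0<\tau<t,\ \gamma_1(\tau;t,x)<\sigma<\gamma_2(\tau;t,x)\},$$ where $\gamma_1(\tau;t,x)=|x-t+\tau|$ if $(t,x)\in\Omega'_2$ and $\gamma_1(\tau;t,x)=x-t+\tau$ otherwise, and where $\gamma_2(\tau;t,x)=\tau-\omega(t+x)$ if $(t,x)\in\Omega'_3$ and $\tau\le\psi^{-1}(t+x)$, and $\gamma_2(\tau;t,x)=x+t-\tau$ otherwise. Then a function $v\in\widetilde H^1(\Omega')$ is a solution of $(\ast)$ in $\Omega'$ if and only if $$v(t,x)=A(t,x)+\frac{\nu^2}{8}\iint_{R(t,x)}v(\tau,\sigma)\,d\sigma\,d\tau\qquad\text{for a.e. }(t,x)\in\Omega'.$$ -/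

import Mathlib

open Set Filter Topology MeasureTheory TopologicalSpace
open scoped ENNReal

namespace Debonding

noncomputable section

/-! ### Weak derivatives and Sobolev functions

Test functions are the elements of Mathlib's `TestFunction U ℝ ⊤`, that is, the smooth functions
with compact support contained in the open set `U`. -/

/-- `g` is the weak derivative of `f` in the direction `e` on the open set `U`. -/
def HasWeakDeriv {E : Type*} [NormedAddCommGroup E] [NormedSpace ℝ E] [MeasureSpace E]
    (U : Opens E) (e : E) (f g : E → ℝ) : Prop :=
  LocallyIntegrableOn f U ∧ LocallyIntegrableOn g U ∧
    ∀ φ : TestFunction U ℝ ⊤,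
      ∫ x in (U : Set E), f x * fderiv ℝ φ x e = -∫ x in (U : Set E), g x * φ x

/-- The open interval `(a, b)`. -/
def interval (a b : ℝ) : Opens ℝ := ⟨Ioo a b, isOpen_Ioo⟩

/-- `f ∈ H¹(a, b)`. -/
def MemH1 (a b : ℝ) (f : ℝ → ℝ) : Prop :=
  MemLp f 2 (volume.restrict (Ioo a b)) ∧
    ∃ g : ℝ → ℝ, MemLp g 2 (volume.restrict (Ioo a b)) ∧ HasWeakDeriv (interval a b) 1 f g

/-- The norm of `f` in `H⁻¹(a, b)`, the dual of `H¹₀(a, b)`, for `f ∈ L²(a, b)` acting by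
integration (test functions are dense in `H¹₀(a, b)`). -/
def negSobolevNorm (a b : ℝ) (f : ℝ → ℝ) : ℝ≥0∞ :=
  ⨆ (η : TestFunction (interval a b) ℝ ⊤)
    (_ : ∫ x in Ioo a b, ((η x) ^ 2 + (deriv η x) ^ 2) ≤ 1),
    ‖∫ x in Ioo a b, f x * η x‖ₑ

/-- The filter of the essential limit as a real variable tends to `0⁺`: null sets of values of the
variable are neglected. -/
def essZeroPlus : Filter ℝ := 𝓝[>] (0 : ℝ) ⊓ ae volume

/-! ### The debonding front and the domains

Points of the plane are pairs `(t, x)`: time first, space second. -/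

/-- `ℓ` is a Lipschitz function on `[0, ∞)` with values in `[ℓ₀, ∞)`, `ℓ 0 = ℓ₀`, and
`0 ≤ ℓ' ≤ 1` almost everywhere. -/
structure IsFront (ℓ₀ : ℝ) (ℓ : ℝ → ℝ) : Prop where
  lipschitz : ∃ K, LipschitzOnWith K ℓ (Ici 0)
  mapsTo : MapsTo ℓ (Ici 0) (Ici ℓ₀)
  zero : ℓ 0 = ℓ₀
  deriv_mem : ∀ᵐ t : ℝ, 0 < t → 0 ≤ deriv ℓ t ∧ deriv ℓ t ≤ 1

/-- `φ(t) = t - ℓ(t)`. -/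
def phi (ℓ : ℝ → ℝ) (t : ℝ) : ℝ := t - ℓ t

/-- `ψ(t) = t + ℓ(t)`. -/
def psi (ℓ : ℝ → ℝ) (t : ℝ) : ℝ := t + ℓ t

/-- The inverse `ψ⁻¹ : [ℓ₀, ∞) → [0, ∞)` of the bijection `ψ : [0, ∞) → [ℓ₀, ∞)`. -/
def psiInv (ℓ : ℝ → ℝ) : ℝ → ℝ := Function.invFunOn (psi ℓ) (Ici 0)

/-- `ω = φ ∘ ψ⁻¹`, on `[ℓ₀, ∞)`. -/
def omega (ℓ : ℝ → ℝ) (s : ℝ) : ℝ := phi ℓ (psiInv ℓ s)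

/-- `Ω = {(t, x) | t > 0, 0 < x < ℓ(t)}`. -/
def Omega (ℓ : ℝ → ℝ) : Set (ℝ × ℝ) := {p | 0 < p.1 ∧ 0 < p.2 ∧ p.2 < ℓ p.1}

/-- `Ω'₁`. -/
def Omega1 (ℓ₀ : ℝ) (ℓ : ℝ → ℝ) : Set (ℝ × ℝ) := {p ∈ Omega ℓ | p.1 ≤ p.2 ∧ p.1 + p.2 ≤ ℓ₀}

/-- `Ω'₂`. -/
def Omega2 (ℓ₀ : ℝ) (ℓ : ℝ → ℝ) : Set (ℝ × ℝ) := {p ∈ Omega ℓ | p.2 < p.1 ∧ p.1 + p.2 < ℓ₀}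

/-- `Ω'₃`. -/
def Omega3 (ℓ₀ : ℝ) (ℓ : ℝ → ℝ) : Set (ℝ × ℝ) := {p ∈ Omega ℓ | p.1 < p.2 ∧ ℓ₀ < p.1 + p.2}

/-- `Ω' = Ω'₁ ∪ Ω'₂ ∪ Ω'₃`. -/
def Omega' (ℓ₀ : ℝ) (ℓ : ℝ → ℝ) : Set (ℝ × ℝ) := Omega1 ℓ₀ ℓ ∪ Omega2 ℓ₀ ℓ ∪ Omega3 ℓ₀ ℓ

/-- `Ω'_T = {(t, x) ∈ Ω' | t < T}`. -/
def Omega'T (ℓ₀ : ℝ) (ℓ : ℝ → ℝ) (T : ℝ) : Set (ℝ × ℝ) := {p ∈ Omega' ℓ₀ ℓ | p.1 < T}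

/-- The interior of `Ω'`: it is `Ω'` without the point `(ℓ₀ / 2, ℓ₀ / 2)`. -/
def openOmega' (ℓ₀ : ℝ) (ℓ : ℝ → ℝ) : Opens (ℝ × ℝ) := ⟨interior (Omega' ℓ₀ ℓ), isOpen_interior⟩

/-- The space of the functions in `H¹_loc(Ω')` that belong to `H¹(Ω'_T)` for every `T > 0`: the weak
first derivatives exist on `Ω'`, and the function and its derivatives are in `L²(Ω'_T)`. -/
def MemHTilde1 (ℓ₀ : ℝ) (ℓ : ℝ → ℝ) (v : ℝ × ℝ → ℝ) : Prop :=
  ∃ vt vx : ℝ × ℝ → ℝ,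
    HasWeakDeriv (openOmega' ℓ₀ ℓ) (1, 0) v vt ∧ HasWeakDeriv (openOmega' ℓ₀ ℓ) (0, 1) v vx ∧
    ∀ T : ℝ, 0 < T →
      MemLp v 2 (volume.restrict (Omega'T ℓ₀ ℓ T)) ∧
      MemLp vt 2 (volume.restrict (Omega'T ℓ₀ ℓ T)) ∧
      MemLp vx 2 (volume.restrict (Omega'T ℓ₀ ℓ T))

/-! ### The initial boundary value problem -/

/-- `v_tt - v_xx - (ν² / 4) v = 0` in the sense of distributions on `U`. -/
def SolvesWaveEq (U : Opens (ℝ × ℝ)) (ν : ℝ) (v : ℝ × ℝ → ℝ) : Prop :=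
  ∀ φ : TestFunction U ℝ ⊤,
    ∫ p in (U : Set (ℝ × ℝ)),
      v p * (fderiv ℝ (fun q => fderiv ℝ φ q (1, 0)) p (1, 0)
        - fderiv ℝ (fun q => fderiv ℝ φ q (0, 1)) p (0, 1) - ν ^ 2 / 4 * φ p) = 0

/-- The trace of `v` on the part `{(t, γ(t)) | t ∈ I}` of the lateral boundary is `g`: the functions
`t ↦ v(t, γ(t) + s h)` converge to `g` in `L²_loc(I)` as `h → 0⁺`, where `s = 1` if the domain lies
to the right of the curve `x = γ(t)`, and `s = -1` if it lies to the left. For an `H¹` function on a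
one-sided neighbourhood of a Lipschitz curve this limit is the trace. -/
def HasTrace (s : ℝ) (γ : ℝ → ℝ) (I : Set ℝ) (v : ℝ × ℝ → ℝ) (g : ℝ → ℝ) : Prop :=
  ∀ K : Set ℝ, IsCompact K → K ⊆ I →
    Tendsto (fun h : ℝ => eLpNorm (fun t => v (t, γ t + s * h) - g t) 2 (volume.restrict K))
      essZeroPlus (𝓝 0)

/-- `v` solves, in `Ω'`, the problem
`v_tt - v_xx - (ν² / 4) v = 0`, `v(t, 0) = z(t)`, `v(t, ℓ(t)) = 0`, `v(0, x) = v₀(x)`,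
`v_t(0, x) = v₁(x)`.
The parts of the lines `x = 0` and `x = ℓ(t)` that bound `Ω'` are those with `0 < t < ℓ₀` and with
`0 < t < ℓ(t)`, respectively. The initial conditions hold in `L²(0, ℓ₀)` and in `H⁻¹(0, ℓ₀)`. -/
structure IsSolution (ν ℓ₀ : ℝ) (ℓ z v₀ v₁ : ℝ → ℝ) (v : ℝ × ℝ → ℝ) : Prop where
  wave : SolvesWaveEq (openOmega' ℓ₀ ℓ) ν v
  trace_left : HasTrace 1 (fun _ => 0) (Ioo 0 ℓ₀) v z
  trace_front : HasTrace (-1) ℓ {t | 0 < t ∧ t < ℓ t} v (fun _ => 0)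
  initial_position :
    Tendsto (fun t : ℝ => eLpNorm (fun x => v (t, x) - v₀ x) 2 (volume.restrict (Ioo 0 ℓ₀)))
      essZeroPlus (𝓝 0)
  initial_velocity : ∃ vt : ℝ × ℝ → ℝ, HasWeakDeriv (openOmega' ℓ₀ ℓ) (1, 0) v vt ∧
    Tendsto (fun t : ℝ => negSobolevNorm 0 ℓ₀ (fun x => vt (t, x) - v₁ x)) essZeroPlus (𝓝 0)

/-! ### The representation formula -/

open Classical in
/-- The d'Alembert solution `A` of the undamped problem in `Ω'`. -/
def dAlembert (ℓ₀ : ℝ) (ℓ z v₀ v₁ : ℝ → ℝ) (p : ℝ × ℝ) : ℝ :=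
  let t := p.1
  let x := p.2
  if p ∈ Omega1 ℓ₀ ℓ then
    1 / 2 * v₀ (x - t) + 1 / 2 * v₀ (x + t) + 1 / 2 * ∫ s in (x - t)..(x + t), v₁ s
  else if p ∈ Omega2 ℓ₀ ℓ then
    z (t - x) - 1 / 2 * v₀ (t - x) + 1 / 2 * v₀ (t + x) + 1 / 2 * ∫ s in (t - x)..(t + x), v₁ s
  else if p ∈ Omega3 ℓ₀ ℓ then
    1 / 2 * v₀ (x - t) - 1 / 2 * v₀ (-omega ℓ (x + t))
      + 1 / 2 * ∫ s in (x - t)..(-omega ℓ (x + t)), v₁ s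
  else 0

open Classical in
/-- The left boundary `γ₁(τ; t, x)` of `R(t, x)`, with `p = (t, x)`. -/
def gamma1 (ℓ₀ : ℝ) (ℓ : ℝ → ℝ) (p : ℝ × ℝ) (τ : ℝ) : ℝ :=
  if p ∈ Omega2 ℓ₀ ℓ then |p.2 - p.1 + τ| else p.2 - p.1 + τ

open Classical in
/-- The right boundary `γ₂(τ; t, x)` of `R(t, x)`, with `p = (t, x)`. -/
def gamma2 (ℓ₀ : ℝ) (ℓ : ℝ → ℝ) (p : ℝ × ℝ) (τ : ℝ) : ℝ :=
  if p ∈ Omega3 ℓ₀ ℓ ∧ τ ≤ psiInv ℓ (p.1 + p.2) then τ - omega ℓ (p.1 + p.2)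
  else p.2 + p.1 - τ

/-- `R(t, x) = {(τ, σ) ∈ Ω' | 0 < τ < t, γ₁(τ; t, x) < σ < γ₂(τ; t, x)}`, with `p = (t, x)`. -/
def region (ℓ₀ : ℝ) (ℓ : ℝ → ℝ) (p : ℝ × ℝ) : Set (ℝ × ℝ) :=
  {q ∈ Omega' ℓ₀ ℓ | 0 < q.1 ∧ q.1 < p.1 ∧ gamma1 ℓ₀ ℓ p q.1 < q.2 ∧ q.2 < gamma2 ℓ₀ ℓ p q.1}

end

end Debonding

namespace Debonding

/-! ### The front, its characteristics, and the domains in characteristic form. -/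

section Front

variable {ℓ₀ : ℝ} {ℓ : ℝ → ℝ}

/-! Put a = t - x and b = t + x. In these coordinates `box` is 4 ∂ₐ∂ᵦ and the front is the curve a =
ω(b). Setting ω(s) = -s for s ≤ ℓ₀ (`omegaExt`) joins the initial line t = 0 to the front: a line t
+ x = b, followed with decreasing a, leaves the domain at a = `omegaExt` b in either case. The case
distinctions defining R(t, x) then collapse to one rectangle (`IsFront.mem_region_iff`), and
inclusion-exclusion writes the integral over R by integrals over backward quadrants {t - x < a, t +
x < b} (`setIntegral_region`). With `dAlembert_eq`, the right hand side of the formula becomes a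
single continuous function on the plane, u = f(a) + g(b) + κ Q(a, b) (`reprFun`), where κ = ν²/8 and
Q is the quadrant integral of v extended by zero.

Whatever v is, u solves `box` u = 2κ v = (ν²/4) v weakly with the prescribed data. By Fubini `box` Q
= 2v (`integral_quadrantInt_mul_box`), the travelling waves are annihilated by `box`, and
integration over t > 0 leaves the terms in v₀ and v₁ (`integral_half_reprFun_mul_box`). The values
of u on the two lateral boundaries and on t = 0 are computed directly.

If v = u almost everywhere, the wave equation follows at once, and the traces and the initial
position follow from the continuity of u. The initial velocity needs more: for a fixed test function
η, the pairing of v_t(t) - v₁ with η is the time integral of a quantity bounded by the slice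
energies uniformly over the unit ball of H¹₀; a countable dense set of η then controls the H⁻¹ norm
(`tendsto_negSobolevNorm`).

Conversely, let v be a solution and W = v - u. Both have the same source (ν²/4) v, so W solves the
homogeneous equation with zero data and no Gronwall argument is needed. Cutting test functions off
near t = 0 shows that v satisfies the weak Cauchy problem (`weakCauchy_of_isSolution`), so W
extended by zero solves the equation across t = 0. A solution of ∂ₐ∂ᵦ W = 0 has vanishing
alternating sum over the vertices of characteristic rectangles; for merely integrable W this is
proved by mollification (`SolvesChar.parallelogram`). Rectangles reaching below t = 0 give W = 0 in
Ω'₁. In Ω'₂ and Ω'₃ the function W depends only on a and only on b respectively, so the zero traces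
propagate along characteristics into the interior (`ae_eq_zero_left`, `ae_eq_zero_front`). -/

theorem IsFront.sub_mem (h : IsFront ℓ₀ ℓ) {s t : ℝ} (hs : 0 ≤ s) (hst : s ≤ t) :
    0 ≤ ℓ t - ℓ s ∧ ℓ t - ℓ s ≤ t - s := by
  obtain ⟨K, hK⟩ := h.lipschitz
  have hsub : uIcc s t ⊆ Ici 0 := by
    rw [uIcc_of_le hst]; exact fun x hx => hs.trans hx.1
  -- Lipschitz implies absolutely continuous, so the almost everywhere bounds on the derivative
  -- integrate to bounds on increments.
  have hac : AbsolutelyContinuousOnInterval ℓ s t :=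
    (hK.mono hsub).absolutelyContinuousOnInterval
  have hint := hac.intervalIntegrable_deriv
  rw [← hac.integral_deriv_eq_sub]
  have hae : ∀ᵐ x ∂(volume.restrict (Ioc s t)), 0 ≤ deriv ℓ x ∧ deriv ℓ x ≤ 1 := by
    filter_upwards [ae_restrict_of_ae h.deriv_mem, ae_restrict_mem measurableSet_Ioc] with x hx hx'
    exact hx (hs.trans_lt hx'.1)
  rw [intervalIntegral.integral_of_le hst]
  constructor
  · exact setIntegral_nonneg_of_ae_restrict (hae.mono fun x hx => hx.1)
  · calc ∫ x in Ioc s t, deriv ℓ x ≤ ∫ _ in Ioc s t, (1 : ℝ) :=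
        integral_mono_ae hint.1 (integrable_const _) (hae.mono fun x hx => hx.2)
      _ = t - s := by simp [hst]

theorem IsFront.continuousOn (h : IsFront ℓ₀ ℓ) : ContinuousOn ℓ (Ici 0) :=
  let ⟨_, hK⟩ := h.lipschitz; hK.continuousOn

theorem IsFront.continuousOn_psi (h : IsFront ℓ₀ ℓ) : ContinuousOn (psi ℓ) (Ici 0) :=
  continuousOn_id.add h.continuousOn

theorem IsFront.psi_zero (h : IsFront ℓ₀ ℓ) : psi ℓ 0 = ℓ₀ := by simp [psi, h.zero]

/-- ψ' = 1 + ℓ' lies in [1, 2]. The lower bound makes ψ injective with Lipschitz inverse; the upper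
one makes ω nondecreasing and controls the change of variables along the front. -/
theorem IsFront.psi_sub_mem (h : IsFront ℓ₀ ℓ) {s t : ℝ} (hs : 0 ≤ s) (hst : s ≤ t) :
    t - s ≤ psi ℓ t - psi ℓ s ∧ psi ℓ t - psi ℓ s ≤ 2 * (t - s) := by
  have := h.sub_mem hs hst
  simp only [psi]
  constructor <;> linarith

theorem IsFront.le (h : IsFront ℓ₀ ℓ) {t : ℝ} (ht : 0 ≤ t) : ℓ₀ ≤ ℓ t := h.mapsTo ht

theorem IsFront.psi_lt_psi_iff (h : IsFront ℓ₀ ℓ) {s t : ℝ} (hs : 0 ≤ s) (ht : 0 ≤ t) :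
    psi ℓ s < psi ℓ t ↔ s < t := by
  constructor
  · intro hlt
    by_contra! hts
    have := (h.psi_sub_mem ht hts).1
    linarith
  · intro hlt
    have := (h.psi_sub_mem hs hlt.le).1
    linarith

theorem IsFront.surjOn_psi (h : IsFront ℓ₀ ℓ) : SurjOn (psi ℓ) (Ici 0) (Ici ℓ₀) := by
  intro s hs
  have h0 : (0 : ℝ) ≤ s - ℓ₀ := sub_nonneg.2 hs
  have hc : ContinuousOn (psi ℓ) (Icc 0 (s - ℓ₀)) := h.continuousOn_psi.mono fun x hx => hx.1
  obtain ⟨t, ht, hts⟩ := intermediate_value_Icc h0 hc (show s ∈ Icc _ _ from by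
    rw [h.psi_zero]
    refine ⟨hs, ?_⟩
    have := h.le h0
    simp only [psi]; linarith)
  exact ⟨t, ht.1, hts⟩

/-- The time at which the characteristic `t + x = s` meets the front `x = ℓ(t)`, and `0` if
`s ≤ ℓ₀`. -/
noncomputable def hitTime (ℓ₀ : ℝ) (ℓ : ℝ → ℝ) (s : ℝ) : ℝ := if s ≤ ℓ₀ then 0 else psiInv ℓ s

/-- The extension of `ω` to the real line by `ω(s) = -s` for `s ≤ ℓ₀`. -/
noncomputable def omegaExt (ℓ₀ : ℝ) (ℓ : ℝ → ℝ) (s : ℝ) : ℝ := 2 * hitTime ℓ₀ ℓ s - s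

theorem IsFront.psiInv_spec (h : IsFront ℓ₀ ℓ) {s : ℝ} (hs : ℓ₀ ≤ s) :
    0 ≤ psiInv ℓ s ∧ psi ℓ (psiInv ℓ s) = s :=
  ⟨Function.invFunOn_mem (h.surjOn_psi hs), Function.invFunOn_eq (h.surjOn_psi hs)⟩

theorem IsFront.hitTime_nonneg (h : IsFront ℓ₀ ℓ) (s : ℝ) : 0 ≤ hitTime ℓ₀ ℓ s := by
  unfold hitTime
  split_ifs with hs
  · exact le_rfl
  · exact (h.psiInv_spec (not_le.1 hs).le).1

theorem IsFront.psi_hitTime (h : IsFront ℓ₀ ℓ) (s : ℝ) : psi ℓ (hitTime ℓ₀ ℓ s) = max s ℓ₀ := by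
  unfold hitTime
  split_ifs with hs
  · rw [h.psi_zero, max_eq_right hs]
  · rw [(h.psiInv_spec (not_le.1 hs).le).2, max_eq_left (not_le.1 hs).le]

theorem IsFront.hitTime_psi (h : IsFront ℓ₀ ℓ) {t : ℝ} (ht : 0 ≤ t) :
    hitTime ℓ₀ ℓ (psi ℓ t) = t := by
  have h1 := h.psi_hitTime (psi ℓ t)
  have h2 : ℓ₀ ≤ psi ℓ t := by have := h.le ht; simp only [psi]; linarith
  rw [max_eq_left h2] at h1
  have h3 := h.psi_lt_psi_iff (h.hitTime_nonneg (psi ℓ t)) ht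
  have h4 := h.psi_lt_psi_iff ht (h.hitTime_nonneg (psi ℓ t))
  rw [h1] at h3 h4
  simp only [lt_self_iff_false, false_iff, not_lt] at h3 h4
  exact le_antisymm h4 h3

theorem IsFront.hitTime_lt_iff (h : IsFront ℓ₀ ℓ) {s t : ℝ} (ht : 0 < t) :
    hitTime ℓ₀ ℓ s < t ↔ s < psi ℓ t := by
  rw [← h.psi_lt_psi_iff (h.hitTime_nonneg s) ht.le, h.psi_hitTime, max_lt_iff]
  have := h.le ht.le
  exact ⟨fun H => H.1, fun H => ⟨H, by simp only [psi]; linarith⟩⟩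

theorem IsFront.monotone_hitTime (h : IsFront ℓ₀ ℓ) : Monotone (hitTime ℓ₀ ℓ) := by
  intro s t hst
  have h3 := h.psi_lt_psi_iff (h.hitTime_nonneg t) (h.hitTime_nonneg s)
  rw [h.psi_hitTime, h.psi_hitTime] at h3
  by_contra! hlt
  exact absurd (h3.2 hlt) (not_lt.2 (max_le_max_right ℓ₀ hst))

theorem IsFront.hitTime_sub_le (h : IsFront ℓ₀ ℓ) {s t : ℝ} (hst : s ≤ t) :
    hitTime ℓ₀ ℓ t - hitTime ℓ₀ ℓ s ≤ t - s := by
  have h1 := (h.psi_sub_mem (h.hitTime_nonneg s) (h.monotone_hitTime hst)).1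
  rw [h.psi_hitTime, h.psi_hitTime] at h1
  refine h1.trans ?_
  rcases le_total s ℓ₀ with h2 | h2 <;> rcases le_total t ℓ₀ with h3 | h3 <;>
    simp only [max_eq_left, max_eq_right, h2, h3] <;> linarith

theorem IsFront.continuous_hitTime (h : IsFront ℓ₀ ℓ) : Continuous (hitTime ℓ₀ ℓ) := by
  refine (LipschitzWith.of_dist_le_mul (K := 1) fun s t => ?_).continuous
  rw [Real.dist_eq, Real.dist_eq, NNReal.coe_one, one_mul]
  wlog hst : s ≤ t generalizing s t
  · rw [abs_sub_comm, abs_sub_comm s]; exact this t s (le_of_not_ge hst)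
  rw [abs_sub_comm, abs_sub_comm s, abs_of_nonneg (sub_nonneg.2 hst),
    abs_of_nonneg (sub_nonneg.2 (h.monotone_hitTime hst))]
  exact h.hitTime_sub_le hst

theorem IsFront.continuous_omegaExt (h : IsFront ℓ₀ ℓ) : Continuous (omegaExt ℓ₀ ℓ) :=
  (continuous_const.mul h.continuous_hitTime).sub continuous_id

theorem hitTime_of_le {s : ℝ} (hs : s ≤ ℓ₀) : hitTime ℓ₀ ℓ s = 0 := if_pos hs

theorem omegaExt_of_le {s : ℝ} (hs : s ≤ ℓ₀) : omegaExt ℓ₀ ℓ s = -s := by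
  simp [omegaExt, hitTime_of_le hs]

theorem IsFront.omegaExt_eq_omega (h : IsFront ℓ₀ ℓ) {s : ℝ} (hs : ℓ₀ < s) :
    omegaExt ℓ₀ ℓ s = omega ℓ s := by
  have h1 := h.psi_hitTime s
  rw [max_eq_left hs.le] at h1
  have h2 : hitTime ℓ₀ ℓ s = psiInv ℓ s := if_neg (not_le.2 hs)
  simp only [omegaExt, omega, phi, psi, h2] at h1 ⊢
  linarith

theorem IsFront.omegaExt_psi (h : IsFront ℓ₀ ℓ) {t : ℝ} (ht : 0 ≤ t) :
    omegaExt ℓ₀ ℓ (psi ℓ t) = phi ℓ t := by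
  rw [omegaExt, h.hitTime_psi ht]; simp only [phi, psi]; ring

/-- If T is the hitting time, the increment of ω = 2T - s is 2ΔT - Δψ, nonnegative because ψ' ≤ 2.
The restriction ℓ₀ ≤ s matters: to the left of ℓ₀ the extension is -s, which decreases. -/
theorem IsFront.omegaExt_mono (h : IsFront ℓ₀ ℓ) {s t : ℝ} (hs : ℓ₀ ≤ s) (hst : s ≤ t) :
    omegaExt ℓ₀ ℓ s ≤ omegaExt ℓ₀ ℓ t := by
  have h1 := (h.psi_sub_mem (h.hitTime_nonneg s) (h.monotone_hitTime hst)).2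
  rw [h.psi_hitTime, h.psi_hitTime, max_eq_left hs, max_eq_left (hs.trans hst)] at h1
  simp only [omegaExt]; linarith

theorem IsFront.neg_le_omegaExt (h : IsFront ℓ₀ ℓ) {s : ℝ} (hs : ℓ₀ ≤ s) :
    -ℓ₀ ≤ omegaExt ℓ₀ ℓ s := by
  have := h.omegaExt_mono le_rfl hs
  rwa [omegaExt_of_le le_rfl] at this

/-- x < ℓ(t) means t + x < ψ(t), that is, the characteristic through the point met the front, or the
initial line, before time t. Positivity of t is contained in this, as hitting times are nonnegative.
-/
theorem IsFront.mem_Omega_iff (h : IsFront ℓ₀ ℓ) {p : ℝ × ℝ} :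
    p ∈ Omega ℓ ↔ 0 < p.2 ∧ hitTime ℓ₀ ℓ (p.1 + p.2) < p.1 := by
  constructor
  · rintro ⟨h1, h2, h3⟩
    exact ⟨h2, (h.hitTime_lt_iff h1).2 (by simp only [psi]; linarith)⟩
  · rintro ⟨h2, h3⟩
    have h1 : 0 < p.1 := (h.hitTime_nonneg _).trans_lt h3
    have := (h.hitTime_lt_iff h1).1 h3
    exact ⟨h1, h2, by simp only [psi] at this; linarith⟩

/-- The set `Ω'` without the point `(ℓ₀ / 2, ℓ₀ / 2)`. -/
def punctured (ℓ₀ : ℝ) (ℓ : ℝ → ℝ) : Set (ℝ × ℝ) :=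
  {p | 0 < p.2 ∧ hitTime ℓ₀ ℓ (p.1 + p.2) < p.1 ∧ (p.1 < p.2 ∨ p.1 + p.2 < ℓ₀)}

theorem IsFront.isOpen_punctured (h : IsFront ℓ₀ ℓ) : IsOpen (punctured ℓ₀ ℓ) := by
  have := h.continuous_hitTime
  exact (isOpen_lt continuous_const continuous_snd).inter
    ((isOpen_lt (this.comp (continuous_fst.add continuous_snd)) continuous_fst).inter
      ((isOpen_lt continuous_fst continuous_snd).union
        (isOpen_lt (continuous_fst.add continuous_snd) continuous_const)))

theorem IsFront.mem_Omega'_iff (h : IsFront ℓ₀ ℓ) (hℓ₀ : 0 < ℓ₀) {p : ℝ × ℝ} :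
    p ∈ Omega' ℓ₀ ℓ ↔ p ∈ punctured ℓ₀ ℓ ∨ p = (ℓ₀ / 2, ℓ₀ / 2) := by
  obtain ⟨t, x⟩ := p
  simp only [Omega', Omega1, Omega2, Omega3, mem_union, mem_ofPred_eq, h.mem_Omega_iff, punctured,
    Prod.mk.injEq]
  constructor
  · rintro ((⟨⟨h1, h2⟩, h3, h4⟩ | ⟨⟨h1, h2⟩, h3, h4⟩) | ⟨⟨h1, h2⟩, h3, h4⟩)
    · rcases h3.lt_or_eq with h5 | h5
      · exact Or.inl ⟨h1, h2, Or.inl h5⟩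
      · rcases h4.lt_or_eq with h6 | h6
        · exact Or.inl ⟨h1, h2, Or.inr h6⟩
        · exact Or.inr ⟨by linarith, by linarith⟩
    · exact Or.inl ⟨h1, h2, Or.inr h4⟩
    · exact Or.inl ⟨h1, h2, Or.inl h3⟩
  · rintro (⟨h1, h2, h3 | h3⟩ | ⟨rfl, rfl⟩)
    · rcases le_or_gt (t + x) ℓ₀ with h4 | h4
      · exact Or.inl (Or.inl ⟨⟨h1, h2⟩, h3.le, h4⟩)
      · exact Or.inr ⟨⟨h1, h2⟩, h3, h4⟩
    · rcases le_or_gt t x with h4 | h4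
      · exact Or.inl (Or.inl ⟨⟨h1, h2⟩, h4, h3.le⟩)
      · exact Or.inl (Or.inr ⟨⟨h1, h2⟩, h4, h3⟩)
    · refine Or.inl (Or.inl ⟨⟨by linarith, ?_⟩, le_rfl, by linarith⟩)
      rw [hitTime_of_le (by linarith)]; linarith

theorem IsFront.coe_openOmega' (h : IsFront ℓ₀ ℓ) (hℓ₀ : 0 < ℓ₀) :
    (openOmega' ℓ₀ ℓ : Set (ℝ × ℝ)) = punctured ℓ₀ ℓ := by
  change interior (Omega' ℓ₀ ℓ) = _
  apply Subset.antisymm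
  · intro p hp
    rcases (h.mem_Omega'_iff hℓ₀).1 (interior_subset hp) with h1 | rfl
    · exact h1
    · exfalso
      -- Slightly later in time at the same x, both t < x and t + x < ℓ₀ fail, so the exceptional
      -- point is not interior.
      have hc : Tendsto (fun ε : ℝ => (ℓ₀ / 2 + ε, ℓ₀ / 2)) (𝓝[>] 0) (𝓝 (ℓ₀ / 2, ℓ₀ / 2)) := by
        have : Continuous fun ε : ℝ => (ℓ₀ / 2 + ε, ℓ₀ / 2) := by fun_prop
        have h2 := this.tendsto 0
        simp only [add_zero] at h2
        exact h2.mono_left nhdsWithin_le_nhds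
      have h3 := (hc.eventually (mem_interior_iff_mem_nhds.1 hp)).and self_mem_nhdsWithin
      obtain ⟨ε, hε, hε0⟩ := h3.exists
      have hε0 : 0 < ε := hε0
      rcases (h.mem_Omega'_iff hℓ₀).1 hε with h4 | h4
      · rcases h4.2.2 with h5 | h5 <;> simp only at h5 <;> linarith
      · simp only [Prod.mk.injEq] at h4; linarith [h4.1]
  · exact interior_maximal (fun p hp => (h.mem_Omega'_iff hℓ₀).2 (Or.inl hp)) h.isOpen_punctured

theorem IsFront.ae_eq_Omega' (h : IsFront ℓ₀ ℓ) (hℓ₀ : 0 < ℓ₀) :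
    (Omega' ℓ₀ ℓ : Set (ℝ × ℝ)) =ᵐ[volume] punctured ℓ₀ ℓ := by
  have h0 : ∀ᵐ p : ℝ × ℝ, p ≠ (ℓ₀ / 2, ℓ₀ / 2) := by
    rw [ae_iff]; simp
  filter_upwards [h0] with p hp
  apply propext
  change p ∈ Omega' ℓ₀ ℓ ↔ p ∈ punctured ℓ₀ ℓ
  simp [h.mem_Omega'_iff hℓ₀, hp]

theorem IsFront.measurableSet_Omega' (h : IsFront ℓ₀ ℓ) (hℓ₀ : 0 < ℓ₀) :
    MeasurableSet (Omega' ℓ₀ ℓ) := by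
  have : Omega' ℓ₀ ℓ = punctured ℓ₀ ℓ ∪ {(ℓ₀ / 2, ℓ₀ / 2)} := by
    ext p; simp [h.mem_Omega'_iff hℓ₀, or_comm]
  rw [this]
  exact h.isOpen_punctured.measurableSet.union (measurableSet_singleton _)

/-- R(t, x) is a rectangle in characteristic coordinates, cut with Ω'. In each case of the
definition, the inequalities not imposed by γ₁ and γ₂ follow from 0 < τ, 0 < σ < ℓ(τ) and the
position of (t, x). -/
theorem IsFront.mem_region_iff (h : IsFront ℓ₀ ℓ) {p q : ℝ × ℝ}
    (hp : p ∈ punctured ℓ₀ ℓ) :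
    q ∈ region ℓ₀ ℓ p ↔ q ∈ Omega' ℓ₀ ℓ ∧ omegaExt ℓ₀ ℓ (p.1 + p.2) < q.1 - q.2 ∧
      q.1 - q.2 < p.1 - p.2 ∧ p.1 - p.2 < q.1 + q.2 ∧ q.1 + q.2 < p.1 + p.2 := by
  obtain ⟨t, x⟩ := p
  obtain ⟨τ, σ⟩ := q
  obtain ⟨hx, hT, hc⟩ := hp
  simp only at hx hT hc
  have hΩ : (t, x) ∈ Omega ℓ := h.mem_Omega_iff.2 ⟨hx, hT⟩
  simp only [region, mem_ofPred_eq]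
  refine and_congr_right fun hq => ?_
  have hq' : (τ, σ) ∈ Omega ℓ := by
    rcases hq with (hq | hq) | hq <;> exact hq.1
  obtain ⟨hτ, hσ, hσℓ⟩ := hq'
  simp only at hτ hσ hσℓ
  by_cases h2 : (t, x) ∈ Omega2 ℓ₀ ℓ
  · have h3 : (t, x) ∉ Omega3 ℓ₀ ℓ := fun h3 => by
      have := h3.2.1; have := h2.2.1; simp only at *; linarith
    have h4 := h2.2; simp only at h4
    simp only [gamma1, gamma2, h2, h3, if_true, false_and, if_false, abs_lt,
      omegaExt_of_le h4.2.le]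
    constructor
    · rintro ⟨-, -, ⟨h5, h6⟩, h7⟩
      refine ⟨?_, ?_, ?_, ?_⟩ <;> linarith
    · rintro ⟨h5, h6, h7, h8⟩
      refine ⟨?_, ?_, ⟨?_, ?_⟩, ?_⟩ <;> linarith
  · have htx : t ≤ x := by
      by_contra! hlt
      exact h2 ⟨hΩ, hlt, hc.resolve_left (not_lt.2 hlt.le)⟩
    by_cases h3 : (t, x) ∈ Omega3 ℓ₀ ℓ
    · have h4 : ℓ₀ < t + x := h3.2.2
      have hpi := h.psiInv_spec h4.le
      have hht : hitTime ℓ₀ ℓ (t + x) = psiInv ℓ (t + x) := if_neg (not_le.2 h4)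
      simp only [gamma1, gamma2, h2, h3, if_false, true_and, ← h.omegaExt_eq_omega h4]
      have hw : omegaExt ℓ₀ ℓ (t + x) = 2 * psiInv ℓ (t + x) - (t + x) := by rw [omegaExt, hht]
      rw [hht] at hT
      split_ifs with h5
      -- Up to the hitting time, γ₂ is the reflected characteristic; the missing bound comes from σ
      -- < ℓ(τ), since then τ + σ < ψ(τ) ≤ t + x.
      · have h6 : τ + σ < t + x := by
          rcases h5.lt_or_eq with h7 | h7
          · have := (h.psi_lt_psi_iff hτ.le hpi.1).2 h7
            rw [hpi.2] at this; simp only [psi] at this; linarith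
          · have h8 : psi ℓ τ = t + x := by rw [h7, hpi.2]
            simp only [psi] at h8; linarith
        constructor
        · rintro ⟨-, -, h7, h8⟩
          refine ⟨?_, ?_, ?_, ?_⟩ <;> linarith
        · rintro ⟨h7, h8, h9, h10⟩
          refine ⟨?_, ?_, ?_, ?_⟩ <;> linarith
      -- After the hitting time, γ₂ gives τ + σ < t + x, and the other bound follows: τ - σ = 2τ -
      -- (τ + σ) > 2ψ⁻¹(t + x) - (t + x) = ω(t + x).
      · push Not at h5
        constructor
        · rintro ⟨-, -, h7, h8⟩
          refine ⟨?_, ?_, ?_, ?_⟩ <;> linarith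
        · rintro ⟨h7, h8, h9, h10⟩
          refine ⟨?_, ?_, ?_, ?_⟩ <;> linarith
    · have h4 : t + x ≤ ℓ₀ := by
        by_contra! hlt
        rcases htx.lt_or_eq with h5 | h5
        · exact h3 ⟨hΩ, h5, hlt⟩
        · rcases hc with h6 | h6 <;> linarith
      simp only [gamma1, gamma2, h2, h3, if_false, false_and, omegaExt_of_le h4]
      constructor
      · rintro ⟨-, -, h7, h8⟩
        refine ⟨?_, ?_, ?_, ?_⟩ <;> linarith
      · rintro ⟨h7, h8, h9, h10⟩
        refine ⟨?_, ?_, ?_, ?_⟩ <;> linarith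

end Front

/-! ### Characteristic coordinates and weak solutions on the half plane. -/

section Characteristic

open scoped ContDiff

/-- The characteristic coordinates `(t - x, t + x)` of the point `(t, x)`. -/
noncomputable def charMap : (ℝ × ℝ) ≃L[ℝ] (ℝ × ℝ) :=
  ContinuousLinearEquiv.equivOfInverse
    ((ContinuousLinearMap.fst ℝ ℝ ℝ - ContinuousLinearMap.snd ℝ ℝ ℝ).prod
      (ContinuousLinearMap.fst ℝ ℝ ℝ + ContinuousLinearMap.snd ℝ ℝ ℝ))
    (((1 / 2 : ℝ) • (ContinuousLinearMap.fst ℝ ℝ ℝ + ContinuousLinearMap.snd ℝ ℝ ℝ)).prod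
      ((1 / 2 : ℝ) • (ContinuousLinearMap.snd ℝ ℝ ℝ - ContinuousLinearMap.fst ℝ ℝ ℝ)))
    (fun p => by ext <;> simp <;> ring) (fun p => by ext <;> simp <;> ring)

@[simp] theorem charMap_apply (p : ℝ × ℝ) : charMap p = (p.1 - p.2, p.1 + p.2) := rfl

theorem charMap_symm_apply (q : ℝ × ℝ) :
    charMap.symm q = ((q.1 + q.2) / 2, (q.2 - q.1) / 2) := by
  change ((1 / 2 : ℝ) * (q.1 + q.2), (1 / 2 : ℝ) * (q.2 - q.1)) = _
  ext <;> simp <;> ring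

theorem measurableEmbedding_charMap : MeasurableEmbedding charMap :=
  charMap.toHomeomorph.measurableEmbedding

theorem measurableEmbedding_charMap_symm : MeasurableEmbedding charMap.symm :=
  charMap.symm.toHomeomorph.measurableEmbedding

theorem map_charMap : Measure.map charMap volume = ENNReal.ofReal (1 / 2) • volume := by
  have hdet : LinearMap.det ((charMap : (ℝ × ℝ) →L[ℝ] (ℝ × ℝ)) : (ℝ × ℝ) →ₗ[ℝ] (ℝ × ℝ)) = 2 := by
    rw [← LinearMap.det_toMatrix (Module.Basis.finTwoProd ℝ), Matrix.det_fin_two]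
    simp [LinearMap.toMatrix_apply]; norm_num
  have := Measure.map_linearMap_addHaar_eq_smul_addHaar (volume : Measure (ℝ × ℝ))
    (f := ((charMap : (ℝ × ℝ) →L[ℝ] (ℝ × ℝ)) : (ℝ × ℝ) →ₗ[ℝ] (ℝ × ℝ))) (by rw [hdet]; norm_num)
  rw [hdet] at this
  norm_num at this ⊢
  exact this

theorem integral_comp_charMap (f : ℝ × ℝ → ℝ) : ∫ p, f (charMap p) = 1 / 2 * ∫ q, f q := by
  rw [← measurableEmbedding_charMap.integral_map, map_charMap, integral_smul_measure]
  norm_num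

theorem quasiMeasurePreserving_charMap : Measure.QuasiMeasurePreserving charMap volume volume :=
  ⟨charMap.continuous.measurable, by rw [map_charMap]; exact Measure.smul_absolutelyContinuous⟩

theorem map_charMap_symm : Measure.map charMap.symm volume = (2 : ℝ≥0∞) • volume := by
  have h := congrArg (fun μ => (2 : ℝ≥0∞) • Measure.map charMap.symm μ) map_charMap
  simp only [Measure.map_smul] at h
  rw [Measure.map_map charMap.symm.continuous.measurable charMap.continuous.measurable,
    charMap.symm_comp_self, Measure.map_id, smul_smul] at h
  rw [h, one_div, ENNReal.ofReal_inv_of_pos two_pos, ENNReal.ofReal_ofNat,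
    ENNReal.mul_inv_cancel two_ne_zero ENNReal.ofNat_ne_top, one_smul]

/-- The d'Alembert operator `∂ₜ² - ∂ₓ²`. -/
noncomputable def box (φ : ℝ × ℝ → ℝ) (p : ℝ × ℝ) : ℝ :=
  fderiv ℝ (fun q => fderiv ℝ φ q (1, 0)) p (1, 0)
    - fderiv ℝ (fun q => fderiv ℝ φ q (0, 1)) p (0, 1)

variable {φ : ℝ × ℝ → ℝ}

theorem contDiff_fderiv_apply (hφ : ContDiff ℝ ∞ φ) (e : ℝ × ℝ) :
    ContDiff ℝ ∞ fun q => fderiv ℝ φ q e :=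
  (hφ.fderiv_right (m := ∞) (by simp)).clm_apply contDiff_const

theorem hasCompactSupport_fderiv_apply (hc : HasCompactSupport φ) (e : ℝ × ℝ) :
    HasCompactSupport fun q => fderiv ℝ φ q e :=
  (hc.fderiv ℝ).comp_left (g := fun L : (ℝ × ℝ) →L[ℝ] ℝ => L e) rfl

theorem contDiff_box (hφ : ContDiff ℝ ∞ φ) : ContDiff ℝ ∞ (box φ) :=
  (contDiff_fderiv_apply (contDiff_fderiv_apply hφ _) _).sub
    (contDiff_fderiv_apply (contDiff_fderiv_apply hφ _) _)

theorem hasCompactSupport_box (hc : HasCompactSupport φ) : HasCompactSupport (box φ) :=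
  (hasCompactSupport_fderiv_apply (hasCompactSupport_fderiv_apply hc _) _).sub
    (hasCompactSupport_fderiv_apply (hasCompactSupport_fderiv_apply hc _) _)

theorem fderiv_fderiv_apply (hφ : ContDiff ℝ ∞ φ) (p e e' : ℝ × ℝ) :
    fderiv ℝ (fun q => fderiv ℝ φ q e) p e' = fderiv ℝ (fderiv ℝ φ) p e' e := by
  have h1 : DifferentiableAt ℝ (fderiv ℝ φ) p :=
    (hφ.fderiv_right (m := ∞) (by simp)).differentiable (by simp) p
  rw [fderiv_clm_apply h1 (differentiableAt_const e)]
  simp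

/-- The directions (1/2, 1/2) and (1/2, -1/2) are ∂ᵦ and ∂ₐ. Symmetry of the second derivative
cancels the mixed terms. Both orders are kept because later integrations run along either family of
characteristics. -/
theorem box_eq (hφ : ContDiff ℝ ∞ φ) (p : ℝ × ℝ) :
    fderiv ℝ (fun q => fderiv ℝ φ q (1 / 2, 1 / 2)) p (1 / 2, -1 / 2) = 1 / 4 * box φ p ∧
    fderiv ℝ (fun q => fderiv ℝ φ q (1 / 2, -1 / 2)) p (1 / 2, 1 / 2) = 1 / 4 * box φ p := by
  have hsymm : IsSymmSndFDerivAt ℝ φ p := hφ.contDiffAt.isSymmSndFDerivAt (by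
    rw [minSmoothness_of_isRCLikeNormedField]; exact WithTop.coe_le_coe.2 le_top)
  simp only [box, fderiv_fderiv_apply hφ]
  have e1 : ((1 / 2, 1 / 2) : ℝ × ℝ) = (1 / 2 : ℝ) • (1, 0) + (1 / 2 : ℝ) • (0, 1) := by
    ext <;> simp
  have e2 : ((1 / 2, -1 / 2) : ℝ × ℝ) = (1 / 2 : ℝ) • (1, 0) - (1 / 2 : ℝ) • (0, 1) := by
    ext <;> simp; ring
  have hs := hsymm.eq (1, 0) (0, 1)
  rw [e1, e2]
  simp only [map_add, map_sub, map_smul, _root_.add_apply,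
    _root_.sub_apply, _root_.smul_apply, smul_eq_mul, hs]
  constructor <;> ring

theorem hasDerivAt_char_left {ψ : ℝ × ℝ → ℝ} (hψ : Differentiable ℝ ψ) (a b : ℝ) :
    HasDerivAt (fun a => ψ (charMap.symm (a, b)))
      (fderiv ℝ ψ (charMap.symm (a, b)) (1 / 2, -1 / 2)) a := by
  have h1 : HasDerivAt (fun a : ℝ => charMap.symm (a, b)) (1 / 2, -1 / 2) a := by
    simp only [charMap_symm_apply]
    have h2 : HasDerivAt (fun a : ℝ => (a + b) / 2) (1 / 2) a :=
      ((hasDerivAt_id a).add_const b).div_const 2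
    have h3 : HasDerivAt (fun a : ℝ => (b - a) / 2) (-1 / 2) a :=
      ((hasDerivAt_id a).const_sub b).div_const 2
    exact h2.prodMk h3
  exact (hψ _).hasFDerivAt.comp_hasDerivAt a h1

theorem hasDerivAt_char_right {ψ : ℝ × ℝ → ℝ} (hψ : Differentiable ℝ ψ) (a b : ℝ) :
    HasDerivAt (fun b => ψ (charMap.symm (a, b)))
      (fderiv ℝ ψ (charMap.symm (a, b)) (1 / 2, 1 / 2)) b := by
  have h1 : HasDerivAt (fun b : ℝ => charMap.symm (a, b)) (1 / 2, 1 / 2) b := by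
    simp only [charMap_symm_apply]
    have h2 : HasDerivAt (fun b : ℝ => (a + b) / 2) (1 / 2) b :=
      ((hasDerivAt_id b).const_add a).div_const 2
    have h3 : HasDerivAt (fun b : ℝ => (b - a) / 2) (1 / 2) b :=
      ((hasDerivAt_id b).sub_const a).div_const 2
    exact h2.prodMk h3
  exact (hψ _).hasFDerivAt.comp_hasDerivAt b h1

theorem hasCompactSupport_char_left {ψ : ℝ × ℝ → ℝ} (hc : HasCompactSupport ψ) (b : ℝ) :
    HasCompactSupport fun a => ψ (charMap.symm (a, b)) := by
  refine hc.comp_isClosedEmbedding (g := fun a : ℝ => charMap.symm (a, b)) ?_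
  exact charMap.symm.toHomeomorph.isClosedEmbedding.comp ⟨isEmbedding_prodMkLeft b, by
    have : range (fun a : ℝ => (a, b)) = Prod.snd ⁻¹' {b} := by ext ⟨x, y⟩; simp [eq_comm]
    rw [this]; exact isClosed_singleton.preimage continuous_snd⟩

theorem hasCompactSupport_char_right {ψ : ℝ × ℝ → ℝ} (hc : HasCompactSupport ψ) (a : ℝ) :
    HasCompactSupport fun b => ψ (charMap.symm (a, b)) := by
  refine hc.comp_isClosedEmbedding (g := fun b : ℝ => charMap.symm (a, b)) ?_
  exact charMap.symm.toHomeomorph.isClosedEmbedding.comp ⟨isEmbedding_prodMkRight a, by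
    have : range (Prod.mk a : ℝ → ℝ × ℝ) = Prod.fst ⁻¹' {a} := by ext ⟨x, y⟩; simp [eq_comm]
    rw [this]; exact isClosed_singleton.preimage continuous_fst⟩

theorem integral_Ioi_char_left {ψ : ℝ × ℝ → ℝ} (hψ : ContDiff ℝ ∞ ψ) (hc : HasCompactSupport ψ)
    (a b : ℝ) :
    ∫ s in Ioi a, fderiv ℝ ψ (charMap.symm (s, b)) (1 / 2, -1 / 2)
      = -ψ (charMap.symm (a, b)) := by
  have hd : Differentiable ℝ ψ := hψ.differentiable (by simp)
  have h1 : ContDiff ℝ ∞ fun s => ψ (charMap.symm (s, b)) := by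
    have : ContDiff ℝ ∞ fun s : ℝ => charMap.symm (s, b) :=
      charMap.symm.contDiff.comp (contDiff_id.prodMk contDiff_const)
    exact hψ.comp this
  rw [← HasCompactSupport.integral_Ioi_deriv_eq (h1.of_le (by simp))
    (hasCompactSupport_char_left hc b) a]
  exact integral_congr_ae (Eventually.of_forall fun s => (hasDerivAt_char_left hd s b).deriv.symm)

theorem integral_Ioi_char_right {ψ : ℝ × ℝ → ℝ} (hψ : ContDiff ℝ ∞ ψ) (hc : HasCompactSupport ψ)
    (a b : ℝ) :
    ∫ s in Ioi b, fderiv ℝ ψ (charMap.symm (a, s)) (1 / 2, 1 / 2)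
      = -ψ (charMap.symm (a, b)) := by
  have hd : Differentiable ℝ ψ := hψ.differentiable (by simp)
  have h1 : ContDiff ℝ ∞ fun s => ψ (charMap.symm (a, s)) := by
    have : ContDiff ℝ ∞ fun s : ℝ => charMap.symm (a, s) :=
      charMap.symm.contDiff.comp (contDiff_const.prodMk contDiff_id)
    exact hψ.comp this
  rw [← HasCompactSupport.integral_Ioi_deriv_eq (h1.of_le (by simp))
    (hasCompactSupport_char_right hc a) b]
  exact integral_congr_ae (Eventually.of_forall fun s => (hasDerivAt_char_right hd a s).deriv.symm)

theorem integral_Ioi_box_left (hφ : ContDiff ℝ ∞ φ) (hc : HasCompactSupport φ) (a b : ℝ) :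
    ∫ s in Ioi a, box φ (charMap.symm (s, b))
      = -4 * fderiv ℝ φ (charMap.symm (a, b)) (1 / 2, 1 / 2) := by
  have h := integral_Ioi_char_left (contDiff_fderiv_apply hφ (1 / 2, 1 / 2))
    (hasCompactSupport_fderiv_apply hc _) a b
  simp only [(box_eq hφ _).1, integral_const_mul] at h
  linarith

theorem integral_Ioi_box_right (hφ : ContDiff ℝ ∞ φ) (hc : HasCompactSupport φ) (a b : ℝ) :
    ∫ s in Ioi b, box φ (charMap.symm (a, s))
      = -4 * fderiv ℝ φ (charMap.symm (a, b)) (1 / 2, -1 / 2) := by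
  have h := integral_Ioi_char_right (contDiff_fderiv_apply hφ (1 / 2, -1 / 2))
    (hasCompactSupport_fderiv_apply hc _) a b
  simp only [(box_eq hφ _).2, integral_const_mul] at h
  linarith

/-- Two applications of the fundamental theorem of calculus to 4 ∂ₐ∂ᵦφ; compact support kills the
contributions at infinity. In effect, the indicator of a forward quadrant is a multiple of a
fundamental solution of `box`. -/
theorem integral_quadrant_box (hφ : ContDiff ℝ ∞ φ) (hc : HasCompactSupport φ) (a b : ℝ) :
    ∫ q in Ioi a ×ˢ Ioi b, box φ (charMap.symm q) = 4 * φ (charMap.symm (a, b)) := by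
  have hcont : Continuous fun q => box φ (charMap.symm q) :=
    (contDiff_box hφ).continuous.comp charMap.symm.continuous
  have hcs : HasCompactSupport fun q => box φ (charMap.symm q) :=
    (hasCompactSupport_box hc).comp_homeomorph charMap.symm.toHomeomorph
  have hint := hcont.integrable_of_hasCompactSupport hcs (μ := (volume : Measure (ℝ × ℝ)))
  rw [Measure.volume_eq_prod] at hint ⊢
  rw [setIntegral_prod _ hint.integrableOn]
  simp only [integral_Ioi_box_right hφ hc, integral_const_mul,
    integral_Ioi_char_left hφ hc]
  ring

/-- The integral of `F` over the backward quadrant `{t - x < a, t + x < b}`. -/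
noncomputable def quadrantInt (F : ℝ × ℝ → ℝ) (a b : ℝ) : ℝ :=
  ∫ q in {q : ℝ × ℝ | q.1 - q.2 < a ∧ q.1 + q.2 < b}, F q

theorem measurableSet_quadrant (a b : ℝ) :
    MeasurableSet {q : ℝ × ℝ | q.1 - q.2 < a ∧ q.1 + q.2 < b} := by
  have h1 : MeasurableSet {q : ℝ × ℝ | q.1 - q.2 < a} :=
    measurableSet_lt (by fun_prop) (by fun_prop)
  have h2 : MeasurableSet {q : ℝ × ℝ | q.1 + q.2 < b} :=
    measurableSet_lt (by fun_prop) (by fun_prop)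
  exact h1.inter h2

theorem ae_fst_ne_charMap (a : ℝ) : ∀ᵐ q : ℝ × ℝ, q.1 - q.2 ≠ a := by
  have h : ∀ᵐ q : ℝ × ℝ, q.1 ≠ a := by
    rw [Measure.volume_eq_prod]
    exact Measure.quasiMeasurePreserving_fst.ae (Measure.ae_ne volume a)
  exact quasiMeasurePreserving_charMap.ae h

theorem ae_snd_ne_charMap (b : ℝ) : ∀ᵐ q : ℝ × ℝ, q.1 + q.2 ≠ b := by
  have h : ∀ᵐ q : ℝ × ℝ, q.2 ≠ b := by
    rw [Measure.volume_eq_prod]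
    exact Measure.quasiMeasurePreserving_snd.ae (Measure.ae_ne volume b)
  exact quasiMeasurePreserving_charMap.ae h

variable {F : ℝ × ℝ → ℝ}

/-- Dominated convergence. As the vertex moves, the indicator of the quadrant changes in the limit
only on the two boundary characteristics, which are null; a half plane t + x < b + 1 carries the
dominating function. -/
theorem continuous_quadrantInt (hF : ∀ M : ℝ, IntegrableOn F {q | q.1 + q.2 < M}) :
    Continuous fun q : ℝ × ℝ => quadrantInt F q.1 q.2 := by
  rw [continuous_iff_continuousAt]
  rintro ⟨a, b⟩
  simp only [quadrantInt, ← integral_indicator (measurableSet_quadrant _ _)]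
  have hms : MeasurableSet {q : ℝ × ℝ | q.1 + q.2 < b + 1} :=
    measurableSet_lt (by fun_prop) (by fun_prop)
  have hev : ∀ᶠ x : ℝ × ℝ in 𝓝 (a, b), x.2 < b + 1 :=
    continuous_snd.continuousAt.eventually_lt continuousAt_const (by simp)
  refine continuousAt_of_dominated
    (bound := {q : ℝ × ℝ | q.1 + q.2 < b + 1}.indicator fun q => ‖F q‖) ?_ ?_ ?_ ?_
  · filter_upwards [hev] with x hx
    rw [aestronglyMeasurable_indicator_iff (measurableSet_quadrant _ _)]
    exact (hF (b + 1)).aestronglyMeasurable.mono_measure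
      (Measure.restrict_mono (fun q hq => hq.2.trans hx) le_rfl)
  · filter_upwards [hev] with x hx
    refine Eventually.of_forall fun q => ?_
    rw [norm_indicator_eq_indicator_norm]
    exact indicator_le_indicator_of_subset (fun q hq => hq.2.trans hx) (fun _ => norm_nonneg _) q
  · exact IntegrableOn.integrable_indicator (hF (b + 1)).norm hms
  · filter_upwards [ae_fst_ne_charMap a, ae_snd_ne_charMap b] with q h1 h2
    have hset : (fun x : ℝ × ℝ => {q : ℝ × ℝ | q.1 - q.2 < x.1 ∧ q.1 + q.2 < x.2}.indicator F q) =
        ({x : ℝ × ℝ | q.1 - q.2 < x.1 ∧ q.1 + q.2 < x.2}.indicator fun _ => F q) := by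
      ext x; rfl
    rw [hset]
    by_cases hq : q.1 - q.2 < a ∧ q.1 + q.2 < b
    · refine ContinuousAt.congr continuousAt_const (f := fun _ => F q) ?_
      have := (isOpen_lt (continuous_const (y := q.1 - q.2)) (continuous_fst (X := ℝ) (Y := ℝ))).inter
        (isOpen_lt (continuous_const (y := q.1 + q.2)) (continuous_snd (X := ℝ) (Y := ℝ)))
      filter_upwards [this.mem_nhds hq] with x hx
      exact (indicator_of_mem (s := {x : ℝ × ℝ | q.1 - q.2 < x.1 ∧ q.1 + q.2 < x.2}) hx
        fun _ => F q).symm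
    · refine ContinuousAt.congr continuousAt_const (f := fun _ => 0) ?_
      have hq' : a < q.1 - q.2 ∨ b < q.1 + q.2 := by
        by_contra! hcon
        exact hq ⟨lt_of_le_of_ne hcon.1 h1, lt_of_le_of_ne hcon.2 h2⟩
      have := (isOpen_lt (continuous_fst (X := ℝ) (Y := ℝ)) (continuous_const (y := q.1 - q.2))).union
        (isOpen_lt (continuous_snd (X := ℝ) (Y := ℝ)) (continuous_const (y := q.1 + q.2)))
      filter_upwards [this.mem_nhds hq'] with x hx
      refine (indicator_of_notMem (fun hx' => ?_) _).symm
      rcases hx with hx | hx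
      · exact absurd hx (not_lt.2 hx'.1.le)
      · exact absurd hx (not_lt.2 hx'.2.le)

/-- Fubini: q lies in the backward quadrant of x exactly when x lies in the forward quadrant of q,
where `integral_quadrant_box` applies. The factor 2 is 4 times the Jacobian 1/2. -/
theorem integral_quadrantInt_mul_box (hF : ∀ M : ℝ, IntegrableOn F {q | q.1 + q.2 < M})
    (hφ : ContDiff ℝ ∞ φ) (hc : HasCompactSupport φ) :
    ∫ p : ℝ × ℝ, quadrantInt F (p.1 - p.2) (p.1 + p.2) * box φ p = 2 * ∫ p, F p * φ p := by
  set m : ℝ × ℝ → ℝ := fun q => box φ (charMap.symm q) with hm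
  have hcont : Continuous m := (contDiff_box hφ).continuous.comp charMap.symm.continuous
  have hcs : HasCompactSupport m :=
    (hasCompactSupport_box hc).comp_homeomorph charMap.symm.toHomeomorph
  have hmint : Integrable m := hcont.integrable_of_hasCompactSupport hcs
  obtain ⟨M, hM⟩ : ∃ M : ℝ, ∀ q, M ≤ q.2 → m q = 0 := by
    obtain ⟨M, hM⟩ := (hcs.isCompact.image continuous_snd).bddAbove
    refine ⟨M + 1, fun q hq => image_eq_zero_of_notMem_tsupport fun hq' => ?_⟩
    have := hM (mem_image_of_mem _ hq')
    linarith
  have hMs : MeasurableSet {q : ℝ × ℝ | q.1 + q.2 < M} :=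
    measurableSet_lt (by fun_prop) (by fun_prop)
  -- F is integrable only on half planes t + x < M. Truncating it beyond the support of `m` changes
  -- no product and makes the integrand integrable on the product space.
  set F' : ℝ × ℝ → ℝ := {q : ℝ × ℝ | q.1 + q.2 < M}.indicator F with hF'
  have hF'int : Integrable F' := (hF M).integrable_indicator hMs
  set S : Set ((ℝ × ℝ) × (ℝ × ℝ)) := {z | z.1.1 - z.1.2 < z.2.1 ∧ z.1.1 + z.1.2 < z.2.2} with hS
  have hSm : MeasurableSet S := by
    have h1 : MeasurableSet {z : (ℝ × ℝ) × (ℝ × ℝ) | z.1.1 - z.1.2 < z.2.1} :=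
      measurableSet_lt (by fun_prop) (by fun_prop)
    have h2 : MeasurableSet {z : (ℝ × ℝ) × (ℝ × ℝ) | z.1.1 + z.1.2 < z.2.2} :=
      measurableSet_lt (by fun_prop) (by fun_prop)
    exact h1.inter h2
  have hprod : Integrable (fun z : (ℝ × ℝ) × (ℝ × ℝ) => S.indicator (fun z => F' z.1 * m z.2) z)
      (volume.prod volume) := (hF'int.mul_prod hmint).indicator hSm
  have h1 : ∫ p : ℝ × ℝ, quadrantInt F (p.1 - p.2) (p.1 + p.2) * box φ p
      = 1 / 2 * ∫ q : ℝ × ℝ, quadrantInt F q.1 q.2 * m q := by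
    rw [← integral_comp_charMap]
    simp only [hm, charMap.symm_apply_apply]
    rfl
  have h2 : ∀ x : ℝ × ℝ, quadrantInt F x.1 x.2 * m x
      = ∫ q, S.indicator (fun z => F' z.1 * m z.2) (q, x) := by
    intro x
    by_cases hx : M ≤ x.2
    · rw [hM x hx, mul_zero]
      refine (integral_eq_zero_of_ae (Eventually.of_forall fun q => ?_)).symm
      simp [indicator, hM x hx]
    · rw [quadrantInt, ← integral_indicator (measurableSet_quadrant _ _), ← integral_mul_const]
      refine integral_congr_ae (Eventually.of_forall fun q => ?_)
      simp only [indicator, hS, mem_ofPred_eq, hF']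
      push Not at hx
      by_cases hq : q.1 - q.2 < x.1 ∧ q.1 + q.2 < x.2
      · have : q.1 + q.2 < M := hq.2.trans hx
        simp [hq, this]
      · simp [hq]
  have h3 : ∀ q : ℝ × ℝ, ∫ x, S.indicator (fun z => F' z.1 * m z.2) (q, x)
      = 4 * (F q * φ q) := by
    intro q
    have h4 : ∀ x : ℝ × ℝ, S.indicator (fun z => F' z.1 * m z.2) (q, x)
        = (Ioi (q.1 - q.2) ×ˢ Ioi (q.1 + q.2)).indicator (fun x => F q * m x) x := by
      intro x
      simp only [indicator, hS, mem_ofPred_eq, hF', mem_prod, mem_Ioi]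
      by_cases hq : q.1 - q.2 < x.1 ∧ q.1 + q.2 < x.2
      · rw [if_pos hq, if_pos hq]
        split_ifs with h5
        · rfl
        · rw [hM x ((not_lt.1 h5).trans hq.2.le)]; simp
      · rw [if_neg hq, if_neg hq]
    simp only [h4]
    rw [integral_indicator (measurableSet_Ioi.prod measurableSet_Ioi), integral_const_mul, hm,
      integral_quadrant_box hφ hc, ← charMap_apply, charMap.symm_apply_apply]
    ring
  rw [h1]
  simp only [h2]
  rw [← integral_integral_swap (f := fun q x => S.indicator (fun z => F' z.1 * m z.2) (q, x)) hprod]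
  simp only [h3, integral_const_mul]
  ring

theorem quadrantInt_eq_zero (hF : ∀ q : ℝ × ℝ, q.1 ≤ 0 → F q = 0) {a b : ℝ} (hab : a + b ≤ 0) :
    quadrantInt F a b = 0 := by
  refine setIntegral_eq_zero_of_forall_eq_zero fun q hq => hF q ?_
  have h1 := hq.1
  have h2 := hq.2
  linarith

/-- On the line t - x = a the half plane t > 0 is the ray b > -a. Integrating 4 ∂ᵦ∂ₐφ along it
leaves only the boundary value of ∂ₐφ = (φ_t - φ_x)/2 at (0, -a). -/
theorem integral_half_fst_mul_box {f : ℝ → ℝ} (hf : Continuous f) (hφ : ContDiff ℝ ∞ φ)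
    (hc : HasCompactSupport φ) :
    ∫ p in {p : ℝ × ℝ | 0 < p.1}, f (p.1 - p.2) * box φ p
      = -∫ x, f (-x) * fderiv ℝ φ (0, x) (1, -1) := by
  have hcont : Continuous fun q => box φ (charMap.symm q) :=
    (contDiff_box hφ).continuous.comp charMap.symm.continuous
  have hcs : HasCompactSupport fun q => box φ (charMap.symm q) :=
    (hasCompactSupport_box hc).comp_homeomorph charMap.symm.toHomeomorph
  have hS : MeasurableSet {q : ℝ × ℝ | 0 < q.1 + q.2} :=
    measurableSet_lt (by fun_prop) (by fun_prop)
  have hint : Integrable (fun q : ℝ × ℝ => {q : ℝ × ℝ | 0 < q.1 + q.2}.indicator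
      (fun q => f q.1 * box φ (charMap.symm q)) q) :=
    ((hf.comp continuous_fst).mul hcont).integrable_of_hasCompactSupport hcs.mul_left
      |>.indicator hS
  have h1 : ∫ p in {p : ℝ × ℝ | 0 < p.1}, f (p.1 - p.2) * box φ p
      = 1 / 2 * ∫ q : ℝ × ℝ, {q : ℝ × ℝ | 0 < q.1 + q.2}.indicator
        (fun q => f q.1 * box φ (charMap.symm q)) q := by
    rw [← integral_comp_charMap, ← integral_indicator (measurableSet_lt (by fun_prop) (by fun_prop))]
    refine integral_congr_ae (Eventually.of_forall fun p => ?_)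
    have : 0 < p.1 ↔ 0 < p.1 - p.2 + (p.1 + p.2) := by constructor <;> intro h <;> linarith
    simp only [indicator, mem_ofPred_eq, this, charMap_apply]
    simp only [← charMap_apply, charMap.symm_apply_apply]
  rw [h1, Measure.volume_eq_prod, integral_prod _ (by rwa [Measure.volume_eq_prod] at hint)]
  have h2 : ∀ a : ℝ, ∫ b, {q : ℝ × ℝ | 0 < q.1 + q.2}.indicator
      (fun q => f q.1 * box φ (charMap.symm q)) (a, b)
      = -2 * (f a * fderiv ℝ φ (0, -a) (1, -1)) := by
    intro a
    have h3 : ∀ b, {q : ℝ × ℝ | 0 < q.1 + q.2}.indicator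
        (fun q => f q.1 * box φ (charMap.symm q)) (a, b)
        = (Ioi (-a)).indicator (fun b => f a * box φ (charMap.symm (a, b))) b := by
      intro b
      have : 0 < a + b ↔ -a < b := by constructor <;> intro h <;> linarith
      simp only [indicator, mem_ofPred_eq, mem_Ioi, this]
    simp only [h3]
    rw [integral_indicator measurableSet_Ioi, integral_const_mul, integral_Ioi_box_right hφ hc]
    have h4 : charMap.symm (a, -a) = (0, -a) := by
      rw [charMap_symm_apply]; ext <;> simp; ring
    have h5 : ((1 / 2, -1 / 2) : ℝ × ℝ) = (1 / 2 : ℝ) • (1, -1) := by ext <;> simp; norm_num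
    rw [h4, h5, map_smul, smul_eq_mul]; ring
  simp only [h2, integral_const_mul]
  rw [← integral_neg_eq_self]
  simp only [neg_neg]
  ring

theorem integral_half_snd_mul_box {f : ℝ → ℝ} (hf : Continuous f) (hφ : ContDiff ℝ ∞ φ)
    (hc : HasCompactSupport φ) :
    ∫ p in {p : ℝ × ℝ | 0 < p.1}, f (p.1 + p.2) * box φ p
      = -∫ x, f x * fderiv ℝ φ (0, x) (1, 1) := by
  have hcont : Continuous fun q => box φ (charMap.symm q) :=
    (contDiff_box hφ).continuous.comp charMap.symm.continuous
  have hcs : HasCompactSupport fun q => box φ (charMap.symm q) :=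
    (hasCompactSupport_box hc).comp_homeomorph charMap.symm.toHomeomorph
  have hS : MeasurableSet {q : ℝ × ℝ | 0 < q.1 + q.2} :=
    measurableSet_lt (by fun_prop) (by fun_prop)
  have hint : Integrable (fun q : ℝ × ℝ => {q : ℝ × ℝ | 0 < q.1 + q.2}.indicator
      (fun q => f q.2 * box φ (charMap.symm q)) q) :=
    ((hf.comp continuous_snd).mul hcont).integrable_of_hasCompactSupport hcs.mul_left
      |>.indicator hS
  have h1 : ∫ p in {p : ℝ × ℝ | 0 < p.1}, f (p.1 + p.2) * box φ p
      = 1 / 2 * ∫ q : ℝ × ℝ, {q : ℝ × ℝ | 0 < q.1 + q.2}.indicator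
        (fun q => f q.2 * box φ (charMap.symm q)) q := by
    rw [← integral_comp_charMap, ← integral_indicator (measurableSet_lt (by fun_prop) (by fun_prop))]
    refine integral_congr_ae (Eventually.of_forall fun p => ?_)
    have : 0 < p.1 ↔ 0 < p.1 - p.2 + (p.1 + p.2) := by constructor <;> intro h <;> linarith
    simp only [indicator, mem_ofPred_eq, this, charMap_apply]
    simp only [← charMap_apply, charMap.symm_apply_apply]
  rw [h1, Measure.volume_eq_prod, integral_prod_symm _ (by rwa [Measure.volume_eq_prod] at hint)]
  have h2 : ∀ b : ℝ, ∫ a, {q : ℝ × ℝ | 0 < q.1 + q.2}.indicator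
      (fun q => f q.2 * box φ (charMap.symm q)) (a, b)
      = -2 * (f b * fderiv ℝ φ (0, b) (1, 1)) := by
    intro b
    have h3 : ∀ a, {q : ℝ × ℝ | 0 < q.1 + q.2}.indicator
        (fun q => f q.2 * box φ (charMap.symm q)) (a, b)
        = (Ioi (-b)).indicator (fun a => f b * box φ (charMap.symm (a, b))) a := by
      intro a
      have : 0 < a + b ↔ -b < a := by constructor <;> intro h <;> linarith
      simp only [indicator, mem_ofPred_eq, mem_Ioi, this]
    simp only [h3]
    rw [integral_indicator measurableSet_Ioi, integral_const_mul, integral_Ioi_box_left hφ hc]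
    have h4 : charMap.symm (-b, b) = (0, b) := by
      rw [charMap_symm_apply]; ext <;> simp
    have h5 : ((1 / 2, 1 / 2) : ℝ × ℝ) = (1 / 2 : ℝ) • (1, 1) := by ext <;> simp
    rw [h4, h5, map_smul, smul_eq_mul]; ring
  simp only [h2, integral_const_mul]
  ring

/-- A superposition of travelling waves and of a quadrant integral, tested against the wave
operator on the half plane `t > 0`. -/
theorem integral_half_travelling_mul_box {f g : ℝ → ℝ} (hf : Continuous f) (hg : Continuous g)
    (hF : ∀ M : ℝ, IntegrableOn F {q | q.1 + q.2 < M}) (hF0 : ∀ q : ℝ × ℝ, q.1 ≤ 0 → F q = 0)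
    (κ : ℝ) (hφ : ContDiff ℝ ∞ φ) (hc : HasCompactSupport φ) :
    ∫ p in {p : ℝ × ℝ | 0 < p.1},
      (f (p.1 - p.2) + g (p.1 + p.2) + κ * quadrantInt F (p.1 - p.2) (p.1 + p.2)) * box φ p
    = 2 * κ * (∫ p, F p * φ p) - (∫ x, f (-x) * fderiv ℝ φ (0, x) (1, -1))
      - ∫ x, g x * fderiv ℝ φ (0, x) (1, 1) := by
  have hb := (contDiff_box hφ).continuous
  have hbc := hasCompactSupport_box hc
  have hI : Continuous fun p : ℝ × ℝ => quadrantInt F (p.1 - p.2) (p.1 + p.2) :=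
    (continuous_quadrantInt hF).comp charMap.continuous
  have i1 : Integrable fun p : ℝ × ℝ => f (p.1 - p.2) * box φ p :=
    ((hf.comp (continuous_fst.sub continuous_snd)).mul hb).integrable_of_hasCompactSupport
      hbc.mul_left
  have i2 : Integrable fun p : ℝ × ℝ => g (p.1 + p.2) * box φ p :=
    ((hg.comp (continuous_fst.add continuous_snd)).mul hb).integrable_of_hasCompactSupport
      hbc.mul_left
  have i3 : Integrable fun p : ℝ × ℝ => κ * (quadrantInt F (p.1 - p.2) (p.1 + p.2) * box φ p) :=
    ((hI.mul hb).integrable_of_hasCompactSupport hbc.mul_left).const_mul κ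
  have h3 : ∫ p in {p : ℝ × ℝ | 0 < p.1}, quadrantInt F (p.1 - p.2) (p.1 + p.2) * box φ p
      = 2 * ∫ p, F p * φ p := by
    rw [← integral_quadrantInt_mul_box hF hφ hc,
      setIntegral_eq_integral_of_forall_compl_eq_zero fun p hp => ?_]
    rw [quadrantInt_eq_zero hF0, zero_mul]
    have hp : ¬ 0 < p.1 := hp
    linarith
  simp only [add_mul, mul_assoc κ]
  have i12 : Integrable fun p : ℝ × ℝ => f (p.1 - p.2) * box φ p + g (p.1 + p.2) * box φ p :=
    i1.add i2
  rw [integral_add i12.integrableOn i3.integrableOn,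
    integral_add i1.integrableOn i2.integrableOn, integral_const_mul, h3,
    integral_half_fst_mul_box hf hφ hc, integral_half_snd_mul_box hg hφ hc]
  ring

end Characteristic

/-! ### The representation formula as one function on the plane. -/

section Representation

open scoped ContDiff

variable {ℓ₀ : ℝ} {ℓ z v₀ v₁ : ℝ → ℝ} {v : ℝ × ℝ → ℝ}

/-- The continuous extension of `v₀` to the real line by constants. -/
noncomputable def clampIcc (ℓ₀ : ℝ) (v₀ : ℝ → ℝ) (s : ℝ) : ℝ := v₀ (max 0 (min s ℓ₀))

/-- The primitive of `v₁`. -/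
noncomputable def primitive (ℓ₀ : ℝ) (v₁ : ℝ → ℝ) (s : ℝ) : ℝ :=
  ∫ r in Iic s, (Ioo 0 ℓ₀).indicator v₁ r

/-- The profile of the wave `f(t - x)` in d'Alembert's formula. -/
noncomputable def profileRight (ℓ₀ : ℝ) (z v₀ v₁ : ℝ → ℝ) (s : ℝ) : ℝ :=
  if s ≤ 0 then 1 / 2 * clampIcc ℓ₀ v₀ (-s) - 1 / 2 * primitive ℓ₀ v₁ (-s)
  else z (max 0 s) - 1 / 2 * clampIcc ℓ₀ v₀ s - 1 / 2 * primitive ℓ₀ v₁ s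

/-- The profile of the wave `g(t + x)` in d'Alembert's formula. -/
noncomputable def profileLeft (ℓ₀ : ℝ) (ℓ z v₀ v₁ : ℝ → ℝ) (s : ℝ) : ℝ :=
  if s ≤ ℓ₀ then 1 / 2 * clampIcc ℓ₀ v₀ s + 1 / 2 * primitive ℓ₀ v₁ s
  else -profileRight ℓ₀ z v₀ v₁ (omegaExt ℓ₀ ℓ s)

theorem clampIcc_of_mem {s : ℝ} (hs : s ∈ Icc 0 ℓ₀) : clampIcc ℓ₀ v₀ s = v₀ s := by
  rw [clampIcc, min_eq_left hs.2, max_eq_right hs.1]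

theorem continuous_clampIcc (hℓ₀ : 0 < ℓ₀) (hv₀ : ContinuousOn v₀ (Icc 0 ℓ₀)) :
    Continuous (clampIcc ℓ₀ v₀) :=
  hv₀.comp_continuous (by fun_prop) fun s =>
    ⟨le_max_left _ _, max_le hℓ₀.le (min_le_right _ _)⟩

theorem primitive_sub (hv₁ : IntegrableOn v₁ (Ioo 0 ℓ₀)) (a b : ℝ) :
    primitive ℓ₀ v₁ b - primitive ℓ₀ v₁ a = ∫ r in a..b, (Ioo 0 ℓ₀).indicator v₁ r := by
  have h := hv₁.integrable_indicator measurableSet_Ioo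
  exact intervalIntegral.integral_Iic_sub_Iic h.integrableOn h.integrableOn

theorem primitive_sub_of_mem (hv₁ : IntegrableOn v₁ (Ioo 0 ℓ₀)) {a b : ℝ} (ha : 0 ≤ a)
    (hab : a ≤ b) (hb : b ≤ ℓ₀) :
    primitive ℓ₀ v₁ b - primitive ℓ₀ v₁ a = ∫ r in a..b, v₁ r := by
  rw [primitive_sub hv₁, intervalIntegral.integral_of_le hab, intervalIntegral.integral_of_le hab,
    integral_Ioc_eq_integral_Ioo, integral_Ioc_eq_integral_Ioo]
  exact setIntegral_congr_fun measurableSet_Ioo fun r hr =>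
    indicator_of_mem (show r ∈ Ioo 0 ℓ₀ from ⟨ha.trans_lt hr.1, hr.2.trans_le hb⟩) _

theorem continuous_primitive (hv₁ : IntegrableOn v₁ (Ioo 0 ℓ₀)) :
    Continuous (primitive ℓ₀ v₁) := by
  have h := hv₁.integrable_indicator measurableSet_Ioo
  have h1 : primitive ℓ₀ v₁ = fun s =>
      primitive ℓ₀ v₁ 0 + ∫ r in (0 : ℝ)..s, (Ioo 0 ℓ₀).indicator v₁ r := by
    ext s; rw [← primitive_sub hv₁]; ring
  rw [h1]
  exact continuous_const.add
    (intervalIntegral.continuous_primitive (fun a b => h.intervalIntegrable) 0)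

theorem primitive_zero : primitive ℓ₀ v₁ 0 = 0 := by
  refine setIntegral_eq_zero_of_forall_eq_zero fun r hr => ?_
  exact indicator_of_notMem (fun h => absurd h.1 (not_lt.2 hr)) _

/-- The branches coming from the initial line and from x = 0 match at s = 0 precisely because v₀(0)
= z(0). -/
theorem continuous_profileRight (hℓ₀ : 0 < ℓ₀) (hz : ContinuousOn z (Ici 0))
    (hv₀ : ContinuousOn v₀ (Icc 0 ℓ₀)) (hv₁ : IntegrableOn v₁ (Ioo 0 ℓ₀)) (hc : v₀ 0 = z 0) :
    Continuous (profileRight ℓ₀ z v₀ v₁) := by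
  have h1 := continuous_clampIcc hℓ₀ hv₀
  have h2 := continuous_primitive hv₁
  have h3 : Continuous fun s => z (max 0 s) :=
    hz.comp_continuous (by fun_prop) fun s => mem_Ici.2 (le_max_left _ _)
  refine Continuous.if_le (by fun_prop)
    ((h3.sub (h1.const_mul _)).sub (h2.const_mul _)) continuous_id continuous_const ?_
  rintro s rfl
  simp only [neg_zero, max_self, primitive_zero, clampIcc, min_eq_left hℓ₀.le, hc]
  ring

/-- At s = ℓ₀ one has ω(ℓ₀) = -ℓ₀; the primitives of v₁ agree there and the values of v₀ have
opposite signs, so v₀(ℓ₀) = 0 is needed. -/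
theorem continuous_profileLeft (h : IsFront ℓ₀ ℓ) (hℓ₀ : 0 < ℓ₀) (hz : ContinuousOn z (Ici 0))
    (hv₀ : ContinuousOn v₀ (Icc 0 ℓ₀)) (hv₁ : IntegrableOn v₁ (Ioo 0 ℓ₀)) (hc : v₀ 0 = z 0)
    (hc' : v₀ ℓ₀ = 0) : Continuous (profileLeft ℓ₀ ℓ z v₀ v₁) := by
  have h1 := continuous_clampIcc hℓ₀ hv₀
  have h2 := continuous_primitive hv₁
  have h3 := (continuous_profileRight hℓ₀ hz hv₀ hv₁ hc).comp h.continuous_omegaExt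
  refine Continuous.if_le (by fun_prop) h3.neg continuous_id continuous_const ?_
  intro s hs
  change s = ℓ₀ at hs
  subst hs
  rw [omegaExt_of_le le_rfl, profileRight, if_pos (by linarith), neg_neg,
    clampIcc_of_mem ⟨hℓ₀.le, le_rfl⟩, hc']
  ring

/-- The right hand side of the representation formula, as a function on the whole plane. -/
noncomputable def reprFun (ℓ₀ : ℝ) (ℓ z v₀ v₁ : ℝ → ℝ) (κ : ℝ) (F : ℝ × ℝ → ℝ) (p : ℝ × ℝ) : ℝ :=
  (profileRight ℓ₀ z v₀ v₁ (p.1 - p.2) - κ * quadrantInt F (p.1 - p.2) (p.1 - p.2))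
    + (profileLeft ℓ₀ ℓ z v₀ v₁ (p.1 + p.2)
      - κ * quadrantInt F (omegaExt ℓ₀ ℓ (p.1 + p.2)) (p.1 + p.2))
    + κ * quadrantInt F (p.1 - p.2) (p.1 + p.2)

/-- The extension of `v` by zero outside `Ω'`. -/
noncomputable def extendZero (ℓ₀ : ℝ) (ℓ : ℝ → ℝ) (v : ℝ × ℝ → ℝ) : ℝ × ℝ → ℝ :=
  (Omega' ℓ₀ ℓ).indicator v

theorem pos_of_mem_Omega' {p : ℝ × ℝ} (hp : p ∈ Omega' ℓ₀ ℓ) : 0 < p.1 ∧ 0 < p.2 := by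
  rcases hp with (hp | hp) | hp <;> exact ⟨hp.1.1, hp.1.2.1⟩

theorem lt_front_of_mem_Omega' {p : ℝ × ℝ} (hp : p ∈ Omega' ℓ₀ ℓ) : p.2 < ℓ p.1 := by
  rcases hp with (hp | hp) | hp <;> exact hp.1.2.2

theorem extendZero_eq_zero {q : ℝ × ℝ} (hq : q.1 ≤ 0) : extendZero ℓ₀ ℓ v q = 0 :=
  indicator_of_notMem (fun h => absurd (pos_of_mem_Omega' h).1 (not_lt.2 hq)) _

theorem quadrantInt_extendZero_of_nonpos {a b : ℝ} (hb : b ≤ 0) :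
    quadrantInt (extendZero ℓ₀ ℓ v) a b = 0 := by
  refine setIntegral_eq_zero_of_forall_eq_zero fun q hq => indicator_of_notMem (fun h => ?_) _
  have h1 := pos_of_mem_Omega' h
  have h2 := hq.2
  linarith [h1.1, h1.2]

theorem quadrantInt_extendZero_of_add_nonpos {a b : ℝ} (hab : a + b ≤ 0) :
    quadrantInt (extendZero ℓ₀ ℓ v) a b = 0 :=
  quadrantInt_eq_zero (fun _ => extendZero_eq_zero) hab

theorem IsFront.Omega'T_subset (h : IsFront ℓ₀ ℓ) (T : ℝ) :
    Omega'T ℓ₀ ℓ T ⊆ Icc 0 T ×ˢ Icc 0 (ℓ₀ + T) := by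
  rintro ⟨t, x⟩ ⟨hp, hT⟩
  have h1 := pos_of_mem_Omega' hp
  have h2 := lt_front_of_mem_Omega' hp
  simp only at h1 h2 hT
  have h3 := (h.sub_mem le_rfl h1.1.le).2
  rw [h.zero] at h3
  exact ⟨⟨h1.1.le, hT.le⟩, h1.2.le, by linarith⟩

theorem IsFront.volume_Omega'T_lt_top (h : IsFront ℓ₀ ℓ) (T : ℝ) :
    volume (Omega'T ℓ₀ ℓ T) < ⊤ :=
  (measure_mono (h.Omega'T_subset T)).trans_lt (isCompact_Icc.prod isCompact_Icc).measure_lt_top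

theorem IsFront.integrableOn_of_memLp (h : IsFront ℓ₀ ℓ) {T : ℝ}
    (hv : MemLp v 2 (volume.restrict (Omega'T ℓ₀ ℓ T))) : IntegrableOn v (Omega'T ℓ₀ ℓ T) := by
  have : IsFiniteMeasure (volume.restrict (Omega'T ℓ₀ ℓ T)) :=
    ⟨by rw [Measure.restrict_apply_univ]; exact h.volume_Omega'T_lt_top T⟩
  exact hv.integrable one_le_two

/-- Since x > 0 in Ω', the bound t + x < M forces t < M; and Ω'_T has finite measure, so L² gives
L¹. -/
theorem IsFront.integrableOn_extendZero (h : IsFront ℓ₀ ℓ) (hℓ₀ : 0 < ℓ₀)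
    (hv : ∀ T : ℝ, 0 < T → MemLp v 2 (volume.restrict (Omega'T ℓ₀ ℓ T))) (M : ℝ) :
    IntegrableOn (extendZero ℓ₀ ℓ v) {q | q.1 + q.2 < M} := by
  have h1 := h.integrableOn_of_memLp (hv (max M 1) (by positivity))
  rw [extendZero, IntegrableOn, integrable_indicator_iff (h.measurableSet_Omega' hℓ₀),
    IntegrableOn, Measure.restrict_restrict (h.measurableSet_Omega' hℓ₀)]
  refine h1.mono_set fun q hq => ⟨hq.1, ?_⟩
  have h2 := pos_of_mem_Omega' hq.1
  have h3 : q.1 + q.2 < M := hq.2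
  exact lt_max_of_lt_left (by linarith [h2.2])

/-- Inclusion-exclusion for the rectangle (w, a) × (a, b), with a = t - x, b = t + x: from the
quadrant at (a, b) remove those at (a, a) and (w, b). No corner has to be added back, because their
intersection misses Ω'. -/
theorem setIntegral_region (h : IsFront ℓ₀ ℓ) (hℓ₀ : 0 < ℓ₀)
    (hF : ∀ M : ℝ, IntegrableOn (extendZero ℓ₀ ℓ v) {q | q.1 + q.2 < M}) {p : ℝ × ℝ}
    (hp : p ∈ punctured ℓ₀ ℓ) :
    ∫ q in region ℓ₀ ℓ p, v q =
      quadrantInt (extendZero ℓ₀ ℓ v) (p.1 - p.2) (p.1 + p.2)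
      - quadrantInt (extendZero ℓ₀ ℓ v) (p.1 - p.2) (p.1 - p.2)
      - quadrantInt (extendZero ℓ₀ ℓ v) (omegaExt ℓ₀ ℓ (p.1 + p.2)) (p.1 + p.2) := by
  obtain ⟨t, x⟩ := p
  simp only
  set w := omegaExt ℓ₀ ℓ (t + x) with hw
  set F := extendZero ℓ₀ ℓ v with hFdef
  set R : Set (ℝ × ℝ) := {q | (w < q.1 - q.2 ∧ q.1 - q.2 < t - x) ∧
    (t - x < q.1 + q.2 ∧ q.1 + q.2 < t + x)} with hR
  have hRm : MeasurableSet R := by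
    have h1 : MeasurableSet {q : ℝ × ℝ | w < q.1 - q.2} :=
      measurableSet_lt (by fun_prop) (by fun_prop)
    have h2 : MeasurableSet {q : ℝ × ℝ | t - x < q.1 + q.2} :=
      measurableSet_lt (by fun_prop) (by fun_prop)
    have h3 : MeasurableSet {q : ℝ × ℝ | q.1 - q.2 < t - x} :=
      measurableSet_lt (by fun_prop) (by fun_prop)
    have h4 : MeasurableSet {q : ℝ × ℝ | q.1 + q.2 < t + x} :=
      measurableSet_lt (by fun_prop) (by fun_prop)
    exact (h1.inter h3).inter (h2.inter h4)
  have hreg : region ℓ₀ ℓ (t, x) = R ∩ Omega' ℓ₀ ℓ := by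
    ext q
    rw [h.mem_region_iff hp, mem_inter_iff, and_comm]
    refine and_congr_left fun _ => ?_
    simp only [hR, mem_ofPred_eq]
    tauto
  have hx : 0 < x := hp.1
  have hwt : w < t - x := by
    have h2 : hitTime ℓ₀ ℓ (t + x) < t := hp.2.1
    rw [hw, omegaExt]; linarith
  have hint : ∀ a b, Integrable (({q : ℝ × ℝ | q.1 - q.2 < a ∧ q.1 + q.2 < b}).indicator F) :=
    fun a b => ((hF b).mono_set fun q hq => hq.2).integrable_indicator (measurableSet_quadrant _ _)
  have hintR : Integrable (R.indicator F) :=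
    ((hF (t + x)).mono_set fun q hq => hq.2.2).integrable_indicator hRm
  rw [hreg, ← setIntegral_indicator (h.measurableSet_Omega' hℓ₀)]
  change ∫ q in R, F q = _
  rw [sub_sub, eq_sub_iff_add_eq]
  simp only [quadrantInt]
  rw [← integral_indicator hRm, ← integral_indicator (measurableSet_quadrant _ _),
    ← integral_indicator (measurableSet_quadrant _ _),
    ← integral_indicator (measurableSet_quadrant _ _), ← integral_add (hint _ _) (hint _ _),
    ← integral_add (g := fun q => {q : ℝ × ℝ | q.1 - q.2 < t - x ∧ q.1 + q.2 < t - x}.indicator F q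
      + {q : ℝ × ℝ | q.1 - q.2 < w ∧ q.1 + q.2 < t + x}.indicator F q) hintR
      ((hint _ _).add (hint _ _))]
  refine integral_congr_ae ?_
  filter_upwards [ae_fst_ne_charMap w, ae_snd_ne_charMap (t - x)] with q h1 h2
  by_cases hq : q ∈ Omega' ℓ₀ ℓ
  swap
  · have : F q = 0 := indicator_of_notMem hq _
    simp [indicator, this]
  have hq0 := pos_of_mem_Omega' hq
  -- If t < x, the second inequality makes τ + σ negative. If t + x < ℓ₀, then w = -(t + x), and
  -- adding the two inequalities gives τ < -x.
  have hdisj : ¬ (q.1 - q.2 < w ∧ q.1 + q.2 < t - x) := by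
    rintro ⟨h3, h4⟩
    rcases hp.2.2 with h5 | h5
    · simp only at h5; linarith [hq0.1, hq0.2]
    · simp only at h5; rw [hw, omegaExt_of_le h5.le] at h3; linarith [hq0.1, hq0.2]
  simp only [indicator, hR, mem_ofPred_eq]
  rcases lt_or_gt_of_ne h1 with h3 | h3 <;> rcases lt_or_gt_of_ne h2 with h4 | h4
  · exact absurd ⟨h3, h4⟩ hdisj
  · have h5 : q.1 - q.2 < t - x := h3.trans hwt
    simp [h3, h5, not_lt.2 h3.le, not_lt.2 h4.le]
  · have h5 : q.1 + q.2 < t + x := by linarith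
    simp [h4, h5, not_lt.2 h3.le, not_lt.2 h4.le]
  · simp [h3, h4, not_lt.2 h3.le, not_lt.2 h4.le]

theorem dAlembert_eq (h : IsFront ℓ₀ ℓ) (hv₁ : IntegrableOn v₁ (Ioo 0 ℓ₀)) {p : ℝ × ℝ}
    (hp : p ∈ punctured ℓ₀ ℓ) :
    dAlembert ℓ₀ ℓ z v₀ v₁ p =
      profileRight ℓ₀ z v₀ v₁ (p.1 - p.2) + profileLeft ℓ₀ ℓ z v₀ v₁ (p.1 + p.2) := by
  obtain ⟨t, x⟩ := p
  obtain ⟨hx, hT, hc⟩ := hp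
  simp only at hx hT hc
  have hΩ : (t, x) ∈ Omega ℓ := h.mem_Omega_iff.2 ⟨hx, hT⟩
  have ht : 0 < t := hΩ.1
  simp only [dAlembert]
  split_ifs with h1 h2 h3
  · obtain ⟨-, h4, h5⟩ := h1
    simp only at h4 h5
    rw [profileRight, if_pos (by linarith), profileLeft, if_pos h5, neg_sub,
      clampIcc_of_mem ⟨by linarith, by linarith⟩, clampIcc_of_mem ⟨by linarith, by linarith⟩,
      ← primitive_sub_of_mem hv₁ (by linarith) (by linarith) (by linarith), add_comm t x]
    ring
  · obtain ⟨-, h4, h5⟩ := h2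
    simp only at h4 h5
    rw [profileRight, if_neg (by linarith), profileLeft, if_pos h5.le,
      clampIcc_of_mem ⟨by linarith, by linarith⟩, clampIcc_of_mem ⟨by linarith, by linarith⟩,
      ← primitive_sub_of_mem hv₁ (by linarith) (by linarith) (by linarith),
      max_eq_right (by linarith)]
    ring
  · obtain ⟨-, h4, h5⟩ := h3
    simp only at h4 h5
    have hw : omegaExt ℓ₀ ℓ (t + x) < t - x := by rw [omegaExt]; linarith
    have hw' := h.neg_le_omegaExt h5.le
    rw [profileRight, if_pos (by linarith), profileLeft, if_neg (by linarith), profileRight,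
      if_pos (by linarith), neg_sub,
      clampIcc_of_mem ⟨by linarith, by linarith⟩, clampIcc_of_mem ⟨by linarith, by linarith⟩,
      add_comm x t, ← h.omegaExt_eq_omega h5,
      ← primitive_sub_of_mem hv₁ (by linarith) (by linarith) (by linarith)]
    ring
  · exfalso
    rcases le_or_gt t x with h4 | h4
    · rcases le_or_gt (t + x) ℓ₀ with h5 | h5
      · exact h1 ⟨hΩ, h4, h5⟩
      · rcases hc with h6 | h6
        · exact h3 ⟨hΩ, h6, h5⟩
        · linarith
    · exact h2 ⟨hΩ, h4, hc.resolve_left (not_lt.2 h4.le)⟩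

theorem reprFun_eq (h : IsFront ℓ₀ ℓ) (hℓ₀ : 0 < ℓ₀) (hv₁ : IntegrableOn v₁ (Ioo 0 ℓ₀))
    (hF : ∀ M : ℝ, IntegrableOn (extendZero ℓ₀ ℓ v) {q | q.1 + q.2 < M}) (κ : ℝ) {p : ℝ × ℝ}
    (hp : p ∈ punctured ℓ₀ ℓ) :
    reprFun ℓ₀ ℓ z v₀ v₁ κ (extendZero ℓ₀ ℓ v) p =
      dAlembert ℓ₀ ℓ z v₀ v₁ p + κ * ∫ q in region ℓ₀ ℓ p, v q := by
  rw [dAlembert_eq h hv₁ hp, setIntegral_region h hℓ₀ hF hp, reprFun]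
  ring

variable {F : ℝ × ℝ → ℝ}

theorem continuous_reprFun (h : IsFront ℓ₀ ℓ) (hℓ₀ : 0 < ℓ₀) (hz : ContinuousOn z (Ici 0))
    (hv₀ : ContinuousOn v₀ (Icc 0 ℓ₀)) (hv₁ : IntegrableOn v₁ (Ioo 0 ℓ₀)) (hc : v₀ 0 = z 0)
    (hc' : v₀ ℓ₀ = 0) (hF : ∀ M : ℝ, IntegrableOn F {q | q.1 + q.2 < M}) (κ : ℝ) :
    Continuous (reprFun ℓ₀ ℓ z v₀ v₁ κ F) := by
  have h1 := continuous_profileRight hℓ₀ hz hv₀ hv₁ hc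
  have h2 := continuous_profileLeft h hℓ₀ hz hv₀ hv₁ hc hc'
  have h3 := continuous_quadrantInt hF
  have h4 := h.continuous_omegaExt
  have e1 : Continuous fun p : ℝ × ℝ => quadrantInt F (p.1 - p.2) (p.1 - p.2) :=
    h3.comp (g := fun q : ℝ × ℝ => quadrantInt F q.1 q.2)
      (f := fun p : ℝ × ℝ => (p.1 - p.2, p.1 - p.2)) (by fun_prop)
  have e2 : Continuous fun p : ℝ × ℝ =>
      quadrantInt F (omegaExt ℓ₀ ℓ (p.1 + p.2)) (p.1 + p.2) :=
    h3.comp (g := fun q : ℝ × ℝ => quadrantInt F q.1 q.2)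
      (f := fun p : ℝ × ℝ => (omegaExt ℓ₀ ℓ (p.1 + p.2), p.1 + p.2)) (by fun_prop)
  have e3 : Continuous fun p : ℝ × ℝ => quadrantInt F (p.1 - p.2) (p.1 + p.2) :=
    h3.comp (g := fun q : ℝ × ℝ => quadrantInt F q.1 q.2)
      (f := fun p : ℝ × ℝ => (p.1 - p.2, p.1 + p.2)) (by fun_prop)
  unfold reprFun
  fun_prop

/-- On x = 0 the vertex (a, b) is (t, t), so two quadrant terms cancel; the third sits at (-t, t),
whose quadrant contains no point with t > 0. The profiles add up to z by construction. -/
theorem reprFun_left {κ t : ℝ} (ht : 0 < t) (htℓ : t ≤ ℓ₀) :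
    reprFun ℓ₀ ℓ z v₀ v₁ κ (extendZero ℓ₀ ℓ v) (t, 0) = z t := by
  simp only [reprFun, sub_zero, add_zero]
  rw [omegaExt_of_le htℓ, quadrantInt_extendZero_of_add_nonpos (a := -t) (by linarith),
    profileRight, if_neg (not_le.2 ht), profileLeft, if_pos htℓ, max_eq_right ht.le]
  ring

/-- On the front a = ω(b), so the reflected quadrant term cancels the full one and g(b) = -f(ω(b))
cancels f(a). The remaining quadrant has b-bound t - ℓ(t) < 0 and misses Ω'; this uses t < ℓ(t). -/
theorem reprFun_front (h : IsFront ℓ₀ ℓ) {κ t : ℝ} (ht : 0 < t) (htℓ : t < ℓ t) :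
    reprFun ℓ₀ ℓ z v₀ v₁ κ (extendZero ℓ₀ ℓ v) (t, ℓ t) = 0 := by
  have h1 := h.omegaExt_psi ht.le
  have h2 := h.le ht.le
  simp only [psi, phi] at h1
  simp only [reprFun]
  rw [h1, quadrantInt_extendZero_of_nonpos (b := t - ℓ t) (by linarith), profileLeft,
    if_neg (by linarith), h1]
  ring

theorem reprFun_initial {κ x : ℝ} (hx : x ∈ Ioo 0 ℓ₀) :
    reprFun ℓ₀ ℓ z v₀ v₁ κ (extendZero ℓ₀ ℓ v) (0, x) = v₀ x := by
  simp only [reprFun, zero_sub, zero_add]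
  rw [omegaExt_of_le hx.2.le, quadrantInt_extendZero_of_add_nonpos (a := -x) (b := x) (by linarith),
    quadrantInt_extendZero_of_nonpos (b := -x) (by linarith [hx.1]),
    profileRight, if_pos (by linarith [hx.1]), profileLeft, if_pos hx.2.le, neg_neg,
    clampIcc_of_mem ⟨hx.1.le, hx.2.le⟩]
  ring

/-- Integration by parts, obtained from Fubini on {s ≤ x} because v₁ is only integrable. -/
theorem integral_primitive_mul_deriv (hv₁ : IntegrableOn v₁ (Ioo 0 ℓ₀)) {η : ℝ → ℝ}
    (hη : ContDiff ℝ ∞ η) (hc : HasCompactSupport η) :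
    ∫ x, primitive ℓ₀ v₁ x * deriv η x = -∫ x in Ioo 0 ℓ₀, v₁ x * η x := by
  set w := (Ioo 0 ℓ₀).indicator v₁ with hw
  have hwi : Integrable w := hv₁.integrable_indicator measurableSet_Ioo
  have hd : Integrable (deriv η) :=
    (hη.continuous_deriv (by simp)).integrable_of_hasCompactSupport hc.deriv
  set S : Set (ℝ × ℝ) := {z | z.1 ≤ z.2} with hS
  have hSm : MeasurableSet S := measurableSet_le (by fun_prop) (by fun_prop)
  have hprod : Integrable (fun z : ℝ × ℝ => S.indicator (fun z => w z.1 * deriv η z.2) z)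
      (volume.prod volume) := (hwi.mul_prod hd).indicator hSm
  have h1 : ∀ x, primitive ℓ₀ v₁ x * deriv η x
      = ∫ s, S.indicator (fun z => w z.1 * deriv η z.2) (s, x) := by
    intro x
    rw [primitive, ← integral_indicator measurableSet_Iic, ← integral_mul_const]
    refine integral_congr_ae (Eventually.of_forall fun s => ?_)
    simp only [indicator, hS, mem_ofPred_eq, mem_Iic]
    split_ifs <;> simp [*]
  have h2 : ∀ s, ∫ x, S.indicator (fun z => w z.1 * deriv η z.2) (s, x) = -(w s * η s) := by
    intro s
    have h3 : ∀ x, S.indicator (fun z => w z.1 * deriv η z.2) (s, x)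
        = (Ici s).indicator (fun x => w s * deriv η x) x := fun x => rfl
    simp only [h3]
    rw [integral_indicator measurableSet_Ici, integral_Ici_eq_integral_Ioi, integral_const_mul,
      HasCompactSupport.integral_Ioi_deriv_eq (hη.of_le (by simp)) hc]
    ring
  simp only [h1]
  rw [← integral_integral_swap (f := fun s x => S.indicator (fun z => w z.1 * deriv η z.2) (s, x))
    hprod]
  simp only [h2, integral_neg]
  rw [← integral_indicator measurableSet_Ioo]
  congr 1
  refine integral_congr_ae (Eventually.of_forall fun s => ?_)
  simp only [hw, indicator]
  split_ifs <;> simp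

variable {φ : ℝ × ℝ → ℝ}

/-- The representation formula defines a weak solution of the wave equation, with initial data
`v₀` and `v₁`. -/
theorem integral_half_reprFun_mul_box (h : IsFront ℓ₀ ℓ) (hℓ₀ : 0 < ℓ₀)
    (hz : ContinuousOn z (Ici 0)) (hv₀ : ContinuousOn v₀ (Icc 0 ℓ₀))
    (hv₁ : IntegrableOn v₁ (Ioo 0 ℓ₀)) (hc : v₀ 0 = z 0) (hc' : v₀ ℓ₀ = 0)
    (hF : ∀ M : ℝ, IntegrableOn (extendZero ℓ₀ ℓ v) {q | q.1 + q.2 < M}) (κ : ℝ)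
    (hφ : ContDiff ℝ ∞ φ) (hφc : HasCompactSupport φ)
    (hφ0 : ∀ x, (0, x) ∈ tsupport φ → x ∈ Ioo 0 ℓ₀) :
    ∫ p in {p : ℝ × ℝ | 0 < p.1},
      reprFun ℓ₀ ℓ z v₀ v₁ κ (extendZero ℓ₀ ℓ v) p * box φ p
    = 2 * κ * (∫ p in Omega' ℓ₀ ℓ, v p * φ p)
      - (∫ x in Ioo 0 ℓ₀, v₀ x * fderiv ℝ φ (0, x) (1, 0))
      + ∫ x in Ioo 0 ℓ₀, v₁ x * φ (0, x) := by
  set F := extendZero ℓ₀ ℓ v with hFd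
  have hcr := continuous_profileRight hℓ₀ hz hv₀ hv₁ hc
  have hcl := continuous_profileLeft h hℓ₀ hz hv₀ hv₁ hc hc'
  have hq := continuous_quadrantInt hF
  have hw := h.continuous_omegaExt
  have e1 : Continuous fun s : ℝ => quadrantInt F s s :=
    hq.comp (g := fun q : ℝ × ℝ => quadrantInt F q.1 q.2) (f := fun s : ℝ => (s, s)) (by fun_prop)
  have e2 : Continuous fun s : ℝ => quadrantInt F (omegaExt ℓ₀ ℓ s) s :=
    hq.comp (g := fun q : ℝ × ℝ => quadrantInt F q.1 q.2)
      (f := fun s : ℝ => (omegaExt ℓ₀ ℓ s, s)) (by fun_prop)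
  have hf : Continuous fun s => profileRight ℓ₀ z v₀ v₁ s - κ * quadrantInt F s s := by fun_prop
  have hg : Continuous fun s =>
      profileLeft ℓ₀ ℓ z v₀ v₁ s - κ * quadrantInt F (omegaExt ℓ₀ ℓ s) s := by fun_prop
  have key := integral_half_travelling_mul_box hf hg hF (fun _ => extendZero_eq_zero) κ hφ hφc
  change _ = 2 * κ * (∫ p in Omega' ℓ₀ ℓ, v p * φ p) - _ + _
  unfold reprFun
  rw [key]
  have h1 : ∫ p, F p * φ p = ∫ p in Omega' ℓ₀ ℓ, v p * φ p := by
    rw [← integral_indicator (h.measurableSet_Omega' hℓ₀)]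
    refine integral_congr_ae (Eventually.of_forall fun p => ?_)
    simp only [hFd, extendZero, indicator]; split_ifs <;> simp
  rw [h1]
  have hφd : Differentiable ℝ φ := hφ.differentiable (by simp)
  set η : ℝ → ℝ := fun x => φ (0, x) with hη
  have hηs : ContDiff ℝ ∞ η := hφ.comp (contDiff_const.prodMk contDiff_id)
  have hηc : HasCompactSupport η := by
    refine HasCompactSupport.of_support_subset_isCompact (hφc.isCompact.image continuous_snd) ?_
    exact fun x hx => ⟨(0, x), subset_tsupport _ hx, rfl⟩
  have hηd : ∀ x, deriv η x = fderiv ℝ φ (0, x) (0, 1) := fun x =>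
    ((hφd (0, x)).hasFDerivAt.comp_hasDerivAt x
      ((hasDerivAt_const x (0 : ℝ)).prodMk (hasDerivAt_id x))).deriv
  have hzero : ∀ x e, x ∉ Ioo 0 ℓ₀ → fderiv ℝ φ (0, x) e = 0 := fun x e hx => by
    rw [fderiv_of_notMem_tsupport ℝ fun hx' => hx (hφ0 x hx')]; rfl
  have hV := integral_primitive_mul_deriv hv₁ hηs hηc
  have hsec : Continuous fun x : ℝ => ((0, x) : ℝ × ℝ) := by fun_prop
  have hcsec : ∀ e, HasCompactSupport fun x => fderiv ℝ φ (0, x) e := fun e => by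
    refine HasCompactSupport.of_support_subset_isCompact (hφc.isCompact.image continuous_snd) ?_
    refine fun x hx => ⟨(0, x), ?_, rfl⟩
    by_contra hx'
    exact hx (by simp [fderiv_of_notMem_tsupport ℝ hx'])
  have hdc : ∀ e, Continuous fun x => fderiv ℝ φ (0, x) e := fun e =>
    (contDiff_fderiv_apply hφ e).continuous.comp hsec
  have i1 : ∀ e, Integrable fun x =>
      (profileRight ℓ₀ z v₀ v₁ (-x) - κ * quadrantInt F (-x) (-x)) * fderiv ℝ φ (0, x) e :=
    fun e => ((hf.comp continuous_neg).mul (hdc e)).integrable_of_hasCompactSupport (hcsec e).mul_left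
  have i2 : ∀ e, Integrable fun x =>
      (profileLeft ℓ₀ ℓ z v₀ v₁ x - κ * quadrantInt F (omegaExt ℓ₀ ℓ x) x) * fderiv ℝ φ (0, x) e :=
    fun e => (hg.mul (hdc e)).integrable_of_hasCompactSupport (hcsec e).mul_left
  have i3 : Integrable fun x => clampIcc ℓ₀ v₀ x * fderiv ℝ φ (0, x) (1, 0) :=
    ((continuous_clampIcc hℓ₀ hv₀).mul (hdc _)).integrable_of_hasCompactSupport (hcsec _).mul_left
  have i4 : Integrable fun x => primitive ℓ₀ v₁ x * fderiv ℝ φ (0, x) (0, 1) :=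
    ((continuous_primitive hv₁).mul (hdc _)).integrable_of_hasCompactSupport (hcsec _).mul_left
  -- With f taken at -x and g at x, f(φ_t - φ_x) + g(φ_t + φ_x) = (f + g)φ_t + (g - f)φ_x. On the
  -- initial line f + g = v₀, g - f is the primitive of v₁, and the quadrant terms vanish.
  have h5 : (∫ x, (profileRight ℓ₀ z v₀ v₁ (-x) - κ * quadrantInt F (-x) (-x))
        * fderiv ℝ φ (0, x) (1, -1))
      + ∫ x, (profileLeft ℓ₀ ℓ z v₀ v₁ x - κ * quadrantInt F (omegaExt ℓ₀ ℓ x) x)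
        * fderiv ℝ φ (0, x) (1, 1)
      = (∫ x, clampIcc ℓ₀ v₀ x * fderiv ℝ φ (0, x) (1, 0))
        + ∫ x, primitive ℓ₀ v₁ x * fderiv ℝ φ (0, x) (0, 1) := by
    rw [← integral_add (i1 _) (i2 _), ← integral_add i3 i4]
    refine integral_congr_ae (Eventually.of_forall fun x => ?_)
    by_cases hx : x ∈ Ioo 0 ℓ₀
    · have e3 : ((1, -1) : ℝ × ℝ) = (1, 0) - (0, 1) := by ext <;> simp
      have e4 : ((1, 1) : ℝ × ℝ) = (1, 0) + (0, 1) := by ext <;> simp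
      simp only [e3, e4, map_sub, map_add]
      rw [omegaExt_of_le hx.2.le, hFd,
        quadrantInt_extendZero_of_add_nonpos (a := -x) (b := x) (by linarith),
        quadrantInt_extendZero_of_nonpos (b := -x) (by linarith [hx.1]),
        profileRight, if_pos (by linarith [hx.1]), profileLeft, if_pos hx.2.le, neg_neg]
      ring
    · simp [hzero x _ hx]
  have h6 : ∫ x, clampIcc ℓ₀ v₀ x * fderiv ℝ φ (0, x) (1, 0)
      = ∫ x in Ioo 0 ℓ₀, v₀ x * fderiv ℝ φ (0, x) (1, 0) := by
    rw [← setIntegral_eq_integral_of_forall_compl_eq_zero (s := Ioo 0 ℓ₀)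
      fun x hx => by rw [hzero x _ hx, mul_zero]]
    exact setIntegral_congr_fun measurableSet_Ioo fun x hx => by
      simp only [clampIcc_of_mem (v₀ := v₀) ⟨hx.1.le, hx.2.le⟩]
  simp only [hηd] at hV
  rw [sub_sub, h5, h6, hV]
  ring

end Representation

/-! ### Essential limits, slices along curves, and attainment of data. -/

section Traces

theorem essZeroPlus_le : essZeroPlus ≤ 𝓝[>] (0 : ℝ) := inf_le_left

theorem eventually_essZeroPlus {p : ℝ → Prop} {q : ℝ → Prop} (hp : ∀ᶠ h in 𝓝[>] (0 : ℝ), p h)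
    (hq : ∀ᵐ h : ℝ, q h) : ∀ᶠ h in essZeroPlus, p h ∧ q h :=
  (hp.filter_mono inf_le_left).and (hq.filter_mono inf_le_right)

/-- A set of full measure meets every interval (0, ε). Bounds holding along this filter can
therefore be passed to the limit. -/
instance : NeBot essZeroPlus := by
  rw [essZeroPlus, inf_neBot_iff]
  intro s hs t ht
  by_contra hcon
  rw [not_nonempty_iff_eq_empty] at hcon
  obtain ⟨ε, hε, hs'⟩ := mem_nhdsGT_iff_exists_Ioo_subset.1 hs
  have h1 : volume (Ioo 0 ε) ≤ volume tᶜ := measure_mono fun x hx hxt => by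
    have : x ∈ s ∩ t := ⟨hs' hx, hxt⟩
    rw [hcon] at this; exact this
  rw [mem_ae_iff.1 ht, Real.volume_Ioo] at h1
  simp only [sub_zero, nonpos_iff_eq_zero, ENNReal.ofReal_eq_zero] at h1
  exact absurd hε (not_lt.2 h1)

/-- For each t, h ↦ γ(t) + s h is an isometry of the line, so this is a measure preserving skew
product composed with the swap. Hence a null set of the plane meets almost every displaced curve in
a null set of parameters, and slices of almost everywhere equal functions agree for almost every
displacement. -/
theorem quasiMeasurePreserving_shear {γ : ℝ → ℝ} (hγ : Continuous γ) {s : ℝ}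
    (hs : s = 1 ∨ s = -1) :
    Measure.QuasiMeasurePreserving (fun q : ℝ × ℝ => (q.2, γ q.2 + s * q.1)) volume volume := by
  have h1 : MeasurePreserving (fun q : ℝ × ℝ => (q.1, γ q.1 + s * q.2)) (volume.prod volume)
      (volume.prod volume) := by
    refine (MeasurePreserving.id volume).skew_product (g := fun t h => γ t + s * h)
      (by fun_prop) (Eventually.of_forall fun t => ?_)
    rcases hs with rfl | rfl
    · simpa using (measurePreserving_add_left volume (γ t)).map_eq
    · have := ((measurePreserving_add_left volume (γ t)).comp
        (Measure.measurePreserving_neg (volume : Measure ℝ))).map_eq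
      simpa [Function.comp_def] using this
  have h2 := h1.comp (Measure.measurePreserving_swap (μ := (volume : Measure ℝ))
    (ν := (volume : Measure ℝ)))
  exact h2.quasiMeasurePreserving

theorem ae_shear {γ : ℝ → ℝ} (hγ : Continuous γ) {s : ℝ} (hs : s = 1 ∨ s = -1)
    {P : ℝ × ℝ → Prop} (hP : ∀ᵐ p, P p) : ∀ᵐ h : ℝ, ∀ᵐ t : ℝ, P (t, γ t + s * h) :=
  Measure.ae_ae_of_ae_prod ((quasiMeasurePreserving_shear hγ hs).ae hP)

theorem tendsto_eLpNorm_of_continuous {u : ℝ × ℝ → ℝ} (hu : Continuous u) {K K' : Set ℝ}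
    (hK : IsCompact K) (hK' : K' ⊆ K) (hm : MeasurableSet K') {g : ℝ → ℝ}
    (hg : ∀ t ∈ K', u (0, t) = g t) :
    Tendsto (fun h : ℝ => eLpNorm (fun t => u (h, t) - g t) 2 (volume.restrict K'))
      (𝓝 0) (𝓝 0) := by
  have hfin : volume K' ≠ ⊤ := ((measure_mono hK').trans_lt hK.measure_lt_top).ne
  rw [ENNReal.tendsto_nhds_zero]
  intro ε hε
  obtain ⟨c, hc0, hc⟩ : ∃ c : ℝ, 0 < c ∧
      volume K' ^ (2 : ℝ≥0∞).toReal⁻¹ * ENNReal.ofReal c ≤ ε := by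
    have h1 : Tendsto (fun c : ℝ => volume K' ^ (2 : ℝ≥0∞).toReal⁻¹ * ENNReal.ofReal c) (𝓝[>] 0)
        (𝓝 0) := by
      have h2 : Tendsto (fun c : ℝ => ENNReal.ofReal c) (𝓝[>] 0) (𝓝 0) := by
        have := (ENNReal.continuous_ofReal.tendsto 0).mono_left
          (nhdsWithin_le_nhds (s := Ioi (0 : ℝ)))
        simpa using this
      have h3 := ENNReal.Tendsto.const_mul (a := volume K' ^ (2 : ℝ≥0∞).toReal⁻¹) h2
        (Or.inr (ENNReal.rpow_ne_top_of_nonneg (by positivity) hfin))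
      simpa using h3
    have h4 := ((ENNReal.tendsto_nhds_zero.1 h1 ε hε).and self_mem_nhdsWithin).exists
    obtain ⟨c, hc, hc0⟩ := h4
    exact ⟨c, hc0, hc⟩
  have h5 : ∀ᶠ h : ℝ in 𝓝 0, ∀ t ∈ K, ‖u (h, t) - u (0, t)‖ < c := by
    refine hK.eventually_forall_of_forall_eventually fun t _ => ?_
    have : Continuous fun z : ℝ × ℝ => ‖u (z.1, z.2) - u (0, z.2)‖ := by fun_prop
    exact this.continuousAt.eventually_lt continuousAt_const (by simpa using hc0)
  filter_upwards [h5] with h hh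
  refine (eLpNorm_le_of_ae_bound (C := c) ?_).trans ?_
  · filter_upwards [ae_restrict_mem hm] with t ht
    rw [← hg t ht]
    exact (hh t (hK' ht)).le
  · simpa [Measure.restrict_apply_univ] using hc

variable {ℓ₀ : ℝ} {ℓ : ℝ → ℝ} {u v : ℝ × ℝ → ℝ} {γ γ' g : ℝ → ℝ} {s : ℝ} {I : Set ℝ}

/-- Slices of u converge uniformly on compact sets, and those of v coincide with them for almost
every small h. The curve γ is usable only on I, so γ' serves as a globally continuous substitute,
e.g. ℓ(max 0 t) for ℓ. -/
theorem HasTrace.of_continuous_of_ae_eq (hu : Continuous u) (hγ : Continuous γ') (hI : EqOn γ γ' I)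
    (hs : s = 1 ∨ s = -1) (hg : ∀ t ∈ I, u (t, γ t) = g t) {U : Set (ℝ × ℝ)}
    (huv : ∀ᵐ p, p ∈ U → v p = u p)
    (hU : ∀ K, IsCompact K → K ⊆ I → ∀ᶠ h in 𝓝[>] (0 : ℝ), ∀ t ∈ K, (t, γ t + s * h) ∈ U) :
    HasTrace s γ I v g := by
  intro K hK hKI
  have h1 := (tendsto_eLpNorm_of_continuous (u := fun z => u (z.2, γ' z.2 + s * z.1)) (g := g)
    (by fun_prop) hK subset_rfl hK.measurableSet (fun t ht => by
      simp [← hI (hKI ht), hg t (hKI ht)])).mono_left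
    (essZeroPlus_le.trans nhdsWithin_le_nhds)
  refine h1.congr' ?_
  filter_upwards [eventually_essZeroPlus (hU K hK hKI) (ae_shear hγ hs huv)] with h hh
  refine eLpNorm_congr_ae ?_
  filter_upwards [ae_restrict_of_ae hh.2, ae_restrict_mem hK.measurableSet] with t ht htK
  have h2 := hh.1 t htK
  rw [hI (hKI htK)] at h2 ⊢
  simp only [ht h2]

theorem HasTrace.sub_continuous (hv : HasTrace s γ I v g) (hu : Continuous u) (hγ : Continuous γ')
    (hI : EqOn γ γ' I) (hs : s = 1 ∨ s = -1) (hg : ∀ t ∈ I, u (t, γ t) = g t)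
    {U : Set (ℝ × ℝ)} (hUm : MeasurableSet U) (hvm : AEStronglyMeasurable v (volume.restrict U))
    (hU : ∀ K, IsCompact K → K ⊆ I → ∀ᶠ h in 𝓝[>] (0 : ℝ), ∀ t ∈ K, (t, γ t + s * h) ∈ U) :
    HasTrace s γ I (fun p => v p - u p) (fun _ => 0) := by
  intro K hK hKI
  have h1 := (tendsto_eLpNorm_of_continuous (u := fun z => u (z.2, γ' z.2 + s * z.1)) (g := g)
    (by fun_prop) hK subset_rfl hK.measurableSet (fun t ht => by
      simp [← hI (hKI ht), hg t (hKI ht)])).mono_left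
    (essZeroPlus_le.trans nhdsWithin_le_nhds)
  have h2 := hv K hK hKI
  have h3 := h2.add h1
  rw [add_zero] at h3
  refine tendsto_of_tendsto_of_tendsto_of_le_of_le' tendsto_const_nhds h3
    (Eventually.of_forall fun _ => zero_le) ?_
  -- The triangle inequality for `eLpNorm` needs measurable slices. Since v is measurable on U only,
  -- its extension by zero is sliced, and for small h the slice over K stays in U.
  have hmeas : ∀ᵐ h : ℝ, AEStronglyMeasurable
      (fun t => U.indicator v (t, γ' t + s * h)) volume := by
    have h4 : AEStronglyMeasurable (U.indicator v) volume :=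
      (aestronglyMeasurable_indicator_iff hUm).2 hvm
    have h5 := h4.comp_quasiMeasurePreserving (quasiMeasurePreserving_shear hγ hs)
    exact AEStronglyMeasurable.prodMk_left (ν := (volume : Measure ℝ)) h5
  filter_upwards [eventually_essZeroPlus (hU K hK hKI) hmeas] with h hh
  have hgK : AEStronglyMeasurable g (volume.restrict K) := by
    have : AEStronglyMeasurable (fun t => u (t, γ' t)) (volume.restrict K) :=
      (show Continuous fun t => u (t, γ' t) by fun_prop).aestronglyMeasurable
    refine this.congr ?_
    filter_upwards [ae_restrict_mem hK.measurableSet] with t ht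
    rw [← hI (hKI ht), hg t (hKI ht)]
  have hvK : AEStronglyMeasurable (fun t => v (t, γ t + s * h)) (volume.restrict K) := by
    refine (hh.2.mono_measure Measure.restrict_le_self).congr ?_
    filter_upwards [ae_restrict_mem hK.measurableSet] with t ht
    have h6 := hh.1 t ht
    rw [hI (hKI ht)] at h6 ⊢
    exact indicator_of_mem h6 v
  have huK : AEStronglyMeasurable (fun t => u (t, γ' t + s * h)) (volume.restrict K) :=
    (show Continuous fun t => u (t, γ' t + s * h) by fun_prop).aestronglyMeasurable
  refine le_trans (le_of_eq ?_) (eLpNorm_sub_le (hvK.sub hgK) (huK.sub hgK) one_le_two)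
  refine eLpNorm_congr_ae ?_
  filter_upwards [ae_restrict_mem hK.measurableSet] with t ht
  simp [hI (hKI ht)]

theorem IsFront.continuous_comp_max (h : IsFront ℓ₀ ℓ) : Continuous fun t => ℓ (max 0 t) :=
  h.continuousOn.comp_continuous (by fun_prop) fun t => mem_Ici.2 (le_max_left 0 t)

theorem IsFront.eventually_left_mem (h : IsFront ℓ₀ ℓ) {K : Set ℝ} (hK : IsCompact K)
    (hKI : K ⊆ Ioo 0 ℓ₀) :
    ∀ᶠ y in 𝓝[>] (0 : ℝ), ∀ t ∈ K, (t, (0 : ℝ) + 1 * y) ∈ punctured ℓ₀ ℓ := by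
  have h1 : ∀ᶠ y : ℝ in 𝓝 0, ∀ t ∈ K, hitTime ℓ₀ ℓ (t + y) < t ∧ t + y < ℓ₀ := by
    refine hK.eventually_forall_of_forall_eventually fun t ht => ?_
    have hc := h.continuous_hitTime
    have c1 : Continuous fun z : ℝ × ℝ => hitTime ℓ₀ ℓ (z.2 + z.1) :=
      hc.comp (continuous_snd.add continuous_fst)
    have c2 : Continuous fun z : ℝ × ℝ => z.2 + z.1 := continuous_snd.add continuous_fst
    refine (c1.continuousAt.eventually_lt continuous_snd.continuousAt ?_).and
      (c2.continuousAt.eventually_lt continuousAt_const ?_)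
    · simp [hitTime_of_le (hKI ht).2.le, (hKI ht).1]
    · simp [(hKI ht).2]
  filter_upwards [h1.filter_mono nhdsWithin_le_nhds, self_mem_nhdsWithin] with y hy hy0 t ht
  have hy0 : 0 < y := hy0
  simp only [zero_add, one_mul]
  exact ⟨hy0, (hy t ht).1, Or.inr (hy t ht).2⟩

theorem IsFront.eventually_front_mem (h : IsFront ℓ₀ ℓ) (hℓ₀ : 0 < ℓ₀) {K : Set ℝ}
    (hK : IsCompact K) (hKI : K ⊆ {t | 0 < t ∧ t < ℓ t}) :
    ∀ᶠ y in 𝓝[>] (0 : ℝ), ∀ t ∈ K, (t, ℓ t + -1 * y) ∈ punctured ℓ₀ ℓ := by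
  have h1 : ∀ᶠ y : ℝ in 𝓝 0, ∀ t ∈ K, y < ℓ (max 0 t) ∧ t + y < ℓ (max 0 t) := by
    refine hK.eventually_forall_of_forall_eventually fun t ht => ?_
    have c1 : Continuous fun z : ℝ × ℝ => ℓ (max 0 z.2) := h.continuous_comp_max.comp continuous_snd
    have c2 : Continuous fun z : ℝ × ℝ => z.2 + z.1 := continuous_snd.add continuous_fst
    have h3 := hKI ht
    have h2 := h.le h3.1.le
    refine (continuous_fst.continuousAt.eventually_lt c1.continuousAt ?_).and
      (c2.continuousAt.eventually_lt c1.continuousAt ?_)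
    · simp only [max_eq_right h3.1.le]; linarith
    · simp only [max_eq_right h3.1.le, add_zero]; exact h3.2
  filter_upwards [h1.filter_mono nhdsWithin_le_nhds, self_mem_nhdsWithin] with y hy hy0 t ht
  have hy0 : 0 < y := hy0
  have h3 := hKI ht
  have h4 := hy t ht
  rw [max_eq_right h3.1.le] at h4
  refine ⟨by simp only; linarith, ?_, Or.inl (by simp only; linarith)⟩
  exact (h.hitTime_lt_iff h3.1).2 (by simp only [psi]; linarith)

/-- Here x < ℓ₀ ≤ ℓ(t), and if x ≤ t then t + x ≤ 2t < ℓ₀. The width ℓ₀/2 keeps the strip below the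
excluded point. -/
theorem IsFront.strip_subset (h : IsFront ℓ₀ ℓ) :
    Ioo 0 (ℓ₀ / 2) ×ˢ Ioo 0 ℓ₀ ⊆ punctured ℓ₀ ℓ := by
  rintro ⟨t, x⟩ ⟨ht, hx⟩
  simp only at ht hx
  have h1 := h.le ht.1.le
  refine ⟨hx.1, (h.hitTime_lt_iff ht.1).2 (by simp only [psi]; linarith [hx.2]), ?_⟩
  rcases lt_or_ge t x with h2 | h2
  · exact Or.inl h2
  · exact Or.inr (by simp only; linarith [ht.2])

theorem tendsto_initial_position (h : IsFront ℓ₀ ℓ) (hℓ₀ : 0 < ℓ₀) (hu : Continuous u)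
    (hg : ∀ x ∈ Ioo 0 ℓ₀, u (0, x) = g x) (huv : ∀ᵐ p, p ∈ punctured ℓ₀ ℓ → v p = u p) :
    Tendsto (fun t : ℝ => eLpNorm (fun x => v (t, x) - g x) 2 (volume.restrict (Ioo 0 ℓ₀)))
      essZeroPlus (𝓝 0) := by
  have h1 := (tendsto_eLpNorm_of_continuous hu isCompact_Icc Ioo_subset_Icc_self measurableSet_Ioo
    hg).mono_left (essZeroPlus_le.trans nhdsWithin_le_nhds)
  refine h1.congr' ?_
  have h2 : ∀ᵐ t : ℝ, ∀ᵐ x : ℝ, (t, x) ∈ punctured ℓ₀ ℓ → v (t, x) = u (t, x) :=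
    Measure.ae_ae_of_ae_prod huv
  filter_upwards [eventually_essZeroPlus (Ioo_mem_nhdsGT (half_pos hℓ₀)) h2] with t ht
  refine eLpNorm_congr_ae ?_
  filter_upwards [ae_restrict_of_ae ht.2, ae_restrict_mem measurableSet_Ioo] with x hx hx'
  rw [hx (h.strip_subset ⟨ht.1, hx'⟩)]

end Traces

/-! ### Product test functions and weak derivatives on time slices. -/

section Velocity

open scoped ContDiff

/-- The function `(t, x) ↦ ϑ(t) η(x)`. -/
def prodFun (ϑ η : ℝ → ℝ) (p : ℝ × ℝ) : ℝ := ϑ p.1 * η p.2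

variable {ϑ η : ℝ → ℝ}

theorem contDiff_prodFun (hϑ : ContDiff ℝ ∞ ϑ) (hη : ContDiff ℝ ∞ η) :
    ContDiff ℝ ∞ (prodFun ϑ η) :=
  (hϑ.comp contDiff_fst).mul (hη.comp contDiff_snd)

theorem support_prodFun_subset :
    Function.support (prodFun ϑ η) ⊆ tsupport ϑ ×ˢ tsupport η := fun _ hp =>
  ⟨subset_tsupport _ (left_ne_zero_of_mul hp), subset_tsupport _ (right_ne_zero_of_mul hp)⟩

theorem hasCompactSupport_prodFun (hϑ : HasCompactSupport ϑ) (hη : HasCompactSupport η) :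
    HasCompactSupport (prodFun ϑ η) :=
  HasCompactSupport.of_support_subset_isCompact (hϑ.isCompact.prod hη.isCompact)
    support_prodFun_subset

theorem tsupport_prodFun_subset : tsupport (prodFun ϑ η) ⊆ tsupport ϑ ×ˢ tsupport η :=
  closure_minimal support_prodFun_subset ((isClosed_tsupport _).prod (isClosed_tsupport _))

theorem fderiv_prodFun (hϑ : ContDiff ℝ ∞ ϑ) (hη : ContDiff ℝ ∞ η) (p e : ℝ × ℝ) :
    fderiv ℝ (prodFun ϑ η) p e = prodFun (deriv ϑ) η p * e.1 + prodFun ϑ (deriv η) p * e.2 := by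
  have h1 : HasFDerivAt (fun q : ℝ × ℝ => ϑ q.1) _ p :=
    ((hϑ.differentiable (by simp) p.1).hasDerivAt).hasFDerivAt.comp p hasFDerivAt_fst
  have h2 : HasFDerivAt (fun q : ℝ × ℝ => η q.2) _ p :=
    ((hη.differentiable (by simp) p.2).hasDerivAt).hasFDerivAt.comp p hasFDerivAt_snd
  have h3 : HasFDerivAt (prodFun ϑ η) _ p := h1.mul h2
  rw [h3.fderiv]
  simp [prodFun]
  ring

theorem fderiv_prodFun_fst (hϑ : ContDiff ℝ ∞ ϑ) (hη : ContDiff ℝ ∞ η) (p : ℝ × ℝ) :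
    fderiv ℝ (prodFun ϑ η) p (1, 0) = prodFun (deriv ϑ) η p := by
  simp [fderiv_prodFun hϑ hη]

theorem fderiv_prodFun_snd (hϑ : ContDiff ℝ ∞ ϑ) (hη : ContDiff ℝ ∞ η) (p : ℝ × ℝ) :
    fderiv ℝ (prodFun ϑ η) p (0, 1) = prodFun ϑ (deriv η) p := by
  simp [fderiv_prodFun hϑ hη]

theorem contDiff_deriv_top (hη : ContDiff ℝ ∞ η) : ContDiff ℝ ∞ (deriv η) :=
  (contDiff_infty_iff_deriv.1 hη).2

theorem box_prodFun (hϑ : ContDiff ℝ ∞ ϑ) (hη : ContDiff ℝ ∞ η) (p : ℝ × ℝ) :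
    box (prodFun ϑ η) p
      = prodFun (deriv (deriv ϑ)) η p - prodFun ϑ (deriv (deriv η)) p := by
  simp only [box, fderiv_prodFun_fst hϑ hη, fderiv_prodFun_snd hϑ hη]
  have h1 := fderiv_prodFun_fst (contDiff_deriv_top hϑ) hη p
  have h2 := fderiv_prodFun_snd hϑ (contDiff_deriv_top hη) p
  rw [← h1, ← h2]

section WeakDeriv

variable {E : Type*} [NormedAddCommGroup E] [NormedSpace ℝ E] [MeasureSpace E] {U : Opens E}

theorem HasWeakDeriv.integral_eq {e : E} {f g : E → ℝ} (h : HasWeakDeriv U e f g) {φ : E → ℝ}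
    (hφ : ContDiff ℝ ∞ φ) (hc : HasCompactSupport φ) (hU : tsupport φ ⊆ U) :
    ∫ x in (U : Set E), f x * fderiv ℝ φ x e = -∫ x in (U : Set E), g x * φ x :=
  h.2.2 ⟨φ, hφ, hc, hU⟩

end WeakDeriv

theorem SolvesWaveEq.integral_eq {U : Opens (ℝ × ℝ)} {ν : ℝ} {v : ℝ × ℝ → ℝ}
    (h : SolvesWaveEq U ν v) {φ : ℝ × ℝ → ℝ} (hφ : ContDiff ℝ ∞ φ) (hc : HasCompactSupport φ)
    (hU : tsupport φ ⊆ U) :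
    ∫ p in (U : Set (ℝ × ℝ)), v p * (box φ p - ν ^ 2 / 4 * φ p) = 0 :=
  h ⟨φ, hφ, hc, hU⟩

theorem tsupport_box_subset {φ : ℝ × ℝ → ℝ} : tsupport (box φ) ⊆ tsupport φ :=
  (tsupport_sub _ _).trans (union_subset
    ((tsupport_fderiv_apply_subset ℝ _).trans (tsupport_fderiv_apply_subset ℝ _))
    ((tsupport_fderiv_apply_subset ℝ _).trans (tsupport_fderiv_apply_subset ℝ _)))

variable {ℓ₀ : ℝ} {ℓ z v₀ v₁ : ℝ → ℝ} {u v : ℝ × ℝ → ℝ} {k : ℝ}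

theorem IsFront.strip_subset_Omega'T (h : IsFront ℓ₀ ℓ) (hℓ₀ : 0 < ℓ₀) :
    Ioo 0 (ℓ₀ / 2) ×ˢ Ioo 0 ℓ₀ ⊆ Omega'T ℓ₀ ℓ ℓ₀ := fun p hp =>
  ⟨(h.mem_Omega'_iff hℓ₀).2 (Or.inl (h.strip_subset hp)), by
    have h1 := hp.1.2; change p.1 < ℓ₀; linarith⟩

section Strip

variable {δ : ℝ} {f : ℝ × ℝ → ℝ}

theorem integrableOn_strip_mul (hf : IntegrableOn f (Ioo 0 δ ×ˢ Ioo 0 ℓ₀)) {g : ℝ × ℝ → ℝ}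
    (hg : Continuous g) (hc : HasCompactSupport g) :
    IntegrableOn (fun p => f p * g p) (Ioo 0 δ ×ˢ Ioo 0 ℓ₀) := by
  obtain ⟨C, hC⟩ := hg.bounded_above_of_compact_support hc
  exact Integrable.mul_bdd hf hg.aestronglyMeasurable (Eventually.of_forall hC)

theorem integrableOn_strip_slice (hf : IntegrableOn f (Ioo 0 δ ×ˢ Ioo 0 ℓ₀)) (hη : Continuous η)
    (hc : HasCompactSupport η) :
    IntegrableOn (fun t => ∫ x in Ioo 0 ℓ₀, f (t, x) * η x) (Ioo 0 δ) := by
  obtain ⟨C, hC⟩ := hη.bounded_above_of_compact_support hc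
  have h1 : IntegrableOn (fun p : ℝ × ℝ => f p * η p.2) (Ioo 0 δ ×ˢ Ioo 0 ℓ₀) :=
    Integrable.mul_bdd hf (hη.comp continuous_snd).aestronglyMeasurable
      (Eventually.of_forall fun p => hC p.2)
  rw [IntegrableOn, Measure.volume_eq_prod, ← Measure.prod_restrict] at h1
  exact h1.integral_prod_left

theorem integral_strip_prodFun (hf : IntegrableOn f (Ioo 0 δ ×ˢ Ioo 0 ℓ₀)) (hϑ : Continuous ϑ)
    (hϑc : HasCompactSupport ϑ) (hη : Continuous η) (hc : HasCompactSupport η) :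
    ∫ p in Ioo 0 δ ×ˢ Ioo 0 ℓ₀, f p * prodFun ϑ η p
      = ∫ t in Ioo 0 δ, ϑ t * ∫ x in Ioo 0 ℓ₀, f (t, x) * η x := by
  have h1 := integrableOn_strip_mul hf (g := prodFun ϑ η)
    ((hϑ.comp continuous_fst).mul (hη.comp continuous_snd)) (hasCompactSupport_prodFun hϑc hc)
  rw [Measure.volume_eq_prod] at h1 ⊢
  rw [setIntegral_prod _ h1]
  refine integral_congr_ae (Eventually.of_forall fun t => ?_)
  simp only [← integral_const_mul]
  refine integral_congr_ae (Eventually.of_forall fun x => ?_)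
  simp only [prodFun]; ring

end Strip

theorem setIntegral_punctured_eq_strip (h : IsFront ℓ₀ ℓ) {G : ℝ × ℝ → ℝ}
    (hG : ∀ p, 0 < p.1 → p ∉ Ioo 0 (ℓ₀ / 2) ×ˢ Ioo 0 ℓ₀ → G p = 0) :
    ∫ p in punctured ℓ₀ ℓ, G p = ∫ p in Ioo 0 (ℓ₀ / 2) ×ˢ Ioo 0 ℓ₀, G p := by
  refine setIntegral_eq_of_subset_of_forall_sdiff_eq_zero h.isOpen_punctured.measurableSet
    h.strip_subset fun p hp => hG p ((h.hitTime_nonneg _).trans_lt hp.1.2.1) hp.2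

/-- Testing the weak derivative with ϑ(t)η(x) and varying ϑ gives the slice identity by the
fundamental lemma of the calculus of variations. The exceptional set of times depends on η. -/
theorem ae_slice_weakDeriv_snd (h : IsFront ℓ₀ ℓ) (hℓ₀ : 0 < ℓ₀) {vx : ℝ × ℝ → ℝ}
    (hd : HasWeakDeriv (openOmega' ℓ₀ ℓ) (0, 1) v vx)
    (hv : IntegrableOn v (Ioo 0 (ℓ₀ / 2) ×ˢ Ioo 0 ℓ₀))
    (hvx : IntegrableOn vx (Ioo 0 (ℓ₀ / 2) ×ˢ Ioo 0 ℓ₀))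
    (hη : ContDiff ℝ ∞ η) (hc : HasCompactSupport η) (hη0 : tsupport η ⊆ Ioo 0 ℓ₀) :
    ∀ᵐ t : ℝ, t ∈ Ioo 0 (ℓ₀ / 2) →
      (∫ x in Ioo 0 ℓ₀, v (t, x) * deriv η x) + ∫ x in Ioo 0 ℓ₀, vx (t, x) * η x = 0 := by
  have hdη : Continuous (deriv η) := (contDiff_deriv_top hη).continuous
  have i1 := integrableOn_strip_slice hv hdη hc.deriv
  have i2 := integrableOn_strip_slice hvx hη.continuous hc
  refine isOpen_Ioo.ae_eq_zero_of_integral_contDiff_smul_eq_zero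
    (i1.add i2).locallyIntegrableOn fun ϑ hϑ hϑc hϑ0 => ?_
  have hsupp : tsupport (prodFun ϑ η) ⊆ Ioo 0 (ℓ₀ / 2) ×ˢ Ioo 0 ℓ₀ :=
    tsupport_prodFun_subset.trans (prod_mono hϑ0 hη0)
  have h1 := hd.integral_eq (contDiff_prodFun hϑ hη) (hasCompactSupport_prodFun hϑc hc)
    (by rw [h.coe_openOmega' hℓ₀]; exact hsupp.trans h.strip_subset)
  simp only [fderiv_prodFun_snd hϑ hη, h.coe_openOmega' hℓ₀] at h1
  rw [setIntegral_punctured_eq_strip h, setIntegral_punctured_eq_strip h,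
    integral_strip_prodFun hv hϑ.continuous hϑc hdη hc.deriv,
    integral_strip_prodFun hvx hϑ.continuous hϑc hη.continuous hc] at h1
  · obtain ⟨C, hC⟩ := hϑ.continuous.bounded_above_of_compact_support hϑc
    have j1 : IntegrableOn (fun t => ϑ t * ∫ x in Ioo 0 ℓ₀, v (t, x) * deriv η x)
        (Ioo 0 (ℓ₀ / 2)) :=
      Integrable.bdd_mul i1 hϑ.continuous.aestronglyMeasurable (Eventually.of_forall hC)
    have j2 : IntegrableOn (fun t => ϑ t * ∫ x in Ioo 0 ℓ₀, vx (t, x) * η x)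
        (Ioo 0 (ℓ₀ / 2)) :=
      Integrable.bdd_mul i2 hϑ.continuous.aestronglyMeasurable (Eventually.of_forall hC)
    rw [← setIntegral_eq_integral_of_forall_compl_eq_zero (s := Ioo 0 (ℓ₀ / 2)) fun t ht => by
      rw [image_eq_zero_of_notMem_tsupport fun ht' => ht (hϑ0 ht'), zero_smul]]
    simp only [smul_eq_mul, mul_add]
    rw [integral_add j1 j2, h1, neg_add_cancel]
  · intro p _ hp
    rw [image_eq_zero_of_notMem_tsupport fun hp' => hp (hsupp hp'), mul_zero]
  · intro p _ hp
    have : prodFun ϑ (deriv η) p = 0 := by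
      by_contra hne
      exact hp (prod_mono hϑ0 (tsupport_deriv_subset.trans hη0) (support_prodFun_subset hne))
    rw [this, mul_zero]

/-- A smooth compactly supported primitive of `ρ - (∫ ρ) ρ₀`, with `ρ₀` a bump on the left of the
origin. -/
theorem exists_primitive_test {δ : ℝ} (hδ : 0 < δ) {ρ : ℝ → ℝ} (hρ : ContDiff ℝ ∞ ρ)
    (hc : HasCompactSupport ρ) (hρ0 : tsupport ρ ⊆ Ioo 0 δ) :
    ∃ θ : ℝ → ℝ, ContDiff ℝ ∞ θ ∧ HasCompactSupport θ ∧ tsupport θ ⊆ Iio δ ∧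
      (∀ t, -1 / 2 ≤ t → deriv θ t = ρ t) ∧ θ 0 = -∫ t, ρ t := by
  -- The bump lives in (-3/2, -1/2), before the initial time: it corrects the mean to zero, so that
  -- the primitive has compact support, without changing the derivative for t ≥ -1/2.
  let b : ContDiffBump (-1 : ℝ) := ⟨1 / 4, 1 / 2, by norm_num, by norm_num⟩
  set ρ₀ : ℝ → ℝ := b.normed volume with hρ₀
  set c := ∫ t, ρ t with hcdef
  have hb : ContDiff ℝ ∞ ρ₀ := b.contDiff_normed
  have hbc : HasCompactSupport ρ₀ := b.hasCompactSupport_normed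
  have hbs : ∀ t, -1 / 2 ≤ t → ρ₀ t = 0 := fun t ht => by
    have : t ∉ Function.support ρ₀ := by
      rw [hρ₀, b.support_normed_eq, Real.ball_eq_Ioo]
      exact fun h => absurd h.2 (not_lt.2 (by norm_num [b]; linarith))
    simpa using this
  have hbs' : ∀ t, t ≤ -3 / 2 → ρ₀ t = 0 := fun t ht => by
    have : t ∉ Function.support ρ₀ := by
      rw [hρ₀, b.support_normed_eq, Real.ball_eq_Ioo]
      exact fun h => absurd h.1 (not_lt.2 (by norm_num [b]; linarith))
    simpa using this
  have hρn : ∀ t, t ≤ 0 → ρ t = 0 := fun t ht =>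
    image_eq_zero_of_notMem_tsupport fun h => absurd (hρ0 h).1 (not_lt.2 ht)
  set r : ℝ → ℝ := fun t => ρ t - c * ρ₀ t with hr
  have hrs : ContDiff ℝ ∞ r := hρ.sub (contDiff_const.mul hb)
  have hrc : HasCompactSupport r := hc.sub hbc.mul_left
  have hri : Integrable r := hrs.continuous.integrable_of_hasCompactSupport hrc
  have hρi : Integrable ρ := hρ.continuous.integrable_of_hasCompactSupport hc
  have hbi : Integrable ρ₀ := hb.continuous.integrable_of_hasCompactSupport hbc
  have hr0 : ∫ t, r t = 0 := by
    simp only [hr]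
    rw [integral_sub hρi (hbi.const_mul c), integral_const_mul, hρ₀, b.integral_normed]
    ring
  set θ : ℝ → ℝ := fun t => ∫ s in (-3 / 2 : ℝ)..t, r s with hθ
  have hθd : ∀ t, HasDerivAt θ (r t) t := fun t =>
    intervalIntegral.integral_hasDerivAt_right (hri.intervalIntegrable)
      hrs.continuous.stronglyMeasurable.stronglyMeasurableAtFilter hrs.continuous.continuousAt
  have hθderiv : deriv θ = r := funext fun t => (hθd t).deriv
  obtain ⟨M, hM0, hM⟩ : ∃ M < δ, ∀ t, M ≤ t → ρ t = 0 := by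
    rcases (tsupport ρ).eq_empty_or_nonempty with he | hne
    · exact ⟨0, hδ, fun t _ => image_eq_zero_of_notMem_tsupport (by simp [he])⟩
    · obtain ⟨M, hM, hMmax⟩ := hc.isCompact.exists_isMaxOn hne continuousOn_id
      refine ⟨(M + δ) / 2, by linarith [(hρ0 hM).2], fun t ht =>
        image_eq_zero_of_notMem_tsupport fun ht' => ?_⟩
      have h1 : t ≤ M := hMmax ht'
      linarith [(hρ0 hM).2]
  have hθl : ∀ t, t ≤ -3 / 2 → θ t = 0 := fun t ht => by
    simp only [hθ]
    rw [intervalIntegral.integral_of_ge ht]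
    rw [setIntegral_eq_zero_of_forall_eq_zero, neg_zero]
    intro s hs
    simp only [hr]
    rw [hρn s (by linarith [hs.2]), hbs' s hs.2]; ring
  have htot : ∀ t, (∀ s, t < s → r s = 0) → -3 / 2 ≤ t → θ t = 0 := fun t ht h3 => by
    simp only [hθ]
    rw [intervalIntegral.integral_of_le h3, ← hr0]
    refine setIntegral_eq_integral_of_forall_compl_eq_zero fun s hs => ?_
    by_cases hst : t < s
    · exact ht s hst
    · have : s ≤ -3 / 2 := by
        by_contra! hlt
        exact hs ⟨hlt, not_lt.1 hst⟩
      simp only [hr]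
      rw [hρn s (by linarith), hbs' s this]; ring
  have hθ0 : θ 0 = -c := by
    have hone : ∫ s in Ioc (-3 / 2 : ℝ) 0, ρ₀ s = 1 := by
      rw [← b.integral_normed (μ := volume)]
      refine setIntegral_eq_integral_of_forall_compl_eq_zero fun s hs => ?_
      by_cases h1 : s ≤ -3 / 2
      · exact hbs' s h1
      · refine hbs s ?_
        by_contra! h2
        exact hs ⟨not_le.1 h1, by linarith⟩
    simp only [hθ]
    rw [intervalIntegral.integral_of_le (by norm_num)]
    have : ∫ s in Ioc (-3 / 2 : ℝ) 0, r s = ∫ s in Ioc (-3 / 2 : ℝ) 0, -c * ρ₀ s := by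
      refine setIntegral_congr_fun measurableSet_Ioc fun s hs => ?_
      simp only [hr]
      rw [hρn s hs.2]; ring
    rw [this, integral_const_mul, hone]; ring
  have hρM : ∀ t, max M 0 ≤ t → r t = 0 := fun t ht => by
    have h0 : 0 ≤ t := (le_max_right _ _).trans ht
    simp only [hr]
    rw [hbs t (by linarith), hM t ((le_max_left _ _).trans ht)]; ring
  have hsupp : Function.support θ ⊆ Icc (-3 / 2) (max M 0) := by
    intro t ht
    have h1 : -3 / 2 ≤ t := by
      by_contra! hlt
      exact ht (hθl t hlt.le)
    refine ⟨h1, ?_⟩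
    by_contra! hlt
    exact ht (htot t (fun s hs => hρM s (hlt.le.trans hs.le)) h1)
  refine ⟨θ, ?_, ?_, ?_, ?_, hθ0⟩
  · exact contDiff_infty_iff_deriv.2 ⟨fun t => (hθd t).differentiableAt, by rw [hθderiv]; exact hrs⟩
  · exact HasCompactSupport.of_support_subset_isCompact isCompact_Icc hsupp
  · exact (closure_minimal hsupp isClosed_Icc).trans fun t ht => ht.2.trans_lt (max_lt hM0 hδ)
  · intro t ht
    rw [hθderiv]
    simp only [hr]
    rw [hbs t ht]; ring

end Velocity

/-! ### The initial velocity in H⁻¹, from the weak Cauchy problem. -/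

section InitialVelocity

open scoped ContDiff

variable {ℓ₀ : ℝ} {ℓ z v₀ v₁ : ℝ → ℝ} {u v vt vx : ℝ × ℝ → ℝ} {k : ℝ} {η : ℝ → ℝ}

/-- `w` is a weak solution of `w_tt - w_xx = f` in the strip `0 < t < ℓ₀ / 2`, `0 < x < ℓ₀`, with
initial data `v₀` and `v₁`. -/
def WeakCauchy (ℓ₀ : ℝ) (v₀ v₁ : ℝ → ℝ) (w f : ℝ × ℝ → ℝ) : Prop :=
  ∀ φ : ℝ × ℝ → ℝ, ContDiff ℝ ∞ φ → HasCompactSupport φ →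
    tsupport φ ⊆ Iio (ℓ₀ / 2) ×ˢ Ioo 0 ℓ₀ →
    ∫ p in Ioo 0 (ℓ₀ / 2) ×ˢ Ioo 0 ℓ₀, w p * box φ p
      = (∫ p in Ioo 0 (ℓ₀ / 2) ×ˢ Ioo 0 ℓ₀, f p * φ p)
        - (∫ x in Ioo 0 ℓ₀, v₀ x * fderiv ℝ φ (0, x) (1, 0)) + ∫ x in Ioo 0 ℓ₀, v₁ x * φ (0, x)

theorem mem_strip {δ : ℝ} {p : ℝ × ℝ} (h : p ∈ Iio δ ×ˢ Ioo 0 ℓ₀) (hp : 0 < p.1) :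
    p ∈ Ioo 0 δ ×ˢ Ioo 0 ℓ₀ := ⟨⟨hp, h.1⟩, h.2⟩

theorem weakCauchy_reprFun (h : IsFront ℓ₀ ℓ) (hℓ₀ : 0 < ℓ₀)
    (hz : ContinuousOn z (Ici 0)) (hv₀ : ContinuousOn v₀ (Icc 0 ℓ₀))
    (hv₁ : IntegrableOn v₁ (Ioo 0 ℓ₀)) (hc : v₀ 0 = z 0) (hc' : v₀ ℓ₀ = 0)
    (hF : ∀ M : ℝ, IntegrableOn (extendZero ℓ₀ ℓ v) {q | q.1 + q.2 < M}) (κ : ℝ) :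
    WeakCauchy ℓ₀ v₀ v₁ (reprFun ℓ₀ ℓ z v₀ v₁ κ (extendZero ℓ₀ ℓ v)) (fun p => 2 * κ * v p) := by
  intro φ hφ hφc hφs
  have key := integral_half_reprFun_mul_box h hℓ₀ hz hv₀ hv₁ hc hc' hF κ hφ hφc
    (fun x hx => (hφs hx).2)
  have hpos : ∀ p ∈ Ioo 0 (ℓ₀ / 2) ×ˢ Ioo 0 ℓ₀, p ∈ {p : ℝ × ℝ | 0 < p.1} := fun p hp => hp.1.1
  rw [setIntegral_eq_of_subset_of_forall_sdiff_eq_zero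
    (measurableSet_lt (by fun_prop) (by fun_prop)) hpos] at key
  · rw [key]
    simp only [mul_assoc (2 * κ), integral_const_mul]
    congr 3
    refine setIntegral_eq_of_subset_of_forall_sdiff_eq_zero (h.measurableSet_Omega' hℓ₀)
      (fun p hp => (h.strip_subset_Omega'T hℓ₀ hp).1) fun p hp => ?_
    rw [image_eq_zero_of_notMem_tsupport fun hp' =>
      hp.2 (mem_strip (hφs hp') (pos_of_mem_Omega' hp.1).1), mul_zero]
  · intro p hp
    rw [image_eq_zero_of_notMem_tsupport fun hp' =>
      hp.2 (mem_strip (hφs (tsupport_box_subset hp')) hp.1), mul_zero]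

/-- The time-integrated form of d/dt ⟨v_t, η⟩ = ⟨v, η''⟩ + k⟨v, η⟩. The test function is θ(t)η(x)
with θ' = ρ for t ≥ 0 and θ(0) = -∫ρ: the v₀ term drops since ρ(0) = 0, the v₁ term becomes
-(∫ρ)⟨v₁, η⟩, and varying ρ gives the identity for almost every t. -/
theorem ae_slice_velocity (h : IsFront ℓ₀ ℓ) (hℓ₀ : 0 < ℓ₀)
    (hd : HasWeakDeriv (openOmega' ℓ₀ ℓ) (1, 0) v vt)
    (hv : IntegrableOn v (Ioo 0 (ℓ₀ / 2) ×ˢ Ioo 0 ℓ₀))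
    (hvt : IntegrableOn vt (Ioo 0 (ℓ₀ / 2) ×ˢ Ioo 0 ℓ₀))
    (hw : WeakCauchy ℓ₀ v₀ v₁ v (fun p => k * v p))
    (hη : ContDiff ℝ ∞ η) (hc : HasCompactSupport η) (hη0 : tsupport η ⊆ Ioo 0 ℓ₀) :
    ∀ᵐ t : ℝ, t ∈ Ioo 0 (ℓ₀ / 2) →
      (∫ x in Ioo 0 ℓ₀, vt (t, x) * η x) - (∫ x in Ioo 0 ℓ₀, v₁ x * η x)
        - primitive (ℓ₀ / 2) (fun t => (∫ x in Ioo 0 ℓ₀, v (t, x) * deriv (deriv η) x)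
          + k * ∫ x in Ioo 0 ℓ₀, v (t, x) * η x) t = 0 := by
  set δ := ℓ₀ / 2 with hδ
  have hδ0 : 0 < δ := half_pos hℓ₀
  have hdη : ContDiff ℝ ∞ (deriv (deriv η)) := contDiff_deriv_top (contDiff_deriv_top hη)
  have i1 := integrableOn_strip_slice hv hdη.continuous hc.deriv.deriv
  have i2 := integrableOn_strip_slice hv hη.continuous hc
  have i3 := integrableOn_strip_slice hvt hη.continuous hc
  set G : ℝ → ℝ := fun t => (∫ x in Ioo 0 ℓ₀, v (t, x) * deriv (deriv η) x)
          + k * ∫ x in Ioo 0 ℓ₀, v (t, x) * η x with hG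
  have iG : IntegrableOn G (Ioo 0 δ) := i1.add (i2.const_mul k)
  have hPc : Continuous (primitive δ G) := continuous_primitive iG
  set c := ∫ x in Ioo 0 ℓ₀, v₁ x * η x with hcdef
  have hcl : Continuous fun t => c + primitive δ G t := continuous_const.add hPc
  have icl : IntegrableOn (fun t => c + primitive δ G t) (Ioo 0 δ) :=
    (hcl.integrableOn_Icc).mono_set Ioo_subset_Icc_self
  simp only [sub_sub]
  refine isOpen_Ioo.ae_eq_zero_of_integral_contDiff_smul_eq_zero
    (i3.sub icl).locallyIntegrableOn fun ρ hρ hρc hρ0 => ?_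
  obtain ⟨θ, hθ, hθc, hθs, hθd, hθ0⟩ := exists_primitive_test hδ0 hρ hρc hρ0
  have hρz : ∀ t, t ∉ Ioo 0 δ → ρ t = 0 := fun t ht =>
    image_eq_zero_of_notMem_tsupport fun h => ht (hρ0 h)
  have hθdd : ∀ t, 0 < t → deriv (deriv θ) t = deriv ρ t := fun t ht => by
    refine Filter.EventuallyEq.deriv_eq ?_
    filter_upwards [Ioi_mem_nhds ht] with s hs
    exact hθd s (by have : 0 < s := hs; linarith)
  have hφ := contDiff_prodFun hθ hη
  have hφc := hasCompactSupport_prodFun hθc hc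
  have key := hw (prodFun θ η) hφ hφc (tsupport_prodFun_subset.trans (prod_mono hθs hη0))
  have e1 : ∫ x in Ioo 0 ℓ₀, v₀ x * fderiv ℝ (prodFun θ η) (0, x) (1, 0) = 0 := by
    refine integral_eq_zero_of_ae (Eventually.of_forall fun x => ?_)
    simp only [fderiv_prodFun_fst hθ hη, prodFun, hθd 0 (by norm_num),
      hρz 0 (fun h => lt_irrefl _ h.1)]
    simp
  have e2 : ∫ x in Ioo 0 ℓ₀, v₁ x * prodFun θ η (0, x) = -(∫ t, ρ t) * c := by
    rw [hcdef, ← integral_const_mul]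
    refine integral_congr_ae (Eventually.of_forall fun x => ?_)
    simp only [prodFun, hθ0]; ring
  have hms : MeasurableSet (Ioo 0 δ ×ˢ Ioo 0 ℓ₀) := measurableSet_Ioo.prod measurableSet_Ioo
  have hρd : ContDiff ℝ ∞ (deriv ρ) := contDiff_deriv_top hρ
  have e3 : ∫ p in Ioo 0 δ ×ˢ Ioo 0 ℓ₀, v p * box (prodFun θ η) p
      = (∫ p in Ioo 0 δ ×ˢ Ioo 0 ℓ₀, v p * prodFun (deriv ρ) η p)
        - ∫ p in Ioo 0 δ ×ˢ Ioo 0 ℓ₀, v p * prodFun θ (deriv (deriv η)) p := by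
    rw [← integral_sub
      (integrableOn_strip_mul hv (contDiff_prodFun hρd hη).continuous
        (hasCompactSupport_prodFun hρc.deriv hc))
      (integrableOn_strip_mul hv (contDiff_prodFun hθ hdη).continuous
        (hasCompactSupport_prodFun hθc hc.deriv.deriv))]
    refine setIntegral_congr_fun hms fun p hp => ?_
    simp only [box_prodFun hθ hη]
    simp only [prodFun, hθdd p.1 hp.1.1]; ring
  have hsupp : tsupport (prodFun ρ η) ⊆ Ioo 0 δ ×ˢ Ioo 0 ℓ₀ :=
    tsupport_prodFun_subset.trans (prod_mono hρ0 hη0)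
  have e4 : ∫ p in Ioo 0 δ ×ˢ Ioo 0 ℓ₀, v p * prodFun (deriv ρ) η p
      = -∫ p in Ioo 0 δ ×ˢ Ioo 0 ℓ₀, vt p * prodFun ρ η p := by
    have h1 := hd.integral_eq (contDiff_prodFun hρ hη) (hasCompactSupport_prodFun hρc hc)
      (by rw [h.coe_openOmega' hℓ₀]; exact hsupp.trans h.strip_subset)
    simp only [fderiv_prodFun_fst hρ hη, h.coe_openOmega' hℓ₀] at h1
    rwa [setIntegral_punctured_eq_strip h, setIntegral_punctured_eq_strip h] at h1
    · intro p _ hp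
      rw [image_eq_zero_of_notMem_tsupport fun hp' => hp (hsupp hp'), mul_zero]
    · intro p _ hp
      have : prodFun (deriv ρ) η p = 0 := by
        by_contra hne
        exact hp (prod_mono (tsupport_deriv_subset.trans hρ0) hη0 (support_prodFun_subset hne))
      rw [this, mul_zero]
  have hθi : Continuous θ := hθ.continuous
  obtain ⟨C, hC⟩ := hθi.bounded_above_of_compact_support hθc
  obtain ⟨C', hC'⟩ := hρ.continuous.bounded_above_of_compact_support hρc
  have j1 : IntegrableOn (fun t => θ t * ∫ x in Ioo 0 ℓ₀, v (t, x) * deriv (deriv η) x)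
      (Ioo 0 δ) := Integrable.bdd_mul i1 hθi.aestronglyMeasurable (Eventually.of_forall hC)
  have j2 : IntegrableOn (fun t => θ t * ∫ x in Ioo 0 ℓ₀, v (t, x) * η x)
      (Ioo 0 δ) := Integrable.bdd_mul i2 hθi.aestronglyMeasurable (Eventually.of_forall hC)
  have j3 : IntegrableOn (fun t => ρ t * ∫ x in Ioo 0 ℓ₀, vt (t, x) * η x)
      (Ioo 0 δ) :=
    Integrable.bdd_mul i3 hρ.continuous.aestronglyMeasurable (Eventually.of_forall hC')
  have j4 : IntegrableOn (fun t => ρ t * (c + primitive δ G t)) (Ioo 0 δ) :=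
    Integrable.bdd_mul icl hρ.continuous.aestronglyMeasurable (Eventually.of_forall hC')
  simp only [mul_assoc k, integral_const_mul] at key
  rw [e3, e4, e1, e2, integral_strip_prodFun hv hθi hθc hdη.continuous hc.deriv.deriv,
    integral_strip_prodFun hvt hρ.continuous hρc hη.continuous hc,
    integral_strip_prodFun hv hθi hθc hη.continuous hc] at key
  have e5 : ∫ t in Ioo 0 δ, G t * θ t
      = (∫ t in Ioo 0 δ, θ t * ∫ x in Ioo 0 ℓ₀, v (t, x) * deriv (deriv η) x)
        + k * ∫ t in Ioo 0 δ, θ t * ∫ x in Ioo 0 ℓ₀, v (t, x) * η x := by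
    rw [← integral_const_mul, ← integral_add j1 (j2.const_mul k)]
    refine integral_congr_ae (Eventually.of_forall fun t => ?_)
    simp only [hG]; ring
  have e6 : ∫ t, primitive δ G t * deriv θ t = ∫ t in Ioo 0 δ, ρ t * primitive δ G t := by
    rw [← setIntegral_eq_integral_of_forall_compl_eq_zero (s := Ioo 0 δ) fun t ht => ?_]
    · refine setIntegral_congr_fun measurableSet_Ioo fun t ht => ?_
      simp only [hθd t (by linarith [ht.1])]; ring
    · rcases le_or_gt t 0 with h0 | h0
      · have : primitive δ G t = 0 := by
          refine setIntegral_eq_zero_of_forall_eq_zero fun r hr => ?_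
          exact indicator_of_notMem (fun h => absurd (h.1.trans_le hr) (not_lt.2 h0)) _
        rw [this, zero_mul]
      · rw [hθd t (by linarith), hρz t ht, mul_zero]
  have e7 : ∫ t, ρ t = ∫ t in Ioo 0 δ, ρ t :=
    (setIntegral_eq_integral_of_forall_compl_eq_zero fun t ht => hρz t ht).symm
  have hP := integral_primitive_mul_deriv iG hθ hθc
  rw [e6] at hP
  rw [← setIntegral_eq_integral_of_forall_compl_eq_zero (s := Ioo 0 δ) fun t ht => by
      rw [hρz t ht, zero_smul]]
  simp only [smul_eq_mul, mul_sub]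
  rw [integral_sub j3 j4]
  simp only [mul_add]
  have j5 : IntegrableOn (fun t => ρ t * c) (Ioo 0 δ) :=
    ((hρ.continuous.integrable_of_hasCompactSupport hρc).mul_const c).integrableOn
  have j6 : IntegrableOn (fun t => ρ t * primitive δ G t) (Ioo 0 δ) :=
    ((hρ.continuous.mul hPc).integrable_of_hasCompactSupport hρc.mul_right).integrableOn
  rw [integral_add j5 j6, integral_mul_const, hP, e5, ← e7]
  linarith

theorem abs_integral_mul_le {f g : ℝ → ℝ} {s : Set ℝ} (hf2 : IntegrableOn (fun x => f x ^ 2) s)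
    (hg2 : IntegrableOn (fun x => g x ^ 2) s) :
    |∫ x in s, f x * g x| ≤ 1 / 2 * (∫ x in s, f x ^ 2) + 1 / 2 * ∫ x in s, g x ^ 2 := by
  rw [← integral_const_mul, ← integral_const_mul,
    ← integral_add (hf2.const_mul _) (hg2.const_mul _)]
  rw [← Real.norm_eq_abs]
  refine norm_integral_le_of_norm_le ((hf2.const_mul _).add (hg2.const_mul _))
    (Eventually.of_forall fun x => ?_)
  rw [Real.norm_eq_abs, abs_le]
  constructor <;> nlinarith [sq_nonneg (f x + g x), sq_nonneg (f x - g x)]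

/-- A bound of the time derivative of `v_t(t, ·)` in the unit ball of `H⁻¹(0, ℓ₀)`. -/
noncomputable def energyBound (ℓ₀ k : ℝ) (v vx : ℝ × ℝ → ℝ) (t : ℝ) : ℝ :=
  1 / 2 * (∫ x in Ioo 0 ℓ₀, vx (t, x) ^ 2) + k / 2 * (∫ x in Ioo 0 ℓ₀, v (t, x) ^ 2)
    + (1 + k) / 2

theorem integrableOn_energyBound {δ : ℝ}
    (hv2 : IntegrableOn (fun p => v p ^ 2) (Ioo 0 δ ×ˢ Ioo 0 ℓ₀))
    (hvx2 : IntegrableOn (fun p => vx p ^ 2) (Ioo 0 δ ×ˢ Ioo 0 ℓ₀)) :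
    IntegrableOn (energyBound ℓ₀ k v vx) (Ioo 0 δ) := by
  rw [IntegrableOn, Measure.volume_eq_prod, ← Measure.prod_restrict] at hv2 hvx2
  exact ((hvx2.integral_prod_left.const_mul _).add (hv2.integral_prod_left.const_mul _)).add
    (integrable_const _)

theorem abs_primitive_le {δ : ℝ} {f g : ℝ → ℝ}
    (hg : IntegrableOn g (Ioo 0 δ)) (hfg : ∀ᵐ t : ℝ, t ∈ Ioo 0 δ → |f t| ≤ g t) (t : ℝ) :
    |primitive δ f t| ≤ primitive δ g t := by
  rw [← Real.norm_eq_abs, primitive, primitive]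
  refine norm_integral_le_of_norm_le (hg.integrable_indicator measurableSet_Ioo).integrableOn
    (ae_restrict_of_ae ?_)
  filter_upwards [hfg] with s hs
  by_cases h : s ∈ Ioo 0 δ
  · simp only [indicator_of_mem h]; exact hs h
  · simp [indicator_of_notMem h]

/-- Moving one derivative from η'' onto v and using Young's inequality bounds |⟨v, η''⟩ + k⟨v, η⟩|
by slice energies plus a constant, uniformly for η in the unit ball of H¹₀. Only the null set of
times still depends on η. -/
theorem ae_slice_velocity_le (h : IsFront ℓ₀ ℓ) (hℓ₀ : 0 < ℓ₀) (hk : 0 ≤ k)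
    (hd : HasWeakDeriv (openOmega' ℓ₀ ℓ) (1, 0) v vt)
    (hd' : HasWeakDeriv (openOmega' ℓ₀ ℓ) (0, 1) v vx)
    (hv : IntegrableOn v (Ioo 0 (ℓ₀ / 2) ×ˢ Ioo 0 ℓ₀))
    (hvt : IntegrableOn vt (Ioo 0 (ℓ₀ / 2) ×ˢ Ioo 0 ℓ₀))
    (hvx : IntegrableOn vx (Ioo 0 (ℓ₀ / 2) ×ˢ Ioo 0 ℓ₀))
    (hv2 : IntegrableOn (fun p => v p ^ 2) (Ioo 0 (ℓ₀ / 2) ×ˢ Ioo 0 ℓ₀))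
    (hvx2 : IntegrableOn (fun p => vx p ^ 2) (Ioo 0 (ℓ₀ / 2) ×ˢ Ioo 0 ℓ₀))
    (hw : WeakCauchy ℓ₀ v₀ v₁ v (fun p => k * v p))
    (hη : ContDiff ℝ ∞ η) (hc : HasCompactSupport η) (hη0 : tsupport η ⊆ Ioo 0 ℓ₀)
    (hη1 : ∫ x in Ioo 0 ℓ₀, (η x ^ 2 + deriv η x ^ 2) ≤ 1) :
    ∀ᵐ t : ℝ, t ∈ Ioo 0 (ℓ₀ / 2) →
      |(∫ x in Ioo 0 ℓ₀, vt (t, x) * η x) - ∫ x in Ioo 0 ℓ₀, v₁ x * η x|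
        ≤ primitive (ℓ₀ / 2) (energyBound ℓ₀ k v vx) t := by
  have hηd := contDiff_deriv_top hη
  have iη : Integrable fun x => η x ^ 2 := by
    simp only [sq]
    exact (hη.continuous.mul hη.continuous).integrable_of_hasCompactSupport hc.mul_left
  have idη : Integrable fun x => deriv η x ^ 2 := by
    simp only [sq]
    exact (hηd.continuous.mul hηd.continuous).integrable_of_hasCompactSupport hc.deriv.mul_left
  rw [integral_add iη.integrableOn idη.integrableOn] at hη1
  have n1 : 0 ≤ ∫ x in Ioo 0 ℓ₀, η x ^ 2 := integral_nonneg fun x => sq_nonneg _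
  have n2 : 0 ≤ ∫ x in Ioo 0 ℓ₀, deriv η x ^ 2 := integral_nonneg fun x => sq_nonneg _
  have s1 : ∀ᵐ t : ℝ, t ∈ Ioo 0 (ℓ₀ / 2) → IntegrableOn (fun x => v (t, x) ^ 2) (Ioo 0 ℓ₀) := by
    rw [IntegrableOn, Measure.volume_eq_prod, ← Measure.prod_restrict] at hv2
    exact (ae_restrict_iff' measurableSet_Ioo).1 hv2.prod_right_ae
  have s2 : ∀ᵐ t : ℝ, t ∈ Ioo 0 (ℓ₀ / 2) → IntegrableOn (fun x => vx (t, x) ^ 2) (Ioo 0 ℓ₀) := by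
    rw [IntegrableOn, Measure.volume_eq_prod, ← Measure.prod_restrict] at hvx2
    exact (ae_restrict_iff' measurableSet_Ioo).1 hvx2.prod_right_ae
  have hbound : ∀ t ∈ Ioo 0 (ℓ₀ / 2), |primitive (ℓ₀ / 2) (fun t =>
      (∫ x in Ioo 0 ℓ₀, v (t, x) * deriv (deriv η) x)
        + k * ∫ x in Ioo 0 ℓ₀, v (t, x) * η x) t|
      ≤ primitive (ℓ₀ / 2) (energyBound ℓ₀ k v vx) t := by
    intro t _
    refine abs_primitive_le (integrableOn_energyBound hv2 hvx2) ?_ t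
    filter_upwards [s1, s2, ae_slice_weakDeriv_snd h hℓ₀ hd' hv hvx hηd hc.deriv
      (tsupport_deriv_subset.trans hη0)] with s h1 h2 h3 hs
    have h4 := abs_integral_mul_le (h1 hs) iη.integrableOn
    have h5 := abs_integral_mul_le (h2 hs) idη.integrableOn
    have h6 : ∫ x in Ioo 0 ℓ₀, v (s, x) * deriv (deriv η) x
        = -∫ x in Ioo 0 ℓ₀, vx (s, x) * deriv η x := by linarith [h3 hs]
    rw [h6, energyBound]
    refine (abs_add_le _ _).trans ?_
    rw [abs_neg, abs_mul, abs_of_nonneg hk]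
    have h7 := mul_le_mul_of_nonneg_left h4 hk
    have h8 := mul_le_mul_of_nonneg_left (show ∫ x in Ioo 0 ℓ₀, η x ^ 2 ≤ 1 by linarith) hk
    linarith
  filter_upwards [ae_slice_velocity h hℓ₀ hd hv hvt hw hη hc hη0] with t ht ht0
  have h1 := ht ht0
  rw [sub_eq_zero.1 h1]
  exact hbound t ht0

/-- The uniform topology comes from C([0, ℓ₀]), which is second countable, and this passes to any
set of test functions. Countability allows the null sets of times attached to each test function to
be merged into one. -/
theorem exists_countable_uniform_dense (B : Set (TestFunction (interval 0 ℓ₀) ℝ ⊤)) :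
    ∃ D ⊆ B, D.Countable ∧ ∀ η ∈ B, ∀ ε > 0, ∃ ζ ∈ D, ∀ x ∈ Icc 0 ℓ₀, |η x - ζ x| < ε := by
  let Φ : B → C(Icc (0 : ℝ) ℓ₀, ℝ) := fun η => ⟨fun x => η.1 x, by
    have := η.1.continuous; fun_prop⟩
  let _ : TopologicalSpace B := TopologicalSpace.induced Φ inferInstance
  have : SecondCountableTopology B := secondCountableTopology_induced B _ Φ
  obtain ⟨D, hDc, hD⟩ := TopologicalSpace.exists_countable_dense B
  refine ⟨Subtype.val '' D, by rintro _ ⟨η, _, rfl⟩; exact η.2, hDc.image _, ?_⟩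
  intro η hη ε hε
  have hcont : Continuous Φ := continuous_induced_dom
  have hopen : IsOpen {ζ : B | dist (Φ ⟨η, hη⟩) (Φ ζ) < ε} :=
    isOpen_lt (continuous_const.dist hcont) continuous_const
  obtain ⟨ζ, hζD, hζ⟩ := hD.exists_mem_open hopen ⟨⟨η, hη⟩, by simpa using hε⟩
  refine ⟨ζ.1, ⟨ζ, hζD, rfl⟩, fun x hx => ?_⟩
  have := (ContinuousMap.dist_lt_iff hε).1 hζ ⟨x, hx⟩
  rwa [Real.dist_eq] at this

/-- Uniform density of D is enough, without control of derivatives, because f is integrable: the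
pairing with f is continuous for uniform convergence. -/
theorem negSobolevNorm_le_of_dense {B D : Set (TestFunction (interval 0 ℓ₀) ℝ ⊤)}
    (hB : B = {η : TestFunction (interval 0 ℓ₀) ℝ ⊤ | ∫ x in Ioo 0 ℓ₀, ((η x) ^ 2 + (deriv η x) ^ 2) ≤ 1})
    (hD : ∀ η ∈ B, ∀ ε > 0, ∃ ζ ∈ D, ∀ x ∈ Icc 0 ℓ₀, |η x - ζ x| < ε) {f : ℝ → ℝ}
    (hf : IntegrableOn f (Ioo 0 ℓ₀)) {c : ℝ}
    (hc : ∀ η ∈ D, |∫ x in Ioo 0 ℓ₀, f x * η x| ≤ c) :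
    negSobolevNorm 0 ℓ₀ f ≤ ENNReal.ofReal c := by
  refine iSup₂_le fun η hη => ?_
  rw [← ofReal_norm]
  refine ENNReal.ofReal_le_ofReal ?_
  have hint : ∀ ζ : TestFunction (interval 0 ℓ₀) ℝ ⊤,
      IntegrableOn (fun x => f x * ζ x) (Ioo 0 ℓ₀) := fun ζ => by
    obtain ⟨C, hC⟩ := ζ.continuous.bounded_above_of_compact_support ζ.hasCompactSupport
    exact Integrable.mul_bdd hf ζ.continuous.aestronglyMeasurable (Eventually.of_forall hC)
  refine le_of_forall_pos_le_add fun ε hε => ?_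
  set M := ∫ x in Ioo 0 ℓ₀, |f x| with hM
  have hM0 : 0 ≤ M := integral_nonneg fun x => abs_nonneg _
  obtain ⟨ζ, hζ, hζε⟩ := hD η (by rw [hB]; exact hη) (ε / (M + 1)) (by positivity)
  have h1 : |(∫ x in Ioo 0 ℓ₀, f x * η x) - ∫ x in Ioo 0 ℓ₀, f x * ζ x| ≤ M * (ε / (M + 1)) := by
    rw [← integral_sub (hint η) (hint ζ), hM, ← integral_mul_const]
    rw [← Real.norm_eq_abs]
    refine norm_integral_le_of_norm_le (hf.abs.mul_const _) ?_
    filter_upwards [ae_restrict_mem measurableSet_Ioo] with x hx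
    rw [← mul_sub, norm_mul, Real.norm_eq_abs, Real.norm_eq_abs]
    exact mul_le_mul_of_nonneg_left (hζε x (Ioo_subset_Icc_self hx)).le (abs_nonneg _)
  have h2 : M * (ε / (M + 1)) ≤ ε := by
    rw [← mul_div_assoc, div_le_iff₀ (by positivity)]; nlinarith
  have h3 := hc ζ hζ
  rw [Real.norm_eq_abs]
  rw [abs_le] at *
  constructor <;> linarith [h1.1, h1.2, h3.1, h3.2]

/-- For almost every t the norm is at most the primitive of `energyBound`, which is continuous and
vanishes at 0. -/
theorem tendsto_negSobolevNorm (h : IsFront ℓ₀ ℓ) (hℓ₀ : 0 < ℓ₀) (hk : 0 ≤ k)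
    (hv₁ : IntegrableOn v₁ (Ioo 0 ℓ₀))
    (hd : HasWeakDeriv (openOmega' ℓ₀ ℓ) (1, 0) v vt)
    (hd' : HasWeakDeriv (openOmega' ℓ₀ ℓ) (0, 1) v vx)
    (hv : IntegrableOn v (Ioo 0 (ℓ₀ / 2) ×ˢ Ioo 0 ℓ₀))
    (hvt : IntegrableOn vt (Ioo 0 (ℓ₀ / 2) ×ˢ Ioo 0 ℓ₀))
    (hvx : IntegrableOn vx (Ioo 0 (ℓ₀ / 2) ×ˢ Ioo 0 ℓ₀))
    (hv2 : IntegrableOn (fun p => v p ^ 2) (Ioo 0 (ℓ₀ / 2) ×ˢ Ioo 0 ℓ₀))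
    (hvx2 : IntegrableOn (fun p => vx p ^ 2) (Ioo 0 (ℓ₀ / 2) ×ˢ Ioo 0 ℓ₀))
    (hw : WeakCauchy ℓ₀ v₀ v₁ v (fun p => k * v p)) :
    Tendsto (fun t : ℝ => negSobolevNorm 0 ℓ₀ (fun x => vt (t, x) - v₁ x)) essZeroPlus (𝓝 0) := by
  obtain ⟨D, hDB, hDc, hD⟩ := exists_countable_uniform_dense (ℓ₀ := ℓ₀)
    {η | ∫ x in Ioo 0 ℓ₀, ((η x) ^ 2 + (deriv η x) ^ 2) ≤ 1}
  have h1 : ∀ᵐ t : ℝ, ∀ η ∈ D, t ∈ Ioo 0 (ℓ₀ / 2) →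
      |(∫ x in Ioo 0 ℓ₀, vt (t, x) * η x) - ∫ x in Ioo 0 ℓ₀, v₁ x * η x|
        ≤ primitive (ℓ₀ / 2) (energyBound ℓ₀ k v vx) t :=
    (ae_ball_iff hDc).2 fun η hη => ae_slice_velocity_le h hℓ₀ hk hd hd' hv hvt hvx hv2 hvx2 hw
      η.contDiff η.hasCompactSupport η.tsupport_subset (hDB hη)
  have h2 : ∀ᵐ t : ℝ, t ∈ Ioo 0 (ℓ₀ / 2) → IntegrableOn (fun x => vt (t, x)) (Ioo 0 ℓ₀) := by
    have := hvt
    rw [IntegrableOn, Measure.volume_eq_prod, ← Measure.prod_restrict] at this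
    exact (ae_restrict_iff' measurableSet_Ioo).1 this.prod_right_ae
  have hlim : Tendsto (fun t => ENNReal.ofReal (primitive (ℓ₀ / 2) (energyBound ℓ₀ k v vx) t))
      essZeroPlus (𝓝 0) := by
    have hc := ENNReal.continuous_ofReal.comp
      (continuous_primitive (integrableOn_energyBound (k := k) hv2 hvx2))
    have h3 := hc.tendsto 0
    simp only [Function.comp_apply, primitive_zero, ENNReal.ofReal_zero] at h3
    exact h3.mono_left (essZeroPlus_le.trans nhdsWithin_le_nhds)
  refine tendsto_of_tendsto_of_tendsto_of_le_of_le' tendsto_const_nhds hlim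
    (Eventually.of_forall fun _ => zero_le) ?_
  filter_upwards [eventually_essZeroPlus (Ioo_mem_nhdsGT (half_pos hℓ₀)) (h1.and h2)] with t ht
  obtain ⟨ht0, ht1, ht2⟩ := ht
  refine negSobolevNorm_le_of_dense rfl hD ((ht2 ht0).sub hv₁) fun η hη => ?_
  have h3 := ht1 η hη ht0
  obtain ⟨C, hC⟩ := η.continuous.bounded_above_of_compact_support η.hasCompactSupport
  rw [← integral_sub
    (Integrable.mul_bdd (ht2 ht0) η.continuous.aestronglyMeasurable (Eventually.of_forall hC))
    (Integrable.mul_bdd hv₁ η.continuous.aestronglyMeasurable (Eventually.of_forall hC))] at h3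
  simpa only [Pi.sub_apply, sub_mul] using h3

end InitialVelocity

/-! ### From the distributional equation and initial values to the weak Cauchy problem. -/

section Cutoff

open scoped ContDiff

variable {ℓ₀ δ : ℝ} {ℓ z v₀ v₁ : ℝ → ℝ} {u v vt vx : ℝ × ℝ → ℝ} {k : ℝ} {φ : ℝ × ℝ → ℝ}

/-- A smooth function that is `0` for `t ≤ h` and `1` for `2 h ≤ t`. -/
noncomputable def cutoff (h t : ℝ) : ℝ := Real.smoothTransition (t / h - 1)

theorem contDiff_cutoff (h : ℝ) : ContDiff ℝ ∞ (cutoff h) :=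
  Real.smoothTransition.contDiff.comp ((contDiff_id.div_const h).sub contDiff_const)

theorem cutoff_of_le {h t : ℝ} (hh : 0 < h) (ht : t ≤ h) : cutoff h t = 0 :=
  Real.smoothTransition.zero_of_nonpos (by rw [sub_nonpos, div_le_one hh]; exact ht)

theorem cutoff_of_ge {h t : ℝ} (hh : 0 < h) (ht : 2 * h ≤ t) : cutoff h t = 1 :=
  Real.smoothTransition.one_of_one_le (by
    have : 2 ≤ t / h := by rwa [le_div_iff₀ hh]
    linarith)

theorem cutoff_nonneg (h t : ℝ) : 0 ≤ cutoff h t := Real.smoothTransition.nonneg _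

theorem cutoff_le_one (h t : ℝ) : cutoff h t ≤ 1 := Real.smoothTransition.le_one _

theorem monotone_cutoff {h : ℝ} (hh : 0 < h) : Monotone (cutoff h) := fun _ _ hst =>
  Real.smoothTransition.monotone (sub_le_sub_right (div_le_div_of_nonneg_right hst hh.le) 1)

theorem deriv_cutoff_nonneg {h : ℝ} (hh : 0 < h) (t : ℝ) : 0 ≤ deriv (cutoff h) t :=
  (monotone_cutoff hh).deriv_nonneg

theorem deriv_cutoff_of_lt {h t : ℝ} (hh : 0 < h) (ht : t < h) : deriv (cutoff h) t = 0 := by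
  have : cutoff h =ᶠ[𝓝 t] fun _ => 0 := by
    filter_upwards [Iio_mem_nhds ht] with s hs
    exact cutoff_of_le hh (le_of_lt hs)
  rw [this.deriv_eq, deriv_const]

theorem deriv_cutoff_of_gt {h t : ℝ} (hh : 0 < h) (ht : 2 * h < t) : deriv (cutoff h) t = 0 := by
  have : cutoff h =ᶠ[𝓝 t] fun _ => 1 := by
    filter_upwards [Ioi_mem_nhds ht] with s hs
    exact cutoff_of_ge hh (le_of_lt hs)
  rw [this.deriv_eq, deriv_const]

theorem tsupport_cutoff_subset {h : ℝ} (hh : 0 < h) : tsupport (cutoff h) ⊆ Ici h :=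
  closure_minimal (fun t ht => by
    by_contra hlt
    exact ht (cutoff_of_le hh (not_le.1 hlt).le)) isClosed_Ici

theorem continuous_deriv_cutoff (h : ℝ) : Continuous (deriv (cutoff h)) :=
  (contDiff_deriv_top (contDiff_cutoff h)).continuous

theorem hasCompactSupport_deriv_cutoff {h : ℝ} (hh : 0 < h) :
    HasCompactSupport (deriv (cutoff h)) :=
  HasCompactSupport.of_support_subset_isCompact (isCompact_Icc (a := h) (b := 2 * h))
    fun t ht => ⟨by
      by_contra! hlt
      exact ht (deriv_cutoff_of_lt hh hlt), by
      by_contra! hlt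
      exact ht (deriv_cutoff_of_gt hh hlt)⟩

theorem integral_deriv_cutoff {h : ℝ} (hh : 0 < h) (hδ : 2 * h < δ) :
    ∫ t in Ioo 0 δ, deriv (cutoff h) t = 1 := by
  rw [← integral_Ioc_eq_integral_Ioo, ← intervalIntegral.integral_of_le (by linarith),
    intervalIntegral.integral_deriv_eq_sub
      (fun t _ => (contDiff_cutoff h).differentiable (by simp) t)
      ((continuous_deriv_cutoff h).intervalIntegrable _ _),
    cutoff_of_ge hh hδ.le, cutoff_of_le hh hh.le, sub_zero]

/-- The kernels are nonnegative, have mass one and concentrate on [h, 2h]. As they are integrated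
against Lebesgue measure, null sets of times do not count and an essential limit of m suffices. -/
theorem tendsto_integral_deriv_cutoff (hδ : 0 < δ) {m : ℝ → ℝ} {c : ℝ}
    (hm : Tendsto m essZeroPlus (𝓝 c)) (hi : IntegrableOn m (Ioo 0 δ)) :
    Tendsto (fun h => ∫ t in Ioo 0 δ, deriv (cutoff h) t * m t) (𝓝[>] 0) (𝓝 c) := by
  rw [Metric.tendsto_nhds]
  intro ε hε
  have h1 : ∀ᶠ t in essZeroPlus, dist (m t) c < ε / 2 := Metric.tendsto_nhds.1 hm _ (half_pos hε)
  obtain ⟨s, hs, s', hs', hss⟩ := mem_inf_iff_superset.1 h1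
  obtain ⟨r, hr, hrs⟩ := mem_nhdsGT_iff_exists_Ioo_subset.1 hs
  have hr0 : 0 < r := hr
  filter_upwards [Ioo_mem_nhdsGT (show 0 < min (r / 2) (δ / 2) by positivity)] with h hh
  have hh0 : 0 < h := hh.1
  have hhr : 2 * h < r := by have := hh.2.trans_le (min_le_left _ _); linarith
  have hhδ : 2 * h < δ := by have := hh.2.trans_le (min_le_right _ _); linarith
  have hdi : IntegrableOn (deriv (cutoff h)) (Ioo 0 δ) :=
    ((continuous_deriv_cutoff h).integrable_of_hasCompactSupport
      (hasCompactSupport_deriv_cutoff hh0)).integrableOn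
  obtain ⟨C, hC⟩ := (continuous_deriv_cutoff h).bounded_above_of_compact_support
    (hasCompactSupport_deriv_cutoff hh0)
  have hmi : IntegrableOn (fun t => deriv (cutoff h) t * m t) (Ioo 0 δ) :=
    Integrable.bdd_mul hi (continuous_deriv_cutoff h).aestronglyMeasurable
      (Eventually.of_forall hC)
  have e1 : (∫ t in Ioo 0 δ, deriv (cutoff h) t * m t) - c
      = ∫ t in Ioo 0 δ, deriv (cutoff h) t * (m t - c) := by
    simp only [mul_sub]
    rw [integral_sub hmi (hdi.mul_const c), integral_mul_const, integral_deriv_cutoff hh0 hhδ,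
      one_mul]
  rw [Real.dist_eq, e1]
  have e2 : ‖∫ t in Ioo 0 δ, deriv (cutoff h) t * (m t - c)‖
      ≤ ∫ t in Ioo 0 δ, deriv (cutoff h) t * (ε / 2) := by
    refine norm_integral_le_of_norm_le (hdi.mul_const _) ?_
    filter_upwards [ae_restrict_of_ae hs', ae_restrict_mem measurableSet_Ioo] with t ht ht'
    rw [norm_mul, Real.norm_of_nonneg (deriv_cutoff_nonneg hh0 t)]
    rcases lt_or_ge t r with h2 | h2
    · have h3 : dist (m t) c < ε / 2 := hss ⟨hrs ⟨ht'.1, h2⟩, ht⟩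
      rw [Real.dist_eq] at h3
      exact mul_le_mul_of_nonneg_left h3.le (deriv_cutoff_nonneg hh0 t)
    · rw [deriv_cutoff_of_gt hh0 (hhr.trans_le h2), zero_mul, zero_mul]
  rw [integral_mul_const, integral_deriv_cutoff hh0 hhδ, one_mul] at e2
  rw [← Real.norm_eq_abs]
  linarith

theorem tendsto_integral_cutoff {μ : Measure (ℝ × ℝ)} {f : ℝ × ℝ → ℝ}
    (hf : Integrable f (μ.restrict {p | 0 < p.1})) :
    Tendsto (fun h => ∫ p in {p | 0 < p.1}, cutoff h p.1 * f p ∂μ) (𝓝[>] 0)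
      (𝓝 (∫ p in {p | 0 < p.1}, f p ∂μ)) := by
  refine tendsto_integral_filter_of_dominated_convergence (fun p => ‖f p‖) ?_ ?_ hf.norm ?_
  · exact Eventually.of_forall fun h =>
      (((contDiff_cutoff h).continuous.comp continuous_fst).aestronglyMeasurable).mul
        hf.aestronglyMeasurable
  · refine Eventually.of_forall fun h => Eventually.of_forall fun p => ?_
    rw [norm_mul]
    refine mul_le_of_le_one_left (norm_nonneg _) ?_
    rw [Real.norm_of_nonneg (cutoff_nonneg _ _)]
    exact cutoff_le_one _ _
  · filter_upwards [ae_restrict_mem (measurableSet_lt (by fun_prop) (by fun_prop))] with p hp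
    have hp : 0 < p.1 := hp
    refine tendsto_const_nhds.congr' ?_
    filter_upwards [Ioo_mem_nhdsGT (half_pos hp)] with h hh
    rw [cutoff_of_ge hh.1 (by linarith [hh.2]), one_mul]

/-- The pairing splits into that of f(t) - w, small by hypothesis, and that of w with ψ(t, ·),
continuous in t by dominated convergence. -/
theorem tendsto_slice_of_enorm (hδ : 0 < δ) {f : ℝ × ℝ → ℝ} {w : ℝ → ℝ} {ψ : ℝ × ℝ → ℝ}
    (hf : IntegrableOn f (Ioo 0 δ ×ˢ Ioo 0 ℓ₀)) (hw : IntegrableOn w (Ioo 0 ℓ₀))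
    (hψ : Continuous ψ) (hψc : HasCompactSupport ψ)
    (hlim : Tendsto (fun t => ‖∫ x in Ioo 0 ℓ₀, (f (t, x) - w x) * ψ (t, x)‖ₑ) essZeroPlus (𝓝 0)) :
    Tendsto (fun t => ∫ x in Ioo 0 ℓ₀, f (t, x) * ψ (t, x)) essZeroPlus
      (𝓝 (∫ x in Ioo 0 ℓ₀, w x * ψ (0, x))) := by
  obtain ⟨C, hC⟩ := hψ.bounded_above_of_compact_support hψc
  have h1 : Tendsto (fun t => ∫ x in Ioo 0 ℓ₀, (f (t, x) - w x) * ψ (t, x)) essZeroPlus (𝓝 0) := by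
    rw [tendsto_zero_iff_enorm_tendsto_zero]; exact hlim
  have h2 : Tendsto (fun t => ∫ x in Ioo 0 ℓ₀, w x * ψ (t, x)) essZeroPlus
      (𝓝 (∫ x in Ioo 0 ℓ₀, w x * ψ (0, x))) := by
    have hc : Continuous fun t => ∫ x in Ioo 0 ℓ₀, w x * ψ (t, x) := by
      refine continuous_of_dominated (bound := fun x => ‖w x‖ * C) ?_ ?_ (hw.norm.mul_const C) ?_
      · exact fun t => hw.aestronglyMeasurable.mul
          (hψ.comp (Continuous.prodMk_right t)).aestronglyMeasurable
      · exact fun t => Eventually.of_forall fun x => by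
          rw [norm_mul]; exact mul_le_mul_of_nonneg_left (hC _) (norm_nonneg _)
      · exact Eventually.of_forall fun x => by fun_prop
    exact (hc.tendsto 0).mono_left (essZeroPlus_le.trans nhdsWithin_le_nhds)
  have h3 := h1.add h2
  rw [zero_add] at h3
  refine h3.congr' ?_
  have h4 : ∀ᵐ t : ℝ, t ∈ Ioo 0 δ → IntegrableOn (fun x => f (t, x)) (Ioo 0 ℓ₀) := by
    rw [IntegrableOn, Measure.volume_eq_prod, ← Measure.prod_restrict] at hf
    exact (ae_restrict_iff' measurableSet_Ioo).1 hf.prod_right_ae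
  filter_upwards [eventually_essZeroPlus (Ioo_mem_nhdsGT hδ) h4] with t ht
  have h5 := ht.2 ht.1
  have hψt : Continuous fun x => ψ (t, x) := hψ.comp (Continuous.prodMk_right t)
  have h6 : IntegrableOn (fun x => (f (t, x) - w x) * ψ (t, x)) (Ioo 0 ℓ₀) :=
    Integrable.mul_bdd (h5.sub hw) hψt.aestronglyMeasurable (Eventually.of_forall fun x => hC _)
  have h7 : IntegrableOn (fun x => w x * ψ (t, x)) (Ioo 0 ℓ₀) :=
    Integrable.mul_bdd hw hψt.aestronglyMeasurable (Eventually.of_forall fun x => hC _)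
  rw [← integral_add h6 h7]
  exact integral_congr_ae (Eventually.of_forall fun x => by ring)

theorem tendsto_slice_position (hδ : 0 < δ) {ψ : ℝ × ℝ → ℝ}
    (hv : IntegrableOn v (Ioo 0 δ ×ˢ Ioo 0 ℓ₀)) (hv₀ : IntegrableOn v₀ (Ioo 0 ℓ₀))
    (hψ : Continuous ψ) (hψc : HasCompactSupport ψ)
    (hlim : Tendsto (fun t : ℝ => eLpNorm (fun x => v (t, x) - v₀ x) 2
      (volume.restrict (Ioo 0 ℓ₀))) essZeroPlus (𝓝 0)) :
    Tendsto (fun t => ∫ x in Ioo 0 ℓ₀, v (t, x) * ψ (t, x)) essZeroPlus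
      (𝓝 (∫ x in Ioo 0 ℓ₀, v₀ x * ψ (0, x))) := by
  refine tendsto_slice_of_enorm hδ hv hv₀ hψ hψc ?_
  obtain ⟨C, hC⟩ := hψ.bounded_above_of_compact_support hψc
  set A : ℝ≥0∞ := (volume.restrict (Ioo 0 ℓ₀)) univ ^
    (1 / (1 : ℝ≥0∞).toReal - 1 / (2 : ℝ≥0∞).toReal) with hA
  have hAtop : A ≠ ⊤ := by
    refine ENNReal.rpow_ne_top_of_nonneg (by norm_num) ?_
    simp
  have h1 := ENNReal.Tendsto.mul_const (b := A * ENNReal.ofReal C) hlim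
    (Or.inr (ENNReal.mul_ne_top hAtop ENNReal.ofReal_ne_top))
  rw [zero_mul] at h1
  refine tendsto_of_tendsto_of_tendsto_of_le_of_le' tendsto_const_nhds h1
    (Eventually.of_forall fun _ => zero_le) ?_
  have h4 : ∀ᵐ t : ℝ, t ∈ Ioo 0 δ → IntegrableOn (fun x => v (t, x)) (Ioo 0 ℓ₀) := by
    rw [IntegrableOn, Measure.volume_eq_prod, ← Measure.prod_restrict] at hv
    exact (ae_restrict_iff' measurableSet_Ioo).1 hv.prod_right_ae
  filter_upwards [eventually_essZeroPlus (Ioo_mem_nhdsGT hδ) h4] with t ht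
  have h5 := eLpNorm_le_eLpNorm_mul_rpow_measure_univ (p := 1) (q := 2) one_le_two
    (((ht.2 ht.1).sub hv₀).aestronglyMeasurable)
  rw [eLpNorm_one_eq_lintegral_enorm] at h5
  calc ‖∫ x in Ioo 0 ℓ₀, (v (t, x) - v₀ x) * ψ (t, x)‖ₑ
      ≤ ∫⁻ x in Ioo 0 ℓ₀, ‖(v (t, x) - v₀ x) * ψ (t, x)‖ₑ := enorm_integral_le_lintegral_enorm _
    _ ≤ ∫⁻ x in Ioo 0 ℓ₀, ‖v (t, x) - v₀ x‖ₑ * ENNReal.ofReal C := by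
        refine lintegral_mono fun x => ?_
        rw [enorm_mul]
        gcongr
        rw [← ofReal_norm]
        exact ENNReal.ofReal_le_ofReal (hC _)
    _ = (∫⁻ x in Ioo 0 ℓ₀, ‖v (t, x) - v₀ x‖ₑ) * ENNReal.ofReal C :=
        lintegral_mul_const' _ _ ENNReal.ofReal_ne_top
    _ ≤ eLpNorm (fun x => v (t, x) - v₀ x) 2 (volume.restrict (Ioo 0 ℓ₀)) * A
          * ENNReal.ofReal C := by gcongr; exact h5
    _ = _ := mul_assoc _ _ _

theorem enorm_integral_le_negSobolevNorm {f η : ℝ → ℝ} (hη : ContDiff ℝ ∞ η)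
    (hc : HasCompactSupport η) (hη0 : tsupport η ⊆ Ioo 0 ℓ₀) {C : ℝ} (hC : 0 < C)
    (hCη : ∫ x in Ioo 0 ℓ₀, (η x ^ 2 + deriv η x ^ 2) ≤ C ^ 2) :
    ‖∫ x in Ioo 0 ℓ₀, f x * η x‖ₑ ≤ ENNReal.ofReal C * negSobolevNorm 0 ℓ₀ f := by
  let ζ : TestFunction (interval 0 ℓ₀) ℝ ⊤ :=
    ⟨fun x => C⁻¹ * η x, contDiff_const.mul hη, hc.mul_left,
      (tsupport_mul_subset_right (f := fun _ => C⁻¹)).trans hη0⟩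
  have hζ : ∀ x, ζ x = C⁻¹ * η x := fun x => rfl
  have hζd : ∀ x, deriv ζ x = C⁻¹ * deriv η x := fun x => by
    change deriv (fun x => C⁻¹ * η x) x = _
    exact deriv_const_mul _ (hη.differentiable (by simp) x)
  have h1 : ∫ x in Ioo 0 ℓ₀, ((ζ x) ^ 2 + (deriv ζ x) ^ 2) ≤ 1 := by
    have : ∀ x, (ζ x) ^ 2 + (deriv ζ x) ^ 2 = (C ^ 2)⁻¹ * (η x ^ 2 + deriv η x ^ 2) := fun x => by
      rw [hζ, hζd]; field_simp
    simp only [this, integral_const_mul]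
    rw [inv_mul_le_iff₀ (by positivity), mul_one]
    exact hCη
  have h2 : ‖∫ x in Ioo 0 ℓ₀, f x * ζ x‖ₑ ≤ negSobolevNorm 0 ℓ₀ f :=
    le_iSup₂ (f := fun (η : TestFunction (interval 0 ℓ₀) ℝ ⊤)
      (_ : ∫ x in Ioo 0 ℓ₀, ((η x) ^ 2 + (deriv η x) ^ 2) ≤ 1) =>
        ‖∫ x in Ioo 0 ℓ₀, f x * η x‖ₑ) ζ h1
  have h3 : ∫ x in Ioo 0 ℓ₀, f x * η x = C * ∫ x in Ioo 0 ℓ₀, f x * ζ x := by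
    rw [← integral_const_mul]
    refine integral_congr_ae (Eventually.of_forall fun x => ?_)
    simp only [hζ]; field_simp
  rw [h3, enorm_mul, Real.enorm_of_nonneg hC.le]
  gcongr

theorem tendsto_slice_velocity (hδ : 0 < δ) (hφ : ContDiff ℝ ∞ φ) (hφc : HasCompactSupport φ)
    (hφs : tsupport φ ⊆ Iio δ ×ˢ Ioo 0 ℓ₀)
    (hvt : IntegrableOn vt (Ioo 0 δ ×ˢ Ioo 0 ℓ₀)) (hv₁ : IntegrableOn v₁ (Ioo 0 ℓ₀))
    (hlim : Tendsto (fun t : ℝ => negSobolevNorm 0 ℓ₀ (fun x => vt (t, x) - v₁ x))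
      essZeroPlus (𝓝 0)) :
    Tendsto (fun t => ∫ x in Ioo 0 ℓ₀, vt (t, x) * φ (t, x)) essZeroPlus
      (𝓝 (∫ x in Ioo 0 ℓ₀, v₁ x * φ (0, x))) := by
  refine tendsto_slice_of_enorm hδ hvt hv₁ hφ.continuous hφc ?_
  obtain ⟨A, hA⟩ := hφ.continuous.bounded_above_of_compact_support hφc
  obtain ⟨B, hB⟩ := (contDiff_fderiv_apply hφ (0, 1)).continuous.bounded_above_of_compact_support
    (hasCompactSupport_fderiv_apply hφc (0, 1))
  -- C bounds the squared H¹ norm of every slice φ(t, ·); the summand 1 gives C ≤ C², so C also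
  -- bounds the norm itself. The bound must be uniform because the test function moves with t.
  set C : ℝ := 1 + (A ^ 2 + B ^ 2) * |ℓ₀| with hC
  have hC1 : 1 ≤ C := by
    have : 0 ≤ (A ^ 2 + B ^ 2) * |ℓ₀| := by positivity
    linarith
  have h1 := ENNReal.Tendsto.const_mul (a := ENNReal.ofReal C) hlim (Or.inr ENNReal.ofReal_ne_top)
  rw [mul_zero] at h1
  refine tendsto_of_tendsto_of_tendsto_of_le_of_le tendsto_const_nhds h1
    (fun _ => zero_le) fun t => ?_
  set η : ℝ → ℝ := fun x => φ (t, x) with hη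
  have hηs : ContDiff ℝ ∞ η := hφ.comp (contDiff_const.prodMk contDiff_id)
  have hηt : tsupport η ⊆ (fun x => (t, x)) ⁻¹' tsupport φ :=
    tsupport_comp_subset_preimage φ (f := fun x : ℝ => (t, x)) (by fun_prop)
  have hηc : HasCompactSupport η := by
    refine HasCompactSupport.of_support_subset_isCompact (hφc.isCompact.image continuous_snd) ?_
    exact fun x hx => ⟨(t, x), subset_tsupport _ hx, rfl⟩
  have hηd : ∀ x, deriv η x = fderiv ℝ φ (t, x) (0, 1) := fun x =>
    ((hφ.differentiable (by simp) (t, x)).hasFDerivAt.comp_hasDerivAt x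
      ((hasDerivAt_const x t).prodMk (hasDerivAt_id x))).deriv
  refine enorm_integral_le_negSobolevNorm hηs hηc (fun x hx => (hφs (hηt hx)).2)
    (by linarith) ?_
  have h2 : ∫ x in Ioo 0 ℓ₀, (η x ^ 2 + deriv η x ^ 2) ≤ ∫ _ in Ioo 0 ℓ₀, (A ^ 2 + B ^ 2) := by
    refine integral_mono_of_nonneg (Eventually.of_forall fun x => by positivity)
      (integrable_const _) (Eventually.of_forall fun x => ?_)
    have e1 := hA (t, x)
    have e2 := hB (t, x)
    rw [Real.norm_eq_abs] at e1 e2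
    have e3 := sq_le_sq' (by linarith [abs_le.1 e1]) (abs_le.1 e1).2
    have e4 := sq_le_sq' (by linarith [abs_le.1 e2]) (abs_le.1 e2).2
    simp only [hηd]
    change φ (t, x) ^ 2 + _ ≤ _
    linarith
  refine h2.trans ?_
  rw [setIntegral_const, smul_eq_mul, Measure.real, Real.volume_Ioo, sub_zero]
  have e5 : (ENNReal.ofReal ℓ₀).toReal ≤ |ℓ₀| := by
    rw [ENNReal.toReal_ofReal']; exact max_le (le_abs_self _) (abs_nonneg _)
  have e6 := mul_le_mul_of_nonneg_right e5 (show 0 ≤ A ^ 2 + B ^ 2 by positivity)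
  nlinarith

theorem fderiv_cutoff_mul {a : ℝ → ℝ} (ha : ContDiff ℝ ∞ a) (hφ : ContDiff ℝ ∞ φ) (p e : ℝ × ℝ) :
    fderiv ℝ (fun q : ℝ × ℝ => a q.1 * φ q) p e
      = deriv a p.1 * e.1 * φ p + a p.1 * fderiv ℝ φ p e := by
  have h1 : HasFDerivAt (fun q : ℝ × ℝ => a q.1) _ p :=
    ((ha.differentiable (by simp) p.1).hasDerivAt).hasFDerivAt.comp p hasFDerivAt_fst
  have h3 : HasFDerivAt (fun q : ℝ × ℝ => a q.1 * φ q) _ p :=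
    h1.mul (hφ.differentiable (by simp) p).hasFDerivAt
  rw [h3.fderiv]
  simp
  ring

theorem contDiff_fst_mul {a : ℝ → ℝ} (ha : ContDiff ℝ ∞ a) (hφ : ContDiff ℝ ∞ φ) :
    ContDiff ℝ ∞ fun q : ℝ × ℝ => a q.1 * φ q := (ha.comp contDiff_fst).mul hφ

/-- The product rule is arranged so that a'' occurs only inside ∂_t(a'φ), which the weak time
derivative transfers to v; no second derivative of the cutoff has to be estimated. -/
theorem box_cutoff_mul {a : ℝ → ℝ} (ha : ContDiff ℝ ∞ a) (hφ : ContDiff ℝ ∞ φ) (p : ℝ × ℝ) :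
    box (fun q : ℝ × ℝ => a q.1 * φ q) p
      = a p.1 * box φ p + deriv a p.1 * fderiv ℝ φ p (1, 0)
        + fderiv ℝ (fun q : ℝ × ℝ => deriv a q.1 * φ q) p (1, 0) := by
  have ha' := contDiff_deriv_top ha
  have e1 : (fun q => fderiv ℝ (fun q : ℝ × ℝ => a q.1 * φ q) q (1, 0))
      = (fun q : ℝ × ℝ => deriv a q.1 * φ q) + fun q => a q.1 * fderiv ℝ φ q (1, 0) := by
    ext q; simp [fderiv_cutoff_mul ha hφ]
  have e2 : (fun q => fderiv ℝ (fun q : ℝ × ℝ => a q.1 * φ q) q (0, 1))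
      = fun q => a q.1 * fderiv ℝ φ q (0, 1) := by
    ext q; simp [fderiv_cutoff_mul ha hφ]
  simp only [box, e1, e2]
  rw [fderiv_add ((contDiff_fst_mul ha' hφ).differentiable (by simp) p)
    ((contDiff_fst_mul ha (contDiff_fderiv_apply hφ _)).differentiable (by simp) p),
    _root_.add_apply, fderiv_cutoff_mul ha (contDiff_fderiv_apply hφ _),
    fderiv_cutoff_mul ha (contDiff_fderiv_apply hφ _)]
  ring

/-- A distributional solution of the wave equation that attains its initial values is a weak
solution of the Cauchy problem near the initial line. -/
theorem weakCauchy_of_isSolution (h : IsFront ℓ₀ ℓ) (hℓ₀ : 0 < ℓ₀) {ν : ℝ}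
    (hv₀ : IntegrableOn v₀ (Ioo 0 ℓ₀)) (hv₁ : IntegrableOn v₁ (Ioo 0 ℓ₀))
    (hwave : SolvesWaveEq (openOmega' ℓ₀ ℓ) ν v)
    (hd : HasWeakDeriv (openOmega' ℓ₀ ℓ) (1, 0) v vt)
    (hv : IntegrableOn v (Ioo 0 (ℓ₀ / 2) ×ˢ Ioo 0 ℓ₀))
    (hvt : IntegrableOn vt (Ioo 0 (ℓ₀ / 2) ×ˢ Ioo 0 ℓ₀))
    (hpos : Tendsto (fun t : ℝ => eLpNorm (fun x => v (t, x) - v₀ x) 2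
      (volume.restrict (Ioo 0 ℓ₀))) essZeroPlus (𝓝 0))
    (hvel : Tendsto (fun t : ℝ => negSobolevNorm 0 ℓ₀ (fun x => vt (t, x) - v₁ x))
      essZeroPlus (𝓝 0)) :
    WeakCauchy ℓ₀ v₀ v₁ v (fun p => ν ^ 2 / 4 * v p) := by
  intro φ hφ hφc hφs
  set δ := ℓ₀ / 2 with hδ
  have hδ0 : 0 < δ := half_pos hℓ₀
  set S : Set (ℝ × ℝ) := Ioo 0 δ ×ˢ Ioo 0 ℓ₀ with hS
  have hSm : MeasurableSet S := measurableSet_Ioo.prod measurableSet_Ioo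
  have hφ' := contDiff_fderiv_apply hφ (1, 0)
  have hφ'c := hasCompactSupport_fderiv_apply hφc (1, 0)
  have hψ : Continuous fun p => box φ p - ν ^ 2 / 4 * φ p :=
    (contDiff_box hφ).continuous.sub (continuous_const.mul hφ.continuous)
  have hψc : HasCompactSupport fun p => box φ p - ν ^ 2 / 4 * φ p :=
    (hasCompactSupport_box hφc).sub hφc.mul_left
  have iψ := integrableOn_strip_mul hv hψ hψc
  have hSpos : S ⊆ {p : ℝ × ℝ | 0 < p.1} := fun p hp => hp.1.1
  have l1 : Tendsto (fun r => ∫ p in S, cutoff r p.1 * (v p * (box φ p - ν ^ 2 / 4 * φ p)))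
      (𝓝[>] 0) (𝓝 (∫ p in S, v p * (box φ p - ν ^ 2 / 4 * φ p))) := by
    have hms : MeasurableSet {p : ℝ × ℝ | 0 < p.1} := measurableSet_lt (by fun_prop) (by fun_prop)
    have e : (volume.restrict S).restrict {p : ℝ × ℝ | 0 < p.1} = volume.restrict S := by
      rw [Measure.restrict_restrict hms, inter_eq_right.2 hSpos]
    have := tendsto_integral_cutoff (μ := volume.restrict S)
      (f := fun p => v p * (box φ p - ν ^ 2 / 4 * φ p)) (by rw [e]; exact iψ)
    rwa [e] at this
  have i2 := integrableOn_strip_mul hv hφ'.continuous hφ'c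
  have i3 := integrableOn_strip_mul hvt hφ.continuous hφc
  have slice : ∀ f : ℝ × ℝ → ℝ, IntegrableOn f S →
      IntegrableOn (fun t => ∫ x in Ioo 0 ℓ₀, f (t, x)) (Ioo 0 δ) := fun f hf => by
    rw [IntegrableOn, hS, Measure.volume_eq_prod, ← Measure.prod_restrict] at hf
    exact hf.integral_prod_left
  have fub : ∀ f : ℝ × ℝ → ℝ, IntegrableOn f S → ∀ r > 0,
      IntegrableOn (fun p => deriv (cutoff r) p.1 * f p) S ∧
      ∫ p in S, deriv (cutoff r) p.1 * f p
        = ∫ t in Ioo 0 δ, deriv (cutoff r) t * ∫ x in Ioo 0 ℓ₀, f (t, x) := fun f hf r hr => by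
    obtain ⟨C, hC⟩ := (continuous_deriv_cutoff r).bounded_above_of_compact_support
      (hasCompactSupport_deriv_cutoff hr)
    have hi : IntegrableOn (fun p : ℝ × ℝ => deriv (cutoff r) p.1 * f p) S :=
      Integrable.bdd_mul hf ((continuous_deriv_cutoff r).comp continuous_fst).aestronglyMeasurable
        (Eventually.of_forall fun p => hC p.1)
    refine ⟨hi, ?_⟩
    rw [hS, Measure.volume_eq_prod] at hi ⊢
    rw [setIntegral_prod _ hi]
    simp only [integral_const_mul]
  have l2 := tendsto_integral_deriv_cutoff hδ0
    (tendsto_slice_position hδ0 hv hv₀ hφ'.continuous hφ'c hpos) (slice _ i2)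
  have l3 := tendsto_integral_deriv_cutoff hδ0
    (tendsto_slice_velocity hδ0 hφ hφc hφs hvt hv₁ hvel) (slice _ i3)
  -- The equation tested with the cutoff times φ, which vanishes near t = 0. As r → 0 the terms with
  -- the derivative of the cutoff concentrate on the initial line and produce the data.
  have key : ∀ r > 0,
      (∫ p in S, cutoff r p.1 * (v p * (box φ p - ν ^ 2 / 4 * φ p)))
      + (∫ t in Ioo 0 δ, deriv (cutoff r) t * ∫ x in Ioo 0 ℓ₀, v (t, x) * fderiv ℝ φ (t, x) (1, 0))
      - (∫ t in Ioo 0 δ, deriv (cutoff r) t * ∫ x in Ioo 0 ℓ₀, vt (t, x) * φ (t, x)) = 0 := by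
    intro r hr
    have hθ := contDiff_cutoff r
    have hθ' := contDiff_deriv_top hθ
    have hsub : ∀ {a : ℝ → ℝ}, tsupport a ⊆ Ici r →
        tsupport (fun q : ℝ × ℝ => a q.1 * φ q) ⊆ S := fun {a} ha p hp => by
      have h1 : p.1 ∈ tsupport a :=
        tsupport_comp_subset_preimage a (f := fun q : ℝ × ℝ => q.1) continuous_fst
          (tsupport_mul_subset_left hp)
      have h2 := hφs (tsupport_mul_subset_right hp)
      exact mem_strip h2 (hr.trans_le (ha h1))
    have s1 := hsub (tsupport_cutoff_subset hr)
    have s2 := hsub (tsupport_deriv_subset.trans (tsupport_cutoff_subset hr))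
    have c1 : HasCompactSupport fun q : ℝ × ℝ => cutoff r q.1 * φ q := hφc.mul_left
    have c2 : HasCompactSupport fun q : ℝ × ℝ => deriv (cutoff r) q.1 * φ q := hφc.mul_left
    have hw := hwave.integral_eq (contDiff_fst_mul hθ hφ) c1
      (by rw [h.coe_openOmega' hℓ₀]; exact s1.trans h.strip_subset)
    have hwd := hd.integral_eq (contDiff_fst_mul hθ' hφ) c2
      (by rw [h.coe_openOmega' hℓ₀]; exact s2.trans h.strip_subset)
    rw [h.coe_openOmega' hℓ₀] at hw hwd
    rw [setIntegral_punctured_eq_strip h] at hw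
    swap
    · intro p _ hp
      have e1 : box (fun q : ℝ × ℝ => cutoff r q.1 * φ q) p = 0 :=
        image_eq_zero_of_notMem_tsupport fun hp' => hp (s1 (tsupport_box_subset hp'))
      have e2 : cutoff r p.1 * φ p = 0 :=
        image_eq_zero_of_notMem_tsupport (f := fun q : ℝ × ℝ => cutoff r q.1 * φ q)
          fun hp' => hp (s1 hp')
      rw [e1, e2]; ring
    rw [setIntegral_punctured_eq_strip h, setIntegral_punctured_eq_strip h] at hwd
    rotate_left
    · intro p _ hp
      rw [image_eq_zero_of_notMem_tsupport (f := fun q : ℝ × ℝ => deriv (cutoff r) q.1 * φ q)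
          fun hp' => hp (s2 hp'), mul_zero]
    · intro p _ hp
      rw [fderiv_of_notMem_tsupport ℝ fun hp' => hp (s2 hp')]; simp
    have i1 : IntegrableOn (fun p => cutoff r p.1 * (v p * (box φ p - ν ^ 2 / 4 * φ p))) S := by
      refine Integrable.bdd_mul (c := 1) iψ
        (hθ.continuous.comp continuous_fst).aestronglyMeasurable (Eventually.of_forall fun p => ?_)
      rw [Real.norm_of_nonneg (cutoff_nonneg _ _)]
      exact cutoff_le_one _ _
    have i4 : IntegrableOn (fun p => v p *
        fderiv ℝ (fun q : ℝ × ℝ => deriv (cutoff r) q.1 * φ q) p (1, 0)) S :=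
      integrableOn_strip_mul hv
        (contDiff_fderiv_apply (contDiff_fst_mul hθ' hφ) (1, 0)).continuous
        (hasCompactSupport_fderiv_apply c2 _)
    have e3 : ∫ p in S, v p * (box (fun q : ℝ × ℝ => cutoff r q.1 * φ q) p
          - ν ^ 2 / 4 * (cutoff r p.1 * φ p))
        = (∫ p in S, cutoff r p.1 * (v p * (box φ p - ν ^ 2 / 4 * φ p)))
          + (∫ p in S, deriv (cutoff r) p.1 * (v p * fderiv ℝ φ p (1, 0)))
          + ∫ p in S, v p * fderiv ℝ (fun q : ℝ × ℝ => deriv (cutoff r) q.1 * φ q) p (1, 0) := by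
      have i5 : IntegrableOn (fun p => cutoff r p.1 * (v p * (box φ p - ν ^ 2 / 4 * φ p))
          + deriv (cutoff r) p.1 * (v p * fderiv ℝ φ p (1, 0))) S := i1.add (fub _ i2 r hr).1
      rw [← integral_add i1 (fub _ i2 r hr).1, ← integral_add i5 i4]
      refine integral_congr_ae (Eventually.of_forall fun p => ?_)
      simp only [box_cutoff_mul hθ hφ]; ring
    have e4 : ∫ p in S, vt p * (deriv (cutoff r) p.1 * φ p)
        = ∫ p in S, deriv (cutoff r) p.1 * (vt p * φ p) :=
      integral_congr_ae (Eventually.of_forall fun p => by ring)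
    rw [e3, hwd, e4, (fub _ i2 r hr).2, (fub _ i3 r hr).2] at hw
    linarith
  have l4 := (l1.add l2).sub l3
  have l5 := tendsto_nhds_unique (l4.congr' (by
    filter_upwards [self_mem_nhdsWithin] with r hr
    exact key r hr)) tendsto_const_nhds
  have i6 := integrableOn_strip_mul hv (contDiff_box hφ).continuous (hasCompactSupport_box hφc)
  have i7 := integrableOn_strip_mul hv hφ.continuous hφc
  have e6 : ∫ p in S, v p * (box φ p - ν ^ 2 / 4 * φ p)
      = (∫ p in S, v p * box φ p) - ∫ p in S, ν ^ 2 / 4 * v p * φ p := by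
    simp only [mul_assoc (ν ^ 2 / 4)]
    rw [← integral_sub i6 (i7.const_mul _)]
    exact integral_congr_ae (Eventually.of_forall fun p => by ring)
  rw [e6] at l5
  linarith

theorem _root_.MeasureTheory.LocallyIntegrableOn.integrableOn_mul {U : Set (ℝ × ℝ)}
    {w g : ℝ × ℝ → ℝ} (hw : LocallyIntegrableOn w U) (hg : Continuous g) (hc : HasCompactSupport g)
    (hU : tsupport g ⊆ U) : IntegrableOn (fun p => w p * g p) U := by
  obtain ⟨C, hC⟩ := hg.bounded_above_of_compact_support hc
  have h1 : IntegrableOn (fun p => w p * g p) (tsupport g) :=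
    Integrable.mul_bdd (hw.integrableOn_compact_subset hU hc.isCompact)
      hg.aestronglyMeasurable (Eventually.of_forall hC)
  refine (h1.integrable_of_forall_notMem_eq_zero fun p hp => ?_).integrableOn
  rw [image_eq_zero_of_notMem_tsupport hp, mul_zero]

/-- The time derivative in the initial condition of `IsSolution` need not be the one of
`MemHTilde1`, and only the latter is known to be in L². Uniqueness up to null sets lets one replace
the other. -/
theorem HasWeakDeriv.ae_eq {U : Opens (ℝ × ℝ)} {e : ℝ × ℝ} {f g g' : ℝ × ℝ → ℝ}
    (hg : HasWeakDeriv U e f g) (hg' : HasWeakDeriv U e f g') :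
    ∀ᵐ p, p ∈ (U : Set (ℝ × ℝ)) → g p = g' p := by
  have key := U.isOpen.ae_eq_zero_of_integral_contDiff_smul_eq_zero
    (hg.2.1.sub hg'.2.1) fun φ hφ hc hU => ?_
  · filter_upwards [key] with p hp hpU
    exact sub_eq_zero.1 (hp hpU)
  have h1 := hg.integral_eq hφ hc hU
  have h2 := hg'.integral_eq hφ hc hU
  rw [h1, neg_inj] at h2
  rw [← setIntegral_eq_integral_of_forall_compl_eq_zero (s := (U : Set (ℝ × ℝ))) fun p hp => by
    rw [image_eq_zero_of_notMem_tsupport fun hp' => hp (hU hp'), zero_smul]]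
  have h3 : ∀ p, φ p • ((g - g') p) = g p * φ p - g' p * φ p := fun p => by
    simp only [smul_eq_mul, Pi.sub_apply]; ring
  simp only [h3]
  rw [integral_sub (hg.2.1.integrableOn_mul hφ.continuous hc hU)
    (hg'.2.1.integrableOn_mul hφ.continuous hc hU), h2, sub_self]

theorem negSobolevNorm_congr {f g : ℝ → ℝ} (hfg : f =ᵐ[volume.restrict (Ioo 0 ℓ₀)] g) :
    negSobolevNorm 0 ℓ₀ f = negSobolevNorm 0 ℓ₀ g := by
  unfold negSobolevNorm
  refine iSup_congr fun η => iSup_congr fun _ => ?_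
  congr 1
  refine integral_congr_ae ?_
  filter_upwards [hfg] with x hx
  rw [hx]

theorem tendsto_negSobolevNorm_congr (h : IsFront ℓ₀ ℓ) (hℓ₀ : 0 < ℓ₀) {vt' : ℝ × ℝ → ℝ}
    (hd : HasWeakDeriv (openOmega' ℓ₀ ℓ) (1, 0) v vt)
    (hd' : HasWeakDeriv (openOmega' ℓ₀ ℓ) (1, 0) v vt')
    (hlim : Tendsto (fun t : ℝ => negSobolevNorm 0 ℓ₀ (fun x => vt' (t, x) - v₁ x))
      essZeroPlus (𝓝 0)) :
    Tendsto (fun t : ℝ => negSobolevNorm 0 ℓ₀ (fun x => vt (t, x) - v₁ x))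
      essZeroPlus (𝓝 0) := by
  refine hlim.congr' ?_
  have h1 := hd'.ae_eq hd
  rw [h.coe_openOmega' hℓ₀] at h1
  have h2 : ∀ᵐ t : ℝ, ∀ᵐ x : ℝ, (t, x) ∈ punctured ℓ₀ ℓ → vt' (t, x) = vt (t, x) :=
    Measure.ae_ae_of_ae_prod h1
  filter_upwards [eventually_essZeroPlus (Ioo_mem_nhdsGT (half_pos hℓ₀)) h2] with t ht
  refine negSobolevNorm_congr ?_
  filter_upwards [ae_restrict_of_ae ht.2, ae_restrict_mem measurableSet_Ioo] with x hx hx'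
  rw [hx (h.strip_subset ⟨ht.1, hx'⟩)]

end Cutoff

/-! ### The parallelogram identity for integrable solutions of ∂ₐ∂ᵦ G = 0. -/

section Mollify

open scoped ContDiff

variable {G : ℝ × ℝ → ℝ} {φ : ℝ × ℝ → ℝ}

theorem integral_deriv_cutoff_univ {h : ℝ} (hh : 0 < h) (a : ℝ) :
    ∫ x, deriv (cutoff h) (x - a) = 1 := by
  rw [integral_sub_right_eq_self (fun x => deriv (cutoff h) x) a,
    ← integral_deriv_cutoff hh (show 2 * h < 3 * h by linarith)]
  refine (setIntegral_eq_integral_of_forall_compl_eq_zero fun x hx => ?_).symm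
  rw [mem_Ioo, not_and_or, not_lt, not_lt] at hx
  rcases hx with hx | hx
  · exact deriv_cutoff_of_lt hh (by linarith)
  · exact deriv_cutoff_of_gt hh (by linarith)

theorem exists_deriv_cutoff_le : ∃ C : ℝ, 0 ≤ C ∧ ∀ h > 0, ∀ t, deriv (cutoff h) t ≤ C / h := by
  obtain ⟨C, hC⟩ := (continuous_deriv_cutoff 1).bounded_above_of_compact_support
    (hasCompactSupport_deriv_cutoff one_pos)
  refine ⟨C, (norm_nonneg _).trans (hC 0), fun h hh t => ?_⟩
  have e1 : deriv (cutoff h) t = deriv (cutoff 1) (t / h) / h := by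
    have h1 : cutoff h = fun t => cutoff 1 (t / h) := by ext t; simp [cutoff]
    have h2 : HasDerivAt (fun t => cutoff 1 (t / h)) (deriv (cutoff 1) (t / h) * (1 / h)) t :=
      ((contDiff_cutoff 1).differentiable (by simp) _).hasDerivAt.comp t
        ((hasDerivAt_id t).div_const h)
    rw [h1, h2.deriv, mul_one_div]
  rw [e1]
  exact div_le_div_of_nonneg_right ((le_abs_self _).trans (hC _)) hh.le

/-- The average of `G` near `q` against a product of smooth kernels. -/
noncomputable def mollify (G : ℝ × ℝ → ℝ) (h : ℝ) (q : ℝ × ℝ) : ℝ :=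
  ∫ y : ℝ × ℝ, G y * (deriv (cutoff h) (y.1 - q.1) * deriv (cutoff h) (y.2 - q.2))

theorem mollifier_eq_zero {h : ℝ} (hh : 0 < h) {q y : ℝ × ℝ}
    (hy : y ∉ Metric.closedBall q (2 * h)) :
    deriv (cutoff h) (y.1 - q.1) * deriv (cutoff h) (y.2 - q.2) = 0 := by
  by_contra hne
  have key : ∀ s, deriv (cutoff h) s ≠ 0 → |s| ≤ 2 * h := fun s hs => by
    rw [abs_le]
    constructor <;> by_contra! hlt
    · exact hs (deriv_cutoff_of_lt hh (by linarith))
    · exact hs (deriv_cutoff_of_gt hh hlt)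
  refine hy ?_
  rw [Metric.mem_closedBall, Prod.dist_eq, Real.dist_eq, Real.dist_eq]
  exact max_le (key _ (left_ne_zero_of_mul hne)) (key _ (right_ne_zero_of_mul hne))

theorem continuous_mollifier (h : ℝ) (q : ℝ × ℝ) : Continuous fun y : ℝ × ℝ =>
    deriv (cutoff h) (y.1 - q.1) * deriv (cutoff h) (y.2 - q.2) := by
  have := continuous_deriv_cutoff h
  fun_prop

theorem hasCompactSupport_mollifier {h : ℝ} (hh : 0 < h) (q : ℝ × ℝ) :
    HasCompactSupport fun y : ℝ × ℝ =>
      deriv (cutoff h) (y.1 - q.1) * deriv (cutoff h) (y.2 - q.2) :=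
  HasCompactSupport.of_support_subset_isCompact (isCompact_closedBall q (2 * h)) fun y hy => by
    by_contra hy'
    exact hy (mollifier_eq_zero hh hy')

theorem integrable_mul_mollifier (hG : LocallyIntegrable G) {h : ℝ} (hh : 0 < h) (q : ℝ × ℝ) :
    Integrable fun y : ℝ × ℝ =>
      G y * (deriv (cutoff h) (y.1 - q.1) * deriv (cutoff h) (y.2 - q.2)) := by
  have := hG.integrable_smul_right_of_hasCompactSupport (continuous_mollifier h q)
    (hasCompactSupport_mollifier hh q)
  simpa only [smul_eq_mul] using this

/-- Convergence holds at Lebesgue points: the kernel has mass one, is at most C²/h², and is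
supported in the sup-norm ball of radius 2h, of area 16h², so the error is at most 16C² times the
mean oscillation. -/
theorem ae_tendsto_mollify (hG : LocallyIntegrable G) :
    ∀ᵐ q, Tendsto (fun h => mollify G h q) (𝓝[>] 0) (𝓝 (G q)) := by
  obtain ⟨C, hC0, hC⟩ := exists_deriv_cutoff_le
  filter_upwards [IsUnifLocDoublingMeasure.ae_tendsto_average_norm_sub volume hG 1] with q hq
  have hδ : Tendsto (fun h : ℝ => 2 * h) (𝓝[>] 0) (𝓝[>] 0) := by
    refine tendsto_nhdsWithin_iff.2 ⟨?_, ?_⟩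
    · exact ((continuous_const.mul continuous_id).tendsto' 0 0 (by simp)).mono_left
        nhdsWithin_le_nhds
    · filter_upwards [self_mem_nhdsWithin] with h hh
      exact mul_pos two_pos (show 0 < h from hh)
  have h1 := hq (fun _ => q) (fun h : ℝ => 2 * h) hδ (by
    filter_upwards [self_mem_nhdsWithin] with h hh
    exact Metric.mem_closedBall_self (by have : 0 < h := hh; positivity))
  have h2 := h1.const_mul (16 * C ^ 2)
  rw [mul_zero] at h2
  rw [tendsto_iff_norm_sub_tendsto_zero]
  refine tendsto_of_tendsto_of_tendsto_of_le_of_le' tendsto_const_nhds h2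
    (Eventually.of_forall fun _ => norm_nonneg _) ?_
  filter_upwards [self_mem_nhdsWithin] with h hh
  have hh : 0 < h := hh
  set k : ℝ × ℝ → ℝ := fun y => deriv (cutoff h) (y.1 - q.1) * deriv (cutoff h) (y.2 - q.2) with hk
  have hki : Integrable k :=
    (continuous_mollifier h q).integrable_of_hasCompactSupport (hasCompactSupport_mollifier hh q)
  have hk1 : ∫ y, k y = 1 := by
    have := integral_prod_mul (μ := volume) (ν := volume) (fun x => deriv (cutoff h) (x - q.1))
      (fun x => deriv (cutoff h) (x - q.2))
    rw [integral_deriv_cutoff_univ hh, integral_deriv_cutoff_univ hh, one_mul] at this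
    exact this
  have hk0 : ∀ y, 0 ≤ k y := fun y =>
    mul_nonneg (deriv_cutoff_nonneg hh _) (deriv_cutoff_nonneg hh _)
  have hkC : ∀ y, k y ≤ C ^ 2 / h ^ 2 := fun y => by
    have := mul_le_mul (hC h hh (y.1 - q.1)) (hC h hh (y.2 - q.2)) (deriv_cutoff_nonneg hh _)
      (by positivity)
    calc k y ≤ C / h * (C / h) := this
      _ = _ := by ring
  have e1 : mollify G h q - G q = ∫ y in Metric.closedBall q (2 * h), (G y - G q) * k y := by
    rw [setIntegral_eq_integral_of_forall_compl_eq_zero fun y hy => by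
      rw [hk]; simp only [mollifier_eq_zero hh hy, mul_zero]]
    simp only [sub_mul]
    rw [integral_sub (integrable_mul_mollifier hG hh q) (hki.const_mul _), integral_const_mul, hk1,
      mul_one]
    rfl
  have hGi : IntegrableOn (fun y => ‖G y - G q‖) (Metric.closedBall q (2 * h)) :=
    ((hG.integrableOn_isCompact (isCompact_closedBall q _)).sub
      (integrableOn_const (isCompact_closedBall q _).measure_lt_top.ne)).norm
  have hvol : volume.real (Metric.closedBall q (2 * h)) = 16 * h ^ 2 := by
    rw [← Prod.mk.eta (p := q), ← closedBall_prod_same, Measure.volume_eq_prod,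
      measureReal_prod_prod, Real.volume_real_closedBall (by positivity),
      Real.volume_real_closedBall (by positivity)]
    ring
  rw [e1]
  calc ‖∫ y in Metric.closedBall q (2 * h), (G y - G q) * k y‖
      ≤ ∫ y in Metric.closedBall q (2 * h), ‖G y - G q‖ * (C ^ 2 / h ^ 2) := by
        refine norm_integral_le_of_norm_le (hGi.mul_const _) (Eventually.of_forall fun y => ?_)
        rw [norm_mul, Real.norm_of_nonneg (hk0 y)]
        exact mul_le_mul_of_nonneg_left (hkC y) (norm_nonneg _)
    _ = _ := by
        rw [integral_mul_const, setAverage_eq, hvol, smul_eq_mul]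
        field_simp

/-- Where G vanishes on an open set the limit exists at every point, so such points may serve as
vertices without being Lebesgue points. -/
theorem tendsto_mollify_zero {q : ℝ × ℝ} {O : Set (ℝ × ℝ)} (hO : O ∈ 𝓝 q)
    (hG : ∀ᵐ y, y ∈ O → G y = 0) : Tendsto (fun h => mollify G h q) (𝓝[>] 0) (𝓝 0) := by
  obtain ⟨ε, hε, hεO⟩ := Metric.mem_nhds_iff.1 hO
  refine tendsto_const_nhds.congr' ?_
  filter_upwards [Ioo_mem_nhdsGT (half_pos hε)] with h hh
  refine (integral_eq_zero_of_ae ?_).symm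
  filter_upwards [hG] with y hy
  by_cases hyO : y ∈ O
  · rw [hy hyO, zero_mul]; rfl
  · have : y ∉ Metric.closedBall q (2 * h) := fun hy' =>
      hyO (hεO (Metric.closedBall_subset_ball (by linarith [hh.2]) hy'))
    rw [mollifier_eq_zero hh.1 this, mul_zero]; rfl

/-- `G` solves `∂ₐ∂ᵦ G = 0` on `D`, tested with products. -/
def SolvesChar (D : Set (ℝ × ℝ)) (G : ℝ × ℝ → ℝ) : Prop :=
  ∀ α β : ℝ → ℝ, ContDiff ℝ ∞ α → ContDiff ℝ ∞ β → HasCompactSupport α → HasCompactSupport β →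
    tsupport α ×ˢ tsupport β ⊆ D → ∫ q, G q * prodFun (deriv α) (deriv β) q = 0

theorem cutoff_sub_cutoff {h : ℝ} (hh : 0 < h) {a b : ℝ} (hab : a ≤ b) :
    ContDiff ℝ ∞ (fun x => cutoff h (x - a) - cutoff h (x - b)) ∧
    HasCompactSupport (fun x => cutoff h (x - a) - cutoff h (x - b)) ∧
    tsupport (fun x => cutoff h (x - a) - cutoff h (x - b)) ⊆ Icc a (b + 2 * h) ∧
    deriv (fun x => cutoff h (x - a) - cutoff h (x - b))
      = fun x => deriv (cutoff h) (x - a) - deriv (cutoff h) (x - b) := by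
  have h1 : ∀ c : ℝ, ContDiff ℝ ∞ fun x => cutoff h (x - c) := fun c =>
    (contDiff_cutoff h).comp (contDiff_id.sub contDiff_const)
  have h2 : Function.support (fun x => cutoff h (x - a) - cutoff h (x - b))
      ⊆ Icc a (b + 2 * h) := by
    intro x hx
    constructor <;> by_contra! hlt
    · exact hx (by simp only [cutoff_of_le hh (show x - a ≤ h by linarith),
        cutoff_of_le hh (show x - b ≤ h by linarith), sub_self])
    · exact hx (by simp only [cutoff_of_ge hh (show 2 * h ≤ x - a by linarith),
        cutoff_of_ge hh (show 2 * h ≤ x - b by linarith), sub_self])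
  refine ⟨(h1 a).sub (h1 b), HasCompactSupport.of_support_subset_isCompact isCompact_Icc h2,
    closure_minimal h2 isClosed_Icc, funext fun x => ?_⟩
  have hd : ∀ c : ℝ, HasDerivAt (fun x => cutoff h (x - c)) (deriv (cutoff h) (x - c)) x :=
    fun c => ((contDiff_cutoff h).differentiable (by simp) (x - c)).hasDerivAt.comp_sub_const x c
  exact ((hd a).sub (hd b)).deriv

/-- A difference of translated cutoffs is a plateau whose derivative is a difference of two
translated kernels. The product of two such plateaus is thus an admissible test function producing
exactly the alternating sum of mollifications at the four vertices; for small h its support stays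
near the rectangle, inside D. -/
theorem SolvesChar.eventually_parallelogram {D : Set (ℝ × ℝ)} (hs : SolvesChar D G)
    (hG : LocallyIntegrable G) (hD : IsOpen D) {a₀ a b₀ b : ℝ} (ha : a₀ ≤ a) (hb : b₀ ≤ b)
    (hR : Icc a₀ a ×ˢ Icc b₀ b ⊆ D) :
    ∀ᶠ h in 𝓝[>] (0 : ℝ), mollify G h (a, b) - mollify G h (a, b₀) - mollify G h (a₀, b)
      + mollify G h (a₀, b₀) = 0 := by
  obtain ⟨δ, hδ, hδD⟩ := (isCompact_Icc.prod isCompact_Icc).exists_thickening_subset_open hD hR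
  filter_upwards [Ioo_mem_nhdsGT (half_pos hδ)] with h hh
  have hh0 := hh.1
  obtain ⟨hα, hαc, hαs, hαd⟩ := cutoff_sub_cutoff hh0 ha
  obtain ⟨hβ, hβc, hβs, hβd⟩ := cutoff_sub_cutoff hh0 hb
  have key := hs _ _ hα hβ hαc hβc fun p hp => hδD ?_
  swap
  · rw [Metric.mem_thickening_iff]
    have h1 := hαs hp.1
    have h2 := hβs hp.2
    refine ⟨(min p.1 a, min p.2 b), ⟨⟨le_min h1.1 ha, min_le_right _ _⟩,
      ⟨le_min h2.1 hb, min_le_right _ _⟩⟩, ?_⟩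
    have e : ∀ {s c : ℝ}, s ≤ c + 2 * h → dist s (min s c) < δ := fun {s c} hsc => by
      rw [Real.dist_eq, abs_of_nonneg (sub_nonneg.2 (min_le_left _ _))]
      rcases min_cases s c with h3 | h3 <;> linarith [hh.2]
    rw [Prod.dist_eq]
    exact max_lt (e h1.2) (e h2.2)
  rw [hαd, hβd] at key
  set f : ℝ × ℝ → ℝ × ℝ → ℝ := fun q y =>
    G y * (deriv (cutoff h) (y.1 - q.1) * deriv (cutoff h) (y.2 - q.2)) with hf
  have i : ∀ q, Integrable (f q) := fun q => integrable_mul_mollifier hG hh0 q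
  have i₁ : Integrable fun y => f (a, b) y - f (a, b₀) y := (i _).sub (i _)
  have i₂ : Integrable fun y => f (a, b) y - f (a, b₀) y - f (a₀, b) y := i₁.sub (i _)
  have e1 : ∀ q : ℝ × ℝ, G q * prodFun (fun x => deriv (cutoff h) (x - a₀) - deriv (cutoff h) (x - a))
      (fun x => deriv (cutoff h) (x - b₀) - deriv (cutoff h) (x - b)) q
      = f (a, b) q - f (a, b₀) q - f (a₀, b) q + f (a₀, b₀) q :=
    fun q => by simp only [prodFun, hf]; ring
  rw [integral_congr_ae (Eventually.of_forall e1), integral_add i₂ (i _), integral_sub i₁ (i _),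
    integral_sub (i _) (i _)] at key
  exact key

theorem SolvesChar.parallelogram {D : Set (ℝ × ℝ)} (hs : SolvesChar D G)
    (hG : LocallyIntegrable G) (hD : IsOpen D) {a₀ a b₀ b : ℝ} (ha : a₀ ≤ a) (hb : b₀ ≤ b)
    (hR : Icc a₀ a ×ˢ Icc b₀ b ⊆ D) {c₁ c₂ c₃ c₄ : ℝ}
    (h₁ : Tendsto (fun h => mollify G h (a, b)) (𝓝[>] 0) (𝓝 c₁))
    (h₂ : Tendsto (fun h => mollify G h (a, b₀)) (𝓝[>] 0) (𝓝 c₂))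
    (h₃ : Tendsto (fun h => mollify G h (a₀, b)) (𝓝[>] 0) (𝓝 c₃))
    (h₄ : Tendsto (fun h => mollify G h (a₀, b₀)) (𝓝[>] 0) (𝓝 c₄)) :
    c₁ - c₂ - c₃ + c₄ = 0 :=
  tendsto_nhds_unique ((((h₁.sub h₂).sub h₃).add h₄).congr'
    (hs.eventually_parallelogram hG hD ha hb hR)) tendsto_const_nhds

theorem box_comp_charMap (hφ : ContDiff ℝ ∞ φ) (p : ℝ × ℝ) :
    box (fun p => φ (charMap p)) p
      = 4 * fderiv ℝ (fun q => fderiv ℝ φ q (0, 1)) (charMap p) (1, 0) := by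
  have hc : ∀ {f : ℝ × ℝ → ℝ}, ContDiff ℝ ∞ f → ∀ q e, fderiv ℝ (fun p => f (charMap p)) q e
      = fderiv ℝ f (charMap q) (charMap e) := fun {f} hf q e => by
    have h1 : HasFDerivAt (fun p => f (charMap p)) _ q :=
      (hf.differentiable (by simp) (charMap q)).hasFDerivAt.comp q charMap.hasFDerivAt
    rw [h1.fderiv]; rfl
  have h2 := (box_eq (hφ.comp charMap.contDiff) p).1
  have e1 : charMap (1 / 2, 1 / 2) = (0, 1) := by ext <;> simp; norm_num
  have e2 : charMap (1 / 2, -1 / 2) = (1, 0) := by ext <;> simp <;> norm_num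
  simp only [Function.comp_def, hc hφ, e1] at h2
  rw [hc (contDiff_fderiv_apply hφ (0, 1)), e2] at h2
  rw [h2]
  ring

theorem solvesChar_of_integral_box {W : ℝ × ℝ → ℝ} {O : Set (ℝ × ℝ)}
    (hW : ∀ φ : ℝ × ℝ → ℝ, ContDiff ℝ ∞ φ → HasCompactSupport φ → tsupport φ ⊆ O →
      ∫ p, W p * box φ p = 0) :
    SolvesChar {q | charMap.symm q ∈ O} (fun q => W (charMap.symm q)) := by
  intro α β hα hβ hαc hβc hs
  have hp := contDiff_prodFun hα hβ
  have hpc := hasCompactSupport_prodFun hαc hβc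
  have key := hW (fun p => prodFun α β (charMap p)) (hp.comp charMap.contDiff)
    (hpc.comp_homeomorph charMap.toHomeomorph) fun p hp => ?_
  · have e1 : ∀ p, W p * box (fun p => prodFun α β (charMap p)) p
        = 4 * (fun q => W (charMap.symm q) * prodFun (deriv α) (deriv β) q) (charMap p) := by
      intro p
      rw [box_comp_charMap hp]
      simp only [fderiv_prodFun_snd hα hβ, fderiv_prodFun_fst hα (contDiff_deriv_top hβ),
        charMap.symm_apply_apply]
      ring
    simp only [e1, integral_const_mul] at key
    rw [integral_comp_charMap (fun q => W (charMap.symm q) * prodFun (deriv α) (deriv β) q)] at key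
    linarith
  · have h1 := tsupport_comp_subset_preimage (prodFun α β) charMap.continuous hp
    have h2 := hs (tsupport_prodFun_subset h1)
    rwa [mem_ofPred_eq, charMap.symm_apply_apply] at h2

end Mollify

/-! ### Uniqueness for zero data, by propagation along characteristics. -/

section Uniqueness

open scoped ContDiff

variable {ℓ₀ : ℝ} {ℓ : ℝ → ℝ} {W : ℝ × ℝ → ℝ}

theorem ae_of_forall_exists_mem_nhds {O : Set (ℝ × ℝ)} {P : ℝ × ℝ → Prop}
    (hP : ∀ x ∈ O, ∃ U ∈ 𝓝 x, ∀ᵐ y, y ∈ U → P y) : ∀ᵐ y, y ∈ O → P y := by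
  rw [ae_iff]
  refine measure_null_of_locally_null _ fun x hx => ?_
  have hxO : x ∈ O := by
    by_contra hxO
    exact hx fun hxO' => absurd hxO' hxO
  obtain ⟨U, hU, hUP⟩ := hP x hxO
  refine ⟨_, inter_mem_nhdsWithin _ hU, measure_mono_null (fun y hy => ?_) (ae_iff.1 hUP)⟩
  exact fun hy' => hy.1 fun _ => hy' hy.2

/-- A set of characteristics b > ℓ₀ is contained in the image under ψ of its hitting times, and ψ is
2-Lipschitz, hence at most doubles Lebesgue (one-dimensional Hausdorff) measure. -/
theorem IsFront.map_hitTime_le (h : IsFront ℓ₀ ℓ) :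
    Measure.map (hitTime ℓ₀ ℓ) (volume.restrict (Ioi ℓ₀)) ≤ (2 : ℝ≥0∞) • volume := by
  have hm := h.continuous_hitTime.measurable
  refine Measure.le_iff.2 fun A hA => ?_
  rw [Measure.map_apply hm hA, Measure.restrict_apply (hm hA), Measure.smul_apply, smul_eq_mul]
  have hL : LipschitzOnWith 2 (psi ℓ) (A ∩ Ici 0) := by
    refine LipschitzOnWith.of_dist_le_mul fun s hs t ht => ?_
    rw [Real.dist_eq, Real.dist_eq, NNReal.coe_ofNat]
    wlog hst : s ≤ t generalizing s t
    · rw [abs_sub_comm, abs_sub_comm s]; exact this t ht s hs (le_of_not_ge hst)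
    have h1 := h.psi_sub_mem hs.2 hst
    rw [abs_sub_comm, abs_sub_comm s, abs_of_nonneg (by linarith), abs_of_nonneg (by linarith)]
    exact h1.2
  have h2 := hL.hausdorffMeasure_image_le zero_le_one
  rw [hausdorffMeasure_real, ENNReal.rpow_one] at h2
  refine (measure_mono fun b hb => ?_).trans (h2.trans ?_)
  · refine ⟨hitTime ℓ₀ ℓ b, ⟨hb.1, h.hitTime_nonneg b⟩, ?_⟩
    rw [h.psi_hitTime, max_eq_left (le_of_lt hb.2)]
  · push_cast
    gcongr
    exact inter_subset_left

/-- If g on a rectangle equals the slice at displacement h, read off through τ(q.1 + h), then its L²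
norm there is at most a constant times the L² norm of the slice over K. The left side does not
depend on h and the right side tends to 0. -/
theorem ae_eq_zero_of_tendsto_slices {g : ℝ × ℝ → ℝ} (hg : AEMeasurable g) {S A J K : Set ℝ}
    (hA : volume A ≠ ⊤) (hK : MeasurableSet K) (hJ : MeasurableSet J) (hS : MeasurableSet S)
    (hA' : MeasurableSet A)
    {τ : ℝ → ℝ} (hτ : Measurable τ) {C : ℝ≥0∞} (hC : C ≠ ⊤)
    (hle : Measure.map τ (volume.restrict J) ≤ C • volume) {m : ℝ → ℝ → ℝ}
    (hmm : ∀ᶠ h in essZeroPlus, AEMeasurable (m h))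
    (hm : Tendsto (fun h => eLpNorm (m h) 2 (volume.restrict K)) essZeroPlus (𝓝 0))
    (hSJ : ∀ᶠ h in essZeroPlus, ∀ s ∈ S, s + h ∈ J ∧ τ (s + h) ∈ K)
    (hgm : ∀ᶠ h in essZeroPlus, ∀ᵐ q, q ∈ S ×ˢ A → g q = m h (τ (q.1 + h))) :
    ∀ᵐ q, q ∈ S ×ˢ A → g q = 0 := by
  have hpow : ∀ h, ∫⁻ t in K, ‖m h t‖ₑ ^ (2 : ℝ) = eLpNorm (m h) 2 (volume.restrict K) ^ (2 : ℝ) :=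
    fun h => (eLpNorm_nnreal_pow_eq_lintegral (p := 2) two_ne_zero).symm
  have hlim : Tendsto (fun h => volume A * (C * ∫⁻ t in K, ‖m h t‖ₑ ^ (2 : ℝ))) essZeroPlus
      (𝓝 0) := by
    have h1 := (ENNReal.continuous_rpow_const (y := 2)).tendsto 0 |>.comp hm
    rw [ENNReal.zero_rpow_of_pos two_pos] at h1
    have h2 := ENNReal.Tendsto.const_mul (a := C) h1 (Or.inr hC)
    have h3 := ENNReal.Tendsto.const_mul (a := volume A) h2 (Or.inr hA)
    simp only [mul_zero] at h3
    refine h3.congr fun h => ?_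
    rw [hpow]; rfl
  have hbound : ∀ᶠ h in essZeroPlus, ∫⁻ q in S ×ˢ A, ‖g q‖ₑ ^ (2 : ℝ)
      ≤ volume A * (C * ∫⁻ t in K, ‖m h t‖ₑ ^ (2 : ℝ)) := by
    filter_upwards [hmm, hSJ, hgm] with h h1 h2 h3
    set F : ℝ → ℝ≥0∞ := K.indicator fun t => ‖m h t‖ₑ ^ (2 : ℝ) with hF
    have hFm : AEMeasurable F := (h1.enorm.pow_const _).indicator hK
    calc ∫⁻ q in S ×ˢ A, ‖g q‖ₑ ^ (2 : ℝ)
        = ∫⁻ q in S ×ˢ A, J.indicator (fun s => F (τ s)) (q.1 + h) := by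
          refine setLIntegral_congr_fun_ae (hS.prod hA') ?_
          filter_upwards [h3] with q hq hqS
          have h4 := h2 q.1 hqS.1
          rw [hq hqS, indicator_of_mem h4.1, hF, indicator_of_mem h4.2]
      _ ≤ ∫⁻ s in S, ∫⁻ _ in A, J.indicator (fun s => F (τ s)) (s + h) := by
          rw [Measure.volume_eq_prod, ← Measure.prod_restrict]
          exact lintegral_prod_le _
      _ = ∫⁻ s in S, volume A * J.indicator (fun s => F (τ s)) (s + h) := by
          simp only [lintegral_const, Measure.restrict_apply_univ, mul_comm]
      _ = volume A * ∫⁻ s in S, J.indicator (fun s => F (τ s)) (s + h) :=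
          lintegral_const_mul' _ _ hA
      _ ≤ volume A * ∫⁻ s, J.indicator (fun s => F (τ s)) (s + h) := by
          gcongr; exact Measure.restrict_le_self
      _ = volume A * ∫⁻ s in J, F (τ s) := by
          rw [lintegral_add_right_eq_self (J.indicator fun s => F (τ s)) h, lintegral_indicator hJ]
      _ = volume A * ∫⁻ t, F t ∂(Measure.map τ (volume.restrict J)) := by
          rw [lintegral_map' (hFm.mono_ac (Measure.absolutelyContinuous_of_le_smul hle))
            hτ.aemeasurable]
      _ ≤ volume A * ∫⁻ t, F t ∂(C • volume) := by gcongr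
      _ = _ := by rw [lintegral_smul_measure, hF, lintegral_indicator hK, smul_eq_mul]
  have h0 : ∫⁻ q in S ×ˢ A, ‖g q‖ₑ ^ (2 : ℝ) = 0 :=
    le_antisymm (ge_of_tendsto hlim hbound) zero_le
  rw [lintegral_eq_zero_iff' (hg.enorm.pow_const _).restrict] at h0
  have h5 := (ae_restrict_iff' (hS.prod hA')).1 h0
  filter_upwards [h5] with q hq hqS
  simpa using hq hqS

theorem locallyIntegrable_comp_charMap_symm (hW : LocallyIntegrable W) :
    LocallyIntegrable fun q => W (charMap.symm q) := by
  rw [locallyIntegrable_iff] at hW ⊢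
  intro K hK
  have h1 := hW _ (hK.image charMap.symm.continuous)
  have h2 : IntegrableOn W (charMap.symm '' K) (Measure.map charMap.symm volume) := by
    rw [map_charMap_symm, IntegrableOn, Measure.restrict_smul]
    exact h1.smul_measure ENNReal.ofNat_ne_top
  rw [measurableEmbedding_charMap_symm.integrableOn_map_iff,
    preimage_image_eq _ charMap.symm.injective] at h2
  exact h2

/-- The rectangle [-ℓ₀, a] × [0, b] lies in the strip extended to t ≤ 0, where the equation holds.
Its three vertices other than (a, b) have a + b < 0, that is t < 0, where W = 0. -/
theorem ae_eq_zero_triangle (hW : LocallyIntegrable W)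
    (hneg : ∀ p, p.1 ≤ 0 → W p = 0)
    (hC : SolvesChar {q | charMap.symm q ∈ Iio (ℓ₀ / 2) ×ˢ Ioo 0 ℓ₀}
      fun q => W (charMap.symm q)) :
    ∀ᵐ q : ℝ × ℝ, q.1 < 0 ∧ q.2 < ℓ₀ ∧ 0 < q.1 + q.2 → W (charMap.symm q) = 0 := by
  have hG := locallyIntegrable_comp_charMap_symm hW
  have hD : IsOpen {q : ℝ × ℝ | charMap.symm q ∈ Iio (ℓ₀ / 2) ×ˢ Ioo 0 ℓ₀} :=
    (isOpen_Iio.prod isOpen_Ioo).preimage charMap.symm.continuous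
  have h0 : ∀ q : ℝ × ℝ, q.1 + q.2 < 0 → Tendsto
      (fun h => mollify (fun q => W (charMap.symm q)) h q) (𝓝[>] 0) (𝓝 0) := fun q hq => by
    refine tendsto_mollify_zero (O := {q | q.1 + q.2 < 0})
      ((isOpen_lt (by fun_prop) continuous_const).mem_nhds hq) (Eventually.of_forall fun y hy => ?_)
    have hy : y.1 + y.2 < 0 := hy
    exact hneg _ (by rw [charMap_symm_apply]; simp only; linarith)
  filter_upwards [ae_tendsto_mollify hG] with q hq hqT
  obtain ⟨a, b⟩ := q
  obtain ⟨h1, h2, h3⟩ := hqT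
  simp only at h1 h2 h3
  have key := hC.parallelogram hG hD (a₀ := -ℓ₀) (a := a) (b₀ := 0) (b := b) (by linarith)
    (by linarith) (fun y hy => ?_) hq (h0 _ (by simpa using h1)) (h0 _ (by simp only; linarith))
    (h0 _ (by simp only; linarith))
  · linarith
  · obtain ⟨⟨h4, h5⟩, h6, h7⟩ := hy
    rw [mem_ofPred_eq, charMap_symm_apply]
    refine ⟨?_, ?_, ?_⟩
    · change (y.1 + y.2) / 2 < ℓ₀ / 2; linarith
    · change 0 < (y.2 - y.1) / 2; linarith
    · change (y.2 - y.1) / 2 < ℓ₀; linarith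

theorem tendsto_mollify_triangle
    (hT : ∀ᵐ q : ℝ × ℝ, q.1 < 0 ∧ q.2 < ℓ₀ ∧ 0 < q.1 + q.2 → W (charMap.symm q) = 0) {q : ℝ × ℝ}
    (hq : q.1 < 0 ∧ q.2 < ℓ₀ ∧ 0 < q.1 + q.2) :
    Tendsto (fun h => mollify (fun q => W (charMap.symm q)) h q) (𝓝[>] 0) (𝓝 0) := by
  refine tendsto_mollify_zero (O := {q : ℝ × ℝ | q.1 < 0 ∧ q.2 < ℓ₀ ∧ 0 < q.1 + q.2})
    (IsOpen.mem_nhds ?_ hq) hT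
  exact (isOpen_lt continuous_fst continuous_const).inter
    ((isOpen_lt continuous_snd continuous_const).inter
      (isOpen_lt continuous_const (continuous_fst.add continuous_snd)))

theorem isOpen_charMap_symm_punctured (h : IsFront ℓ₀ ℓ) :
    IsOpen {q : ℝ × ℝ | charMap.symm q ∈ punctured ℓ₀ ℓ} :=
  h.isOpen_punctured.preimage charMap.symm.continuous

theorem mem_punctured_charMap_symm {a b : ℝ} : charMap.symm (a, b) ∈ punctured ℓ₀ ℓ ↔
    a < b ∧ omegaExt ℓ₀ ℓ b < a ∧ (a < 0 ∨ b < ℓ₀) := by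
  rw [charMap_symm_apply]
  simp only [punctured, mem_ofPred_eq, omegaExt]
  rw [show (a + b) / 2 + (b - a) / 2 = b by ring]
  refine and_congr ⟨fun _ => by linarith, fun _ => by linarith⟩
    (and_congr ⟨fun _ => by linarith, fun _ => by linarith⟩
      (or_congr ⟨fun _ => by linarith, fun _ => by linarith⟩ Iff.rfl))

/-- Beyond the left characteristic the solution depends on `t - x` only. -/
theorem eq_of_left (h : IsFront ℓ₀ ℓ) (hW : LocallyIntegrable W)
    (hP : SolvesChar {q | charMap.symm q ∈ punctured ℓ₀ ℓ} fun q => W (charMap.symm q))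
    (hT : ∀ᵐ q : ℝ × ℝ, q.1 < 0 ∧ q.2 < ℓ₀ ∧ 0 < q.1 + q.2 → W (charMap.symm q) = 0)
    {a b b' c c' : ℝ} (ha : 0 < a) (hab : a < b') (hb : b' ≤ b) (hbℓ : b < ℓ₀)
    (hc : Tendsto (fun h => mollify (fun q => W (charMap.symm q)) h (a, b)) (𝓝[>] 0) (𝓝 c))
    (hc' : Tendsto (fun h => mollify (fun q => W (charMap.symm q)) h (a, b')) (𝓝[>] 0) (𝓝 c')) :
    c = c' := by
  -- With a₀ = -b'/2 the two vertices (a₀, b') and (a₀, b) lie in the triangle where W is already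
  -- zero.
  have key := hP.parallelogram (locallyIntegrable_comp_charMap_symm hW)
    (isOpen_charMap_symm_punctured h) (a₀ := -b' / 2) (a := a) (b₀ := b') (b := b) (by linarith) hb
    (fun y hy => ?_) hc hc'
    (tendsto_mollify_triangle hT ⟨by simp only; linarith, hbℓ, by simp only; linarith⟩)
    (tendsto_mollify_triangle hT ⟨by simp only; linarith, by simp only; linarith,
      by simp only; linarith⟩)
  · linarith
  · obtain ⟨⟨h4, h5⟩, h6, h7⟩ := hy
    refine mem_punctured_charMap_symm.2 ⟨by linarith, ?_, Or.inr (by linarith)⟩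
    rw [omegaExt_of_le (by linarith)]
    linarith

/-- Beyond the right characteristic the solution depends on `t + x` only. -/
theorem eq_of_front (h : IsFront ℓ₀ ℓ) (hW : LocallyIntegrable W)
    (hP : SolvesChar {q | charMap.symm q ∈ punctured ℓ₀ ℓ} fun q => W (charMap.symm q))
    (hT : ∀ᵐ q : ℝ × ℝ, q.1 < 0 ∧ q.2 < ℓ₀ ∧ 0 < q.1 + q.2 → W (charMap.symm q) = 0)
    {a a' b c c' : ℝ} (hb : ℓ₀ < b) (ha : omegaExt ℓ₀ ℓ b < a) (ha0 : a < 0)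
    (ha' : omegaExt ℓ₀ ℓ b < a') (ha0' : a' < 0)
    (hc : Tendsto (fun h => mollify (fun q => W (charMap.symm q)) h (a, b)) (𝓝[>] 0) (𝓝 c))
    (hc' : Tendsto (fun h => mollify (fun q => W (charMap.symm q)) h (a', b)) (𝓝[>] 0) (𝓝 c')) :
    c = c' := by
  wlog haa : a' ≤ a generalizing a a' c c'
  · exact (this ha' ha0' ha ha0 hc' hc (le_of_not_ge haa)).symm
  have h1 := h.neg_le_omegaExt hb.le
  -- Since a' > -ℓ₀, the midpoint (ℓ₀ - a')/2 of -a' and ℓ₀ puts both lower vertices in the triangle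
  -- where W is already zero.
  have key := hP.parallelogram (locallyIntegrable_comp_charMap_symm hW)
    (isOpen_charMap_symm_punctured h) (a₀ := a') (a := a) (b₀ := (ℓ₀ - a') / 2) (b := b) haa
    (by linarith) (fun y hy => ?_) hc
    (tendsto_mollify_triangle hT ⟨ha0, by simp only; linarith, by simp only; linarith⟩) hc'
    (tendsto_mollify_triangle hT ⟨ha0', by simp only; linarith, by simp only; linarith⟩)
  · linarith
  · obtain ⟨⟨h4, h5⟩, h6, h7⟩ := hy
    refine mem_punctured_charMap_symm.2 ⟨by linarith, ?_, Or.inl (by linarith)⟩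
    rcases le_total y.2 ℓ₀ with h8 | h8
    · rw [omegaExt_of_le h8]; linarith
    · have := h.omegaExt_mono h8 h7; linarith

theorem ae_slice_aemeasurable (hW : LocallyIntegrable W) {γ : ℝ → ℝ} (hγ : Continuous γ) {s : ℝ}
    (hs : s = 1 ∨ s = -1) : ∀ᵐ h : ℝ, AEMeasurable fun t => W (t, γ t + s * h) := by
  have h1 : AEStronglyMeasurable (fun q : ℝ × ℝ => W (q.2, γ q.2 + s * q.1))
      (volume.prod volume) :=
    hW.aestronglyMeasurable.comp_quasiMeasurePreserving (quasiMeasurePreserving_shear hγ hs)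
  filter_upwards [h1.prodMk_left] with x hx
  exact hx.aemeasurable

/-- Near each point W depends on a only, so its value there is also its value on the line x = y at
time a + y. The zero trace makes these slices small in L² as y → 0. -/
theorem ae_eq_zero_left (h : IsFront ℓ₀ ℓ) (hW : LocallyIntegrable W)
    (hP : SolvesChar {q | charMap.symm q ∈ punctured ℓ₀ ℓ} fun q => W (charMap.symm q))
    (hT : ∀ᵐ q : ℝ × ℝ, q.1 < 0 ∧ q.2 < ℓ₀ ∧ 0 < q.1 + q.2 → W (charMap.symm q) = 0)
    (hL : HasTrace 1 (fun _ => 0) (Ioo 0 ℓ₀) W fun _ => 0) :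
    ∀ᵐ q : ℝ × ℝ, 0 < q.1 ∧ q.1 < q.2 ∧ q.2 < ℓ₀ → W (charMap.symm q) = 0 := by
  have hG := locallyIntegrable_comp_charMap_symm hW
  refine ae_of_forall_exists_mem_nhds (O := {q : ℝ × ℝ | 0 < q.1 ∧ q.1 < q.2 ∧ q.2 < ℓ₀})
    fun p hp => ?_
  obtain ⟨a, b⟩ := p
  obtain ⟨h1, h2, h3⟩ := hp
  simp only at h1 h2 h3
  obtain ⟨ε, hε, hε1, hε2, hε3⟩ : ∃ ε > 0, 4 * ε < a ∧ 4 * ε < b - a ∧ 4 * ε < ℓ₀ - b := by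
    have h4 : 0 < min a (min (b - a) (ℓ₀ - b)) :=
      lt_min h1 (lt_min (by linarith) (by linarith))
    refine ⟨min a (min (b - a) (ℓ₀ - b)) / 5, by positivity, ?_, ?_, ?_⟩
    · have := min_le_left a (min (b - a) (ℓ₀ - b)); linarith
    · have := (min_le_right a (min (b - a) (ℓ₀ - b))).trans (min_le_left _ _); linarith
    · have := (min_le_right a (min (b - a) (ℓ₀ - b))).trans (min_le_right _ _); linarith
  refine ⟨Ioo (a - ε) (a + ε) ×ˢ Ioo (b - ε) (b + ε),
    prod_mem_nhds (Ioo_mem_nhds (by linarith) (by linarith))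
      (Ioo_mem_nhds (by linarith) (by linarith)), ?_⟩
  have hE : ∀ᵐ p : ℝ × ℝ, Tendsto
      (fun h => mollify (fun q => W (charMap.symm q)) h (charMap p)) (𝓝[>] 0) (𝓝 (W p)) := by
    filter_upwards [quasiMeasurePreserving_charMap.ae (ae_tendsto_mollify hG)] with p hp
    simpa only [charMap.symm_apply_apply] using hp
  have hsmall : ∀ᶠ y in 𝓝[>] (0 : ℝ), y ∈ Ioo 0 ε := Ioo_mem_nhdsGT hε
  refine ae_eq_zero_of_tendsto_slices (K := Icc (a - ε) (a + 2 * ε)) (J := univ) (τ := id) (C := 1)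
    (m := fun y t => W (t, 0 + 1 * y)) hG.aestronglyMeasurable.aemeasurable (by simp)
    measurableSet_Icc MeasurableSet.univ measurableSet_Ioo measurableSet_Ioo measurable_id
    ENNReal.one_ne_top (by simp) ?_ ?_ ?_ ?_
  · exact (eventually_essZeroPlus hsmall (ae_slice_aemeasurable hW continuous_const
      (Or.inl rfl))).mono fun y hy => hy.2
  · have := hL (Icc (a - ε) (a + 2 * ε)) isCompact_Icc fun t ht =>
      ⟨by linarith [ht.1], by linarith [ht.2]⟩
    simpa only [sub_zero] using this
  · refine (hsmall.filter_mono essZeroPlus_le).mono fun y hy s hs => ⟨mem_univ _, ?_, ?_⟩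
    · change a - ε ≤ s + y; linarith [hs.1, hy.1]
    · change s + y ≤ a + 2 * ε; linarith [hs.2, hy.2]
  · refine (eventually_essZeroPlus hsmall
      (ae_shear (γ := fun _ => 0) continuous_const (Or.inl rfl) hE)).mono fun y hy => ?_
    obtain ⟨hy1, hy2⟩ := hy
    have h5 : ∀ᵐ s : ℝ, Tendsto (fun h => mollify (fun q => W (charMap.symm q)) h
        (charMap (s + y, (0 : ℝ) + 1 * y))) (𝓝[>] 0) (𝓝 (W (s + y, (0 : ℝ) + 1 * y))) :=
      (measurePreserving_add_right volume y).quasiMeasurePreserving.ae hy2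
    have h6 := (Measure.quasiMeasurePreserving_fst (μ := volume) (ν := (volume : Measure ℝ))).ae h5
    filter_upwards [h6, ae_tendsto_mollify hG] with q hq hq' hqS
    obtain ⟨a', b'⟩ := q
    obtain ⟨⟨h7, h8⟩, h9, h10⟩ := hqS
    simp only at h7 h8 h9 h10 hq
    refine eq_of_left h hW hP hT (a := a') (b := b') (b' := a' + 2 * y) (by linarith)
      (by linarith [hy1.1]) (by linarith [hy1.2]) (by linarith) hq' ?_
    have e : charMap (a' + y, (0 : ℝ) + 1 * y) = (a', a' + 2 * y) := by
      rw [charMap_apply]; ext <;> simp only <;> ring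
    rwa [e] at hq

/-- The same transport, now along lines of constant b up to the displaced front x = ℓ(t) - y. Slices
are parametrised by time and the rectangle by b, so the change of variables is `hitTime`, with
constant 2 from `IsFront.map_hitTime_le`. -/
theorem ae_eq_zero_front (h : IsFront ℓ₀ ℓ) (hW : LocallyIntegrable W)
    (hP : SolvesChar {q | charMap.symm q ∈ punctured ℓ₀ ℓ} fun q => W (charMap.symm q))
    (hT : ∀ᵐ q : ℝ × ℝ, q.1 < 0 ∧ q.2 < ℓ₀ ∧ 0 < q.1 + q.2 → W (charMap.symm q) = 0)
    (hR : HasTrace (-1) ℓ {t | 0 < t ∧ t < ℓ t} W fun _ => 0) :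
    ∀ᵐ q : ℝ × ℝ, q.1 < 0 ∧ ℓ₀ < q.2 ∧ omegaExt ℓ₀ ℓ q.2 < q.1 → W (charMap.symm q) = 0 := by
  have hG := locallyIntegrable_comp_charMap_symm hW
  have hsw : Measure.QuasiMeasurePreserving (Prod.swap : ℝ × ℝ → ℝ × ℝ) volume volume :=
    (Measure.measurePreserving_swap (μ := volume) (ν := volume)).quasiMeasurePreserving
  refine ae_of_forall_exists_mem_nhds
    (O := {q : ℝ × ℝ | q.1 < 0 ∧ ℓ₀ < q.2 ∧ omegaExt ℓ₀ ℓ q.2 < q.1}) fun p hp => ?_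
  obtain ⟨a, b⟩ := p
  obtain ⟨h1, h2, h3⟩ := hp
  simp only at h1 h2 h3
  set m := (omegaExt ℓ₀ ℓ b + a) / 2 with hm
  have hev : ∀ᶠ s in 𝓝 b, omegaExt ℓ₀ ℓ s < m ∧ ℓ₀ < s :=
    (h.continuous_omegaExt.continuousAt.eventually_lt_const (by linarith)).and
      (lt_mem_nhds h2)
  obtain ⟨δ, hδ, hδb⟩ := Metric.eventually_nhds_iff.1 hev
  obtain ⟨ε, hε, hε1, hε2, hε3⟩ : ∃ ε > 0, 3 * ε < δ ∧ ε < a - m ∧ ε < -a := by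
    have h4 : 0 < min δ (min (a - m) (-a)) :=
      lt_min hδ (lt_min (by linarith) (by linarith))
    refine ⟨min δ (min (a - m) (-a)) / 4, by positivity, ?_, ?_, ?_⟩
    · have := min_le_left δ (min (a - m) (-a)); linarith
    · have := (min_le_right δ (min (a - m) (-a))).trans (min_le_left _ _); linarith
    · have := (min_le_right δ (min (a - m) (-a))).trans (min_le_right _ _); linarith
  have hb : ∀ s, b - ε ≤ s → s ≤ b + 2 * ε → omegaExt ℓ₀ ℓ s < m ∧ ℓ₀ < s := fun s hs hs' =>
    hδb (by rw [Real.dist_eq, abs_lt]; constructor <;> linarith)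
  set K := hitTime ℓ₀ ℓ '' Icc (b - ε) (b + 2 * ε) with hK
  have hKc : IsCompact K := isCompact_Icc.image h.continuous_hitTime
  have hhit : ∀ s, ℓ₀ < s → 0 ≤ hitTime ℓ₀ ℓ s ∧ hitTime ℓ₀ ℓ s + ℓ (hitTime ℓ₀ ℓ s) = s :=
    fun s hs => ⟨h.hitTime_nonneg s, by
      have := h.psi_hitTime s
      rwa [max_eq_left hs.le] at this⟩
  have hKI : K ⊆ {t | 0 < t ∧ t < ℓ t} := by
    rintro _ ⟨s, hs, rfl⟩
    obtain ⟨h4, h5⟩ := hb s hs.1 hs.2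
    obtain ⟨h6, h7⟩ := hhit s h5
    refine ⟨lt_of_le_of_ne h6 fun h8 => ?_, ?_⟩
    · rw [← h8, h.zero] at h7; linarith
    · simp only [omegaExt] at h4; linarith
  have hE : ∀ᵐ p : ℝ × ℝ, Tendsto
      (fun h => mollify (fun q => W (charMap.symm q)) h (charMap p)) (𝓝[>] 0) (𝓝 (W p)) := by
    filter_upwards [quasiMeasurePreserving_charMap.ae (ae_tendsto_mollify hG)] with p hp
    simpa only [charMap.symm_apply_apply] using hp
  have hsmall : ∀ᶠ y in 𝓝[>] (0 : ℝ), y ∈ Ioo 0 ε := Ioo_mem_nhdsGT hε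
  have hγ := h.continuous_comp_max
  have key : ∀ᵐ q : ℝ × ℝ, q ∈ Ioo (b - ε) (b + ε) ×ˢ Ioo (a - ε) (a + ε) →
      W (charMap.symm q.swap) = 0 := by
    refine ae_eq_zero_of_tendsto_slices (K := K) (J := Ioi ℓ₀) (τ := hitTime ℓ₀ ℓ) (C := 2)
      (m := fun y t => W (t, ℓ (max 0 t) + -1 * y))
      (hG.aestronglyMeasurable.comp_quasiMeasurePreserving hsw).aemeasurable (by simp)
      hKc.measurableSet measurableSet_Ioi measurableSet_Ioo measurableSet_Ioo
      h.continuous_hitTime.measurable ENNReal.ofNat_ne_top h.map_hitTime_le ?_ ?_ ?_ ?_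
    · exact (eventually_essZeroPlus hsmall (ae_slice_aemeasurable hW hγ
        (Or.inr rfl))).mono fun y hy => hy.2
    · refine (hR K hKc hKI).congr fun y => eLpNorm_congr_ae ?_
      filter_upwards [ae_restrict_mem hKc.measurableSet] with t ht
      rw [sub_zero, max_eq_right (hKI ht).1.le]
    · refine (hsmall.filter_mono essZeroPlus_le).mono fun y hy s hs => ?_
      have h4 : b - ε ≤ s + y := by linarith [hs.1, hy.1]
      have h5 : s + y ≤ b + 2 * ε := by linarith [hs.2, hy.2]
      exact ⟨(hb _ h4 h5).2, mem_image_of_mem _ ⟨h4, h5⟩⟩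
    · refine (eventually_essZeroPlus hsmall (ae_shear hγ (Or.inr rfl) hE)).mono fun y hy => ?_
      obtain ⟨hy1, hy2⟩ := hy
      have h4 := (Measure.absolutelyContinuous_of_le_smul h.map_hitTime_le).ae_le hy2
      have h5 := (ae_restrict_iff' measurableSet_Ioi).1
        (ae_of_ae_map h.continuous_hitTime.aemeasurable h4)
      have h6 := (measurePreserving_add_right volume y).quasiMeasurePreserving.ae h5
      have h7 := (Measure.quasiMeasurePreserving_fst (μ := volume)
        (ν := (volume : Measure ℝ))).ae h6
      filter_upwards [h7, hsw.ae (ae_tendsto_mollify hG)] with q hq hq' hqS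
      obtain ⟨b', a'⟩ := q
      obtain ⟨⟨h8, h9⟩, h10, h11⟩ := hqS
      simp only [Prod.swap_prod_mk] at h8 h9 h10 h11 hq hq' ⊢
      have h12 := hb (b' + y) (by linarith [hy1.1]) (by linarith [hy1.2])
      have h13 := hb b' (by linarith) (by linarith)
      have h14 := hq h12.2
      obtain ⟨h15, h16⟩ := hhit _ h12.2
      have h17 := h.omegaExt_mono h13.2.le (show b' ≤ b' + y by linarith [hy1.1])
      rw [max_eq_right h15] at h14 ⊢
      -- The hitting time is taken at b' + y, because moving left by y from the front lowers t + x
      -- from b' + y to b'.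
      have e : charMap (hitTime ℓ₀ ℓ (b' + y), ℓ (hitTime ℓ₀ ℓ (b' + y)) + -1 * y)
          = (omegaExt ℓ₀ ℓ (b' + y) + y, b') := by
        rw [charMap_apply]
        ext
        · simp only [omegaExt]; linarith
        · simp only; linarith
      rw [e] at h14
      exact eq_of_front h hW hP hT h13.2 (by linarith) (by linarith) (by linarith [hy1.1])
        (by linarith [hy1.2]) hq' h14
  refine ⟨Ioo (a - ε) (a + ε) ×ˢ Ioo (b - ε) (b + ε),
    prod_mem_nhds (Ioo_mem_nhds (by linarith) (by linarith))
      (Ioo_mem_nhds (by linarith) (by linarith)), ?_⟩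
  filter_upwards [hsw.ae key] with q hq hqS
  exact hq ⟨hqS.2, hqS.1⟩

/-- Uniqueness for the homogeneous problem with zero data. -/
theorem ae_eq_zero_punctured (h : IsFront ℓ₀ ℓ) (hW : LocallyIntegrable W)
    (hneg : ∀ p, p.1 ≤ 0 → W p = 0)
    (hC : ∀ φ : ℝ × ℝ → ℝ, ContDiff ℝ ∞ φ → HasCompactSupport φ →
      tsupport φ ⊆ Iio (ℓ₀ / 2) ×ˢ Ioo 0 ℓ₀ → ∫ p, W p * box φ p = 0)
    (hP : ∀ φ : ℝ × ℝ → ℝ, ContDiff ℝ ∞ φ → HasCompactSupport φ →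
      tsupport φ ⊆ punctured ℓ₀ ℓ → ∫ p, W p * box φ p = 0)
    (hL : HasTrace 1 (fun _ => 0) (Ioo 0 ℓ₀) W fun _ => 0)
    (hR : HasTrace (-1) ℓ {t | 0 < t ∧ t < ℓ t} W fun _ => 0) :
    ∀ᵐ p, p ∈ punctured ℓ₀ ℓ → W p = 0 := by
  have hP' := solvesChar_of_integral_box hP
  have hT := ae_eq_zero_triangle hW hneg (solvesChar_of_integral_box hC)
  have hall : ∀ᵐ q : ℝ × ℝ, q.1 ≠ 0 → q.2 ≠ ℓ₀ → charMap.symm q ∈ punctured ℓ₀ ℓ →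
      W (charMap.symm q) = 0 := by
    filter_upwards [hT, ae_eq_zero_left h hW hP' hT hL, ae_eq_zero_front h hW hP' hT hR]
      with q h1 h2 h3 hq1 hq2 hq
    obtain ⟨h4, h5, h6⟩ := mem_punctured_charMap_symm.1 hq
    rcases lt_or_gt_of_ne hq2 with h7 | h7
    · rw [omegaExt_of_le h7.le] at h5
      rcases lt_or_gt_of_ne hq1 with h8 | h8
      · exact h1 ⟨h8, h7, by linarith⟩
      · exact h2 ⟨h8, h4, h7⟩
    · exact h3 ⟨h6.resolve_right (not_lt.2 h7.le), h7, h5⟩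
  filter_upwards [quasiMeasurePreserving_charMap.ae hall, ae_fst_ne_charMap 0,
    ae_snd_ne_charMap ℓ₀] with p hp h1 h2 hpU
  have := hp h1 h2
  rw [charMap.symm_apply_apply] at this
  exact this hpU

end Uniqueness

/-! ### The two implications. -/

section Duhamel

open scoped ContDiff

variable {ν ℓ₀ κ : ℝ} {ℓ z v₀ v₁ : ℝ → ℝ} {v w : ℝ × ℝ → ℝ} {φ : ℝ × ℝ → ℝ}

theorem HasTrace.congr_on {s : ℝ} {γ g : ℝ → ℝ} {I : Set ℝ} (hv : HasTrace s γ I v g)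
    {U : Set (ℝ × ℝ)} (hvw : ∀ p ∈ U, v p = w p)
    (hU : ∀ K, IsCompact K → K ⊆ I → ∀ᶠ h in 𝓝[>] (0 : ℝ), ∀ t ∈ K, (t, γ t + s * h) ∈ U) :
    HasTrace s γ I w g := by
  intro K hK hKI
  refine (hv K hK hKI).congr' ?_
  filter_upwards [(hU K hK hKI).filter_mono essZeroPlus_le] with h hh
  refine eLpNorm_congr_ae ?_
  filter_upwards [ae_restrict_mem hK.measurableSet] with t ht
  rw [hvw _ (hh t ht)]

theorem integral_punctured_reprFun_mul_box (h : IsFront ℓ₀ ℓ) (hℓ₀ : 0 < ℓ₀)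
    (hz : ContinuousOn z (Ici 0)) (hv₀ : ContinuousOn v₀ (Icc 0 ℓ₀))
    (hv₁ : IntegrableOn v₁ (Ioo 0 ℓ₀)) (hc : v₀ 0 = z 0) (hc' : v₀ ℓ₀ = 0)
    (hF : ∀ M : ℝ, IntegrableOn (extendZero ℓ₀ ℓ v) {q | q.1 + q.2 < M}) (κ : ℝ)
    (hφ : ContDiff ℝ ∞ φ) (hφc : HasCompactSupport φ) (hφU : tsupport φ ⊆ punctured ℓ₀ ℓ) :
    ∫ p in punctured ℓ₀ ℓ, reprFun ℓ₀ ℓ z v₀ v₁ κ (extendZero ℓ₀ ℓ v) p * box φ p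
      = 2 * κ * ∫ p in punctured ℓ₀ ℓ, v p * φ p := by
  have hpos : punctured ℓ₀ ℓ ⊆ {p : ℝ × ℝ | 0 < p.1} := fun p hp => (h.hitTime_nonneg _).trans_lt hp.2.1
  have hx : ∀ x : ℝ, (0, x) ∉ tsupport φ := fun x hx => lt_irrefl (0 : ℝ) (hpos (hφU hx))
  have key := integral_half_reprFun_mul_box h hℓ₀ hz hv₀ hv₁ hc hc' hF κ hφ hφc
    (fun x hx' => absurd hx' (hx x))
  have e1 : ∀ x, φ (0, x) = 0 := fun x => image_eq_zero_of_notMem_tsupport (hx x)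
  have e2 : ∀ x, fderiv ℝ φ (0, x) = 0 := fun x => fderiv_of_notMem_tsupport ℝ (hx x)
  simp only [e1, e2, _root_.zero_apply, mul_zero, integral_zero, sub_zero, add_zero] at key
  rw [setIntegral_congr_set (h.ae_eq_Omega' hℓ₀)] at key
  rw [← key]
  refine (setIntegral_eq_of_subset_of_forall_sdiff_eq_zero
    (measurableSet_lt (by fun_prop) (by fun_prop)) hpos fun p hp => ?_).symm
  rw [image_eq_zero_of_notMem_tsupport fun hp' => hp.2 (hφU (tsupport_box_subset hp')), mul_zero]

/-- A function satisfying Duhamel's formula is a solution. -/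
theorem isSolution_of_ae_eq (h : IsFront ℓ₀ ℓ) (hℓ₀ : 0 < ℓ₀)
    (hz : ContinuousOn z (Ici 0)) (hv₀ : ContinuousOn v₀ (Icc 0 ℓ₀))
    (hv₁ : IntegrableOn v₁ (Ioo 0 ℓ₀)) (hc : v₀ 0 = z 0) (hc' : v₀ ℓ₀ = 0)
    (hv : MemHTilde1 ℓ₀ ℓ v)
    (hF : ∀ M : ℝ, IntegrableOn (extendZero ℓ₀ ℓ v) {q | q.1 + q.2 < M})
    (hvu : ∀ᵐ p, p ∈ punctured ℓ₀ ℓ →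
      v p = reprFun ℓ₀ ℓ z v₀ v₁ (ν ^ 2 / 8) (extendZero ℓ₀ ℓ v) p) :
    IsSolution ν ℓ₀ ℓ z v₀ v₁ v := by
  obtain ⟨vt, vx, hd, hd', hL2⟩ := hv
  set u := reprFun ℓ₀ ℓ z v₀ v₁ (ν ^ 2 / 8) (extendZero ℓ₀ ℓ v) with hu
  have huc : Continuous u := continuous_reprFun h hℓ₀ hz hv₀ hv₁ hc hc' hF _
  have hUm := h.isOpen_punctured.measurableSet
  have hloc := hd.1
  rw [h.coe_openOmega' hℓ₀] at hloc
  obtain ⟨hm, hmt, hmx⟩ := hL2 ℓ₀ hℓ₀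
  have hsub := h.strip_subset_Omega'T hℓ₀
  have hsq : ∀ {f : ℝ × ℝ → ℝ}, MemLp f 2 (volume.restrict (Omega'T ℓ₀ ℓ ℓ₀)) →
      IntegrableOn (fun p => f p ^ 2) (Ioo 0 (ℓ₀ / 2) ×ˢ Ioo 0 ℓ₀) := fun hf =>
    IntegrableOn.mono_set (t := Omega'T ℓ₀ ℓ ℓ₀) hf.integrable_sq hsub
  refine ⟨fun φ => ?_, ?_, ?_, ?_, vt, hd, ?_⟩
  · have hφU : tsupport φ ⊆ punctured ℓ₀ ℓ := by
      have := φ.tsupport_subset; rwa [h.coe_openOmega' hℓ₀] at this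
    have hφ : ContDiff ℝ ∞ φ := φ.contDiff
    have hφc := φ.hasCompactSupport
    rw [h.coe_openOmega' hℓ₀]
    have i1 := hloc.integrableOn_mul (contDiff_box hφ).continuous (hasCompactSupport_box hφc)
      (tsupport_box_subset.trans hφU)
    have i2 := hloc.integrableOn_mul hφ.continuous hφc hφU
    have e1 : ∫ p in punctured ℓ₀ ℓ, v p * box φ p = ∫ p in punctured ℓ₀ ℓ, u p * box φ p := by
      refine setIntegral_congr_ae hUm ?_
      filter_upwards [hvu] with p hp hpU
      rw [hp hpU]
    rw [integral_punctured_reprFun_mul_box h hℓ₀ hz hv₀ hv₁ hc hc' hF _ hφ hφc hφU] at e1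
    have e2 : ∫ p in punctured ℓ₀ ℓ, v p * (box φ p - ν ^ 2 / 4 * φ p)
        = (∫ p in punctured ℓ₀ ℓ, v p * box φ p)
          - ν ^ 2 / 4 * ∫ p in punctured ℓ₀ ℓ, v p * φ p := by
      rw [← integral_const_mul, ← integral_sub i1 (i2.const_mul _)]
      exact integral_congr_ae (Eventually.of_forall fun p => by ring)
    exact e2.trans (by rw [e1]; ring)
  · exact HasTrace.of_continuous_of_ae_eq huc continuous_const (fun _ _ => rfl) (Or.inl rfl)
      (fun t ht => reprFun_left ht.1 ht.2.le) hvu fun K hK hKI => h.eventually_left_mem hK hKI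
  · exact HasTrace.of_continuous_of_ae_eq huc h.continuous_comp_max
      (fun t ht => by rw [max_eq_right ht.1.le]) (Or.inr rfl)
      (fun t ht => reprFun_front h ht.1 ht.2) hvu fun K hK hKI => h.eventually_front_mem hℓ₀ hK hKI
  · exact tendsto_initial_position h hℓ₀ huc (fun x hx => reprFun_initial hx) hvu
  -- Continuity of u says nothing about v_t, so the initial velocity is recovered from the weak
  -- Cauchy problem that v inherits from u.
  · refine tendsto_negSobolevNorm h hℓ₀ (v₀ := v₀) (k := ν ^ 2 / 4) (by positivity) hv₁ hd hd'
      ((h.integrableOn_of_memLp hm).mono_set hsub) ((h.integrableOn_of_memLp hmt).mono_set hsub)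
      ((h.integrableOn_of_memLp hmx).mono_set hsub) (hsq hm) (hsq hmx) ?_
    intro φ hφ hφc hφs
    have key := weakCauchy_reprFun h hℓ₀ hz hv₀ hv₁ hc hc' hF (ν ^ 2 / 8) φ hφ hφc hφs
    rw [show 2 * (ν ^ 2 / 8) = ν ^ 2 / 4 by ring] at key
    rw [← key]
    refine setIntegral_congr_ae (measurableSet_Ioo.prod measurableSet_Ioo) ?_
    filter_upwards [hvu] with p hp hpS
    rw [hp (h.strip_subset hpS)]

/-- A solution satisfies Duhamel's formula. -/
theorem IsSolution.ae_eq_reprFun (hs : IsSolution ν ℓ₀ ℓ z v₀ v₁ v) (h : IsFront ℓ₀ ℓ)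
    (hℓ₀ : 0 < ℓ₀) (hz : ContinuousOn z (Ici 0)) (hv₀ : ContinuousOn v₀ (Icc 0 ℓ₀))
    (hv₁ : IntegrableOn v₁ (Ioo 0 ℓ₀)) (hc : v₀ 0 = z 0) (hc' : v₀ ℓ₀ = 0)
    (hv : MemHTilde1 ℓ₀ ℓ v)
    (hF : ∀ M : ℝ, IntegrableOn (extendZero ℓ₀ ℓ v) {q | q.1 + q.2 < M}) :
    ∀ᵐ p, p ∈ punctured ℓ₀ ℓ →
      v p = reprFun ℓ₀ ℓ z v₀ v₁ (ν ^ 2 / 8) (extendZero ℓ₀ ℓ v) p := by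
  obtain ⟨vt, vx, hd, hd', hL2⟩ := hv
  set u := reprFun ℓ₀ ℓ z v₀ v₁ (ν ^ 2 / 8) (extendZero ℓ₀ ℓ v) with hu
  have huc : Continuous u := continuous_reprFun h hℓ₀ hz hv₀ hv₁ hc hc' hF _
  have hUm := h.isOpen_punctured.measurableSet
  have hloc := hd.1
  rw [h.coe_openOmega' hℓ₀] at hloc
  obtain ⟨hm, hmt, -⟩ := hL2 ℓ₀ hℓ₀
  have hsub := h.strip_subset_Omega'T hℓ₀
  have hpu : punctured ℓ₀ ℓ ⊆ Omega' ℓ₀ ℓ := fun p hp => (h.mem_Omega'_iff hℓ₀).2 (Or.inl hp)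
  -- The source of u is built from v itself, so the zero-order terms cancel and W satisfies the
  -- homogeneous wave equation.
  set W : ℝ × ℝ → ℝ := extendZero ℓ₀ ℓ (fun p => v p - u p) with hWd
  have hWU : ∀ p ∈ punctured ℓ₀ ℓ, v p - u p = W p := fun p hp =>
    (indicator_of_mem (hpu hp) (fun p => v p - u p)).symm
  have hW0 : ∀ p, p.1 ≤ 0 → W p = 0 := fun p hp =>
    indicator_of_notMem (fun hp' => not_lt.2 hp (pos_of_mem_Omega' hp').1) _
  have hWint : ∀ g : ℝ × ℝ → ℝ, ∫ p, W p * g p = ∫ p in punctured ℓ₀ ℓ, (v p - u p) * g p := by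
    intro g
    rw [← setIntegral_congr_set (h.ae_eq_Omega' hℓ₀),
      ← integral_indicator (h.measurableSet_Omega' hℓ₀)]
    refine integral_congr_ae (Eventually.of_forall fun p => ?_)
    by_cases hp : p ∈ Omega' ℓ₀ ℓ
    · simp only [hWd, extendZero, indicator_of_mem hp]
    · simp only [hWd, extendZero, indicator_of_notMem hp, zero_mul]
  have hWloc : LocallyIntegrable W := by
    have e1 : W = fun p => extendZero ℓ₀ ℓ v p - (Omega' ℓ₀ ℓ).indicator u p :=
      indicator_sub (Omega' ℓ₀ ℓ) v u
    rw [e1]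
    refine LocallyIntegrable.sub (fun x => ?_)
      (huc.locallyIntegrable.indicator (h.measurableSet_Omega' hℓ₀))
    refine ⟨{q | q.1 + q.2 < x.1 + x.2 + 1}, IsOpen.mem_nhds ?_ ?_, hF _⟩
    · exact isOpen_lt (continuous_fst.add continuous_snd) continuous_const
    · change x.1 + x.2 < x.1 + x.2 + 1; linarith
  have hP : ∀ φ : ℝ × ℝ → ℝ, ContDiff ℝ ∞ φ → HasCompactSupport φ →
      tsupport φ ⊆ punctured ℓ₀ ℓ → ∫ p, W p * box φ p = 0 := by
    intro φ hφ hφc hφU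
    have hb := (contDiff_box hφ).continuous
    have hbc := hasCompactSupport_box hφc
    have i1 := hloc.integrableOn_mul hb hbc (tsupport_box_subset.trans hφU)
    have i2 := hloc.integrableOn_mul hφ.continuous hφc hφU
    have i3 : IntegrableOn (fun p => u p * box φ p) (punctured ℓ₀ ℓ) :=
      ((huc.mul hb).integrable_of_hasCompactSupport hbc.mul_left).integrableOn
    have e1 := hs.wave.integral_eq hφ hφc (by rw [h.coe_openOmega' hℓ₀]; exact hφU)
    rw [h.coe_openOmega' hℓ₀] at e1
    have e2 : ∫ p in punctured ℓ₀ ℓ, v p * (box φ p - ν ^ 2 / 4 * φ p)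
        = (∫ p in punctured ℓ₀ ℓ, v p * box φ p)
          - ν ^ 2 / 4 * ∫ p in punctured ℓ₀ ℓ, v p * φ p := by
      rw [← integral_const_mul, ← integral_sub i1 (i2.const_mul _)]
      exact integral_congr_ae (Eventually.of_forall fun p => by ring)
    have e3 := integral_punctured_reprFun_mul_box h hℓ₀ hz hv₀ hv₁ hc hc' hF (ν ^ 2 / 8) hφ hφc hφU
    rw [hWint]
    simp only [sub_mul]
    rw [integral_sub i1 i3]
    linarith
  -- These test functions may reach t ≤ 0. Since v and u solve the same weak Cauchy problem, the
  -- data terms cancel and the zero extension of W solves the equation across the initial line.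
  have hC : ∀ φ : ℝ × ℝ → ℝ, ContDiff ℝ ∞ φ → HasCompactSupport φ →
      tsupport φ ⊆ Iio (ℓ₀ / 2) ×ˢ Ioo 0 ℓ₀ → ∫ p, W p * box φ p = 0 := by
    intro φ hφ hφc hφs
    have hb := (contDiff_box hφ).continuous
    have hbc := hasCompactSupport_box hφc
    have hvs := (h.integrableOn_of_memLp hm).mono_set hsub
    have hv₀i : IntegrableOn v₀ (Ioo 0 ℓ₀) :=
      (hv₀.integrableOn_compact isCompact_Icc).mono_set Ioo_subset_Icc_self
    obtain ⟨vt', hdt', hvel⟩ := hs.initial_velocity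
    have e1 := weakCauchy_of_isSolution h hℓ₀ hv₀i hv₁ hs.wave hd hvs
      ((h.integrableOn_of_memLp hmt).mono_set hsub) hs.initial_position
      (tendsto_negSobolevNorm_congr h hℓ₀ hd hdt' hvel) φ hφ hφc hφs
    have e2 := weakCauchy_reprFun h hℓ₀ hz hv₀ hv₁ hc hc' hF (ν ^ 2 / 8) φ hφ hφc hφs
    rw [show 2 * (ν ^ 2 / 8) = ν ^ 2 / 4 by ring, ← e1] at e2
    have i1 := integrableOn_strip_mul hvs hb hbc
    have i3 : IntegrableOn (fun p => u p * box φ p) (Ioo 0 (ℓ₀ / 2) ×ˢ Ioo 0 ℓ₀) :=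
      ((huc.mul hb).integrable_of_hasCompactSupport hbc.mul_left).integrableOn
    rw [hWint, setIntegral_punctured_eq_strip h fun p hp hp' => by
      rw [image_eq_zero_of_notMem_tsupport fun hp2 =>
        hp' (mem_strip (hφs (tsupport_box_subset hp2)) hp), mul_zero]]
    simp only [sub_mul]
    rw [integral_sub i1 i3, ← e2, sub_self]
  have hL : HasTrace 1 (fun _ => 0) (Ioo 0 ℓ₀) W fun _ => 0 :=
    (hs.trace_left.sub_continuous huc continuous_const (fun _ _ => rfl) (Or.inl rfl)
      (fun t ht => reprFun_left ht.1 ht.2.le) hUm hloc.aestronglyMeasurable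
      fun K hK hKI => h.eventually_left_mem hK hKI).congr_on hWU
      fun K hK hKI => h.eventually_left_mem hK hKI
  have hR : HasTrace (-1) ℓ {t | 0 < t ∧ t < ℓ t} W fun _ => 0 :=
    (hs.trace_front.sub_continuous huc h.continuous_comp_max
      (fun t ht => by rw [max_eq_right ht.1.le]) (Or.inr rfl)
      (fun t ht => reprFun_front h ht.1 ht.2) hUm hloc.aestronglyMeasurable
      fun K hK hKI => h.eventually_front_mem hℓ₀ hK hKI).congr_on hWU
      fun K hK hKI => h.eventually_front_mem hℓ₀ hK hKI
  filter_upwards [ae_eq_zero_punctured h hWloc hW0 hC hP hL hR] with p hp hpU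
  have := hp hpU
  rw [← hWU p hpU] at this
  linarith

end Duhamel

end Debonding

/-- Duhamel's principle in the time-dependent domain `Ω'`. The continuous representatives of
`v₀ ∈ H¹(0, ℓ₀)` on `[0, ℓ₀]` and of `z` on `[0, ∞)` are meant. -/
theorem mainTheorem3
    (ν ℓ₀ : ℝ) (hν : 0 ≤ ν) (hℓ₀ : 0 < ℓ₀)
    (ℓ : ℝ → ℝ) (hℓ : Debonding.IsFront ℓ₀ ℓ)
    (z v₀ v₁ : ℝ → ℝ)
    (hz : ContinuousOn z (Ici 0)) (hz' : ∀ b : ℝ, 0 < b → Debonding.MemH1 0 b z)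
    (hv₀ : ContinuousOn v₀ (Icc 0 ℓ₀)) (hv₀' : Debonding.MemH1 0 ℓ₀ v₀)
    (hv₁ : MemLp v₁ 2 (volume.restrict (Ioo 0 ℓ₀)))
    (hcompat_left : v₀ 0 = z 0) (hcompat_right : v₀ ℓ₀ = 0)
    (v : ℝ × ℝ → ℝ) (hv : Debonding.MemHTilde1 ℓ₀ ℓ v) :
    Debonding.IsSolution ν ℓ₀ ℓ z v₀ v₁ v ↔
      ∀ᵐ p ∂(volume.restrict (Debonding.Omega' ℓ₀ ℓ)),
        v p = Debonding.dAlembert ℓ₀ ℓ z v₀ v₁ p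
          + ν ^ 2 / 8 * ∫ q in Debonding.region ℓ₀ ℓ p, v q := by
  have hv₁i : IntegrableOn v₁ (Ioo 0 ℓ₀) := hv₁.integrable one_le_two
  have hF : ∀ M : ℝ, IntegrableOn (Debonding.extendZero ℓ₀ ℓ v) {q | q.1 + q.2 < M} := by
    obtain ⟨vt, vx, -, -, hL2⟩ := hv
    exact hℓ.integrableOn_extendZero hℓ₀ fun T hT => (hL2 T hT).1
  have hrepr : (∀ᵐ p ∂(volume.restrict (Debonding.Omega' ℓ₀ ℓ)),
        v p = Debonding.dAlembert ℓ₀ ℓ z v₀ v₁ p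
          + ν ^ 2 / 8 * ∫ q in Debonding.region ℓ₀ ℓ p, v q) ↔
      ∀ᵐ p, p ∈ Debonding.punctured ℓ₀ ℓ → v p =
        Debonding.reprFun ℓ₀ ℓ z v₀ v₁ (ν ^ 2 / 8) (Debonding.extendZero ℓ₀ ℓ v) p := by
    rw [Measure.restrict_congr_set (hℓ.ae_eq_Omega' hℓ₀),
      ae_restrict_iff' hℓ.isOpen_punctured.measurableSet]
    refine eventually_congr (Eventually.of_forall fun p => forall_congr' fun hp => ?_)
    rw [Debonding.reprFun_eq hℓ hℓ₀ hv₁i hF _ hp]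
  rw [hrepr]
  exact ⟨fun hs => hs.ae_eq_reprFun hℓ hℓ₀ hz hv₀ hv₁i hcompat_left hcompat_right hv hF,
    Debonding.isSolution_of_ae_eq hℓ hℓ₀ hz hv₀ hv₁i hcompat_left hcompat_right hv hF⟩
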